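/- Let $\Bbbk$ be a commutative unital ring, $b,r\ge 0$, and $\underline N=(N_1,\dots,N_r)\in\mathbb N^r$. Let $\mathcal P^r_b$ be the set of $\rho=(b_0,\dots,b_r)\in\mathbb N^{r+1}$ with $\sum_i b_i=b$. **The algebra.** The dg-enhanced KLRW algebra $T^{\lambda,\underline N}_b$ is the $\Bbbk$-algebra spanned by braid-like diagrams (read from bottom to top, multiplied by vertical concatenation, the product being $0$ if the colours do not match) with one vertical blue strand on the far left, $b$ black strands, and $r$ red strands labelled $N_1,\dots,N_r$ from left to right. Red strands do not cross each other; black strands may cross black and red strands and may carry dots; a black strand that is leftmost may be nailed on the blue strand. For $\rho\in\mathcal P^r_b$, $1_\rho$ is the diagram of vertical strands: $b_0$ black, the first red, $b_1$ black, …, the $r$-th red, $b_r$ black. Write $\tau_i$ for the crossing of the strands in positions $i,i+1$ (counted from the left, without the blue strand), $x_i$ for a dot on the strand in position $i$ and $n$ for the nail. Diagrams are taken up to planar isotopy (distant pieces commute) and modulo the local relations, where colours are those at the bottom: * two black strands: $\tau_i^2=0$, $\tau_ix_i=x_{i+1}\tau_i+1$, $x_i\tau_i=\tau_ix_{i+1}+1$;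 * a red strand labelled $N$ and a black strand: dots slide freely through the crossing, and $\tau_i^2=x^N$, with $x$ the dot on the black strand; * three strands, at most one of them red: $\tau_i\tau_{i+1}\tau_i=\tau_{i+1}\tau_i\tau_{i+1}$, unless the middle strand is red, with label $N$, in which case $\tau_i\tau_{i+1}\tau_i=\tau_{i+1}\tau_i\tau_{i+1}+\sum_{m+\ell=N-1}x_i^m x_{i+2}^\ell$; * the nail: $nx_1=x_1n$, $n^2=0$, and $\tau_1n\tau_1n=-n\tau_1n\tau_1$ if the two leftmost strands are black. It is $\mathbb Z\times\mathbb Z^2$-graded by $\deg=(\deg_h,\deg_q,\deg_\lambda)$: a black/black crossing has degree $(0,-2,0)$, a dot $(0,2,0)$, a crossing of a black strand with a red strand labelled $N_i$ $(0,N_i,0)$, and a nail $(1,0,2)$. **The elements.** For $\kappa,\rho\in\mathcal P^r_b$ let ${}_\kappa S_\rho\subset S_{b+r}$ be the set of permutations which, drawn as diagrams whose strands are coloured by $1_\rho$ at the bottom and by $1_\kappa$ at the top, respect the colours and have no red/red crossing in a reduced expression. A reduced expression $\sigma_{i_1}\cdots\sigma_{i_m}$ is left-adjusted if $i_1+\cdots+i_m$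 is minimal among the reduced expressions of the same permutation. For $w\in{}_\kappa S_\rho$, $\underline l\in\{0,1\}^b$ and $\underline a\in\mathbb N^b$, the element $b_{w,\underline l,\underline a}\in 1_\kappa T^{\lambda,\underline N}_b1_\rho$ is obtained as follows: choose a left-adjusted expression of $w$; for each $i$ with $l_i=1$, at a height where the $i$-th black strand (counted from the left at the top) is at its leftmost position, pull that strand to the left over all the strands on its left, nail it once on the blue strand and pull it back, i.e. insert $\tau_{p-1}\cdots\tau_1\,n\,\tau_1\cdots\tau_{p-1}$, where $p$ is its position there; finally put $a_i$ dots on the $i$-th black strand at the top, for every $i$. **Theorem.** Let $\kappa,\rho\in\mathcal P^r_b$. For every $w\in{}_\kappa S_\rho$ and every $\underline l$ this construction can be carried out; and whatever choices are made in it for the pairs $(w,\underline l)$ (left-adjusted expression, heights and relative order of the nails), the family $b_{w,\underline l,\underline a}$, for $w\in{}_\kappa S_\rho$, $\underline l\in\{0,1\}^b$, $\underline a\in\mathbb N^b$, is a basis of $1_\kappa T^{\lambda,\underline N}_b1_\rho$ as a $\mathbb Z\times\mathbb Z^2$-graded $\Bbbk$-module: its elements are homogeneous and linearly independent over $\Bbbk$,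 they span $1_\kappa T^{\lambda,\underline N}_b1_\rho$, and for every degree $g$ those of degree $g$ span the part of degree $g$. -/

import Mathlib

/-!
Conventions.  A diagram has one blue strand on the far left (it never moves and is not numbered)
and `b + r` further strands, `b` black and `r` red.  The positions of these strands are numbered
`0, …, b + r - 1` from left to right, black strands are numbered `0, …, b - 1` and red strands
`0, …, r - 1`, both from left to right.  Diagrams are read from bottom to top; the product `x * y`
is `x` on top of `y`, and a word is listed from top to bottom.
-/

namespace KLRW

/-! ### Weak compositions and positions of strands -/

/-- Weak compositions `(b_0, …, b_r)` of `b` into `r + 1` parts. -/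
abbrev Comp (b r : ℕ) : Type :=
  {ρ : Fin (r + 1) → ℕ // ρ ∈ Finset.piAntidiag (Finset.univ : Finset (Fin (r + 1))) b}

/-- The number `b_0 + ⋯ + b_i` of black strands to the left of the `i`-th red strand in `1_ρ`. -/
def blacksBefore {b r : ℕ} (ρ : Comp b r) (i : Fin r) : ℕ :=
  ∑ j ∈ Finset.univ.filter (fun j : Fin (r + 1) => (j : ℕ) ≤ (i : ℕ)), ρ.1 j

/-- The position of the `i`-th red strand in `1_ρ`. -/
def redPos {b r : ℕ} (ρ : Comp b r) (i : Fin r) : ℕ :=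
  blacksBefore ρ i + i

/-- The position of the `k`-th black strand in `1_ρ`: it has to its left `k` black strands and
the red strands with at most `k` black strands to their left. -/
def blackPos {b r : ℕ} (ρ : Comp b r) (k : Fin b) : ℕ :=
  k + (Finset.univ.filter fun i : Fin r => blacksBefore ρ i ≤ (k : ℕ)).card

/-- Position `p` is occupied by a red strand of `1_ρ`. -/
def IsRed {b r : ℕ} (ρ : Comp b r) (p : ℕ) : Prop :=
  ∃ i : Fin r, redPos ρ i = p

/-- Position `p` is occupied by a black strand of `1_ρ`. -/
def IsBlack {b r : ℕ} (ρ : Comp b r) (p : ℕ) : Prop :=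
  p < b + r ∧ ¬ IsRed ρ p

/-! ### The algebra -/

/-- The elementary pieces of a diagram: a dot on the strand at position `p`, a crossing of the
strands at positions `i` and `i + 1`, and the nail of the leftmost strand on the blue strand. -/
inductive Letter where
  | dot (p : ℕ)
  | cross (i : ℕ)
  | nail

/-- Generators: the idempotents `1_ρ`, and the elementary pieces; an elementary piece stands for
the sum, over all `ρ` at the bottom for which it makes sense, of the corresponding diagrams. -/
inductive Gen (b r : ℕ) where
  | idem (ρ : Comp b r)
  | piece (a : Letter)

section Algebra

variable (k : Type*) [CommRing k] {b r : ℕ}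

/-- The idempotent `1_ρ` in the free algebra. -/
def fE (ρ : Comp b r) : FreeAlgebra k (Gen b r) := FreeAlgebra.ι k (Gen.idem ρ)

/-- The dot at position `p` in the free algebra. -/
def fX (p : ℕ) : FreeAlgebra k (Gen b r) := FreeAlgebra.ι k (Gen.piece (Letter.dot p))

/-- The crossing of positions `i` and `i + 1` in the free algebra. -/
def fC (i : ℕ) : FreeAlgebra k (Gen b r) := FreeAlgebra.ι k (Gen.piece (Letter.cross i))

/-- The nail in the free algebra. -/
def fN : FreeAlgebra k (Gen b r) := FreeAlgebra.ι k (Gen.piece Letter.nail)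

/-- The defining relations of the dg-enhanced KLRW algebra; in each local relation `ρ` is the
bottom of the diagrams. -/
inductive Rel (N : Fin r → ℕ) : FreeAlgebra k (Gen b r) → FreeAlgebra k (Gen b r) → Prop
  -- Idempotents.
  | idem_mul_self (ρ : Comp b r) : Rel N (fE k ρ * fE k ρ) (fE k ρ)
  | idem_mul_ne (κ ρ : Comp b r) (h : κ ≠ ρ) : Rel N (fE k κ * fE k ρ) 0
  | idem_sum : Rel N (∑ ρ : Comp b r, fE k ρ) 1
  -- Colours: which elementary pieces exist above `1_ρ`, and what their top is.
  | dot_idem (p : ℕ) (ρ : Comp b r) : Rel N (fX k p * fE k ρ) (fE k ρ * fX k p)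
  | dot_zero (p : ℕ) (ρ : Comp b r) (h : ¬ IsBlack ρ p) : Rel N (fX k p * fE k ρ) 0
  | cross_idem (i : ℕ) (κ ρ : Comp b r) (hi : i + 1 < b + r)
      (h : ∀ j : Fin r, redPos κ j = Equiv.swap i (i + 1) (redPos ρ j)) :
      Rel N (fC k i * fE k ρ) (fE k κ * fC k i)
  | cross_zero (i : ℕ) (ρ : Comp b r)
      (h : b + r ≤ i + 1 ∨ (IsRed ρ i ∧ IsRed ρ (i + 1))) : Rel N (fC k i * fE k ρ) 0
  | nail_idem (ρ : Comp b r) : Rel N (fN k * fE k ρ) (fE k ρ * fN k)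
  | nail_zero (ρ : Comp b r) (h : ¬ IsBlack ρ 0) : Rel N (fN k * fE k ρ) 0
  -- Planar isotopy: distant pieces commute (no two nails are distant, so there is no sign).
  | dot_dot (p q : ℕ) : Rel N (fX k p * fX k q) (fX k q * fX k p)
  | dot_cross (p i : ℕ) (h : p ≠ i) (h' : p ≠ i + 1) : Rel N (fX k p * fC k i) (fC k i * fX k p)
  | cross_cross (i j : ℕ) (h : i + 1 < j) : Rel N (fC k i * fC k j) (fC k j * fC k i)
  | nail_dot (p : ℕ) (h : 0 < p) : Rel N (fN k * fX k p) (fX k p * fN k)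
  | nail_cross (i : ℕ) (h : 0 < i) : Rel N (fN k * fC k i) (fC k i * fN k)
  -- The nilHecke relations.
  | cross_sq (i : ℕ) (ρ : Comp b r) (h₀ : IsBlack ρ i) (h₁ : IsBlack ρ (i + 1)) :
      Rel N (fC k i * fC k i * fE k ρ) 0
  | braid (i : ℕ) (ρ : Comp b r) (h₀ : IsBlack ρ i) (h₁ : IsBlack ρ (i + 1))
      (h₂ : IsBlack ρ (i + 2)) :
      Rel N (fC k i * fC k (i + 1) * fC k i * fE k ρ)
        (fC k (i + 1) * fC k i * fC k (i + 1) * fE k ρ)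
  | dot_slide_left (i : ℕ) (ρ : Comp b r) (h₀ : IsBlack ρ i) (h₁ : IsBlack ρ (i + 1)) :
      Rel N (fC k i * fX k i * fE k ρ) (fX k (i + 1) * fC k i * fE k ρ + fE k ρ)
  | dot_slide_right (i : ℕ) (ρ : Comp b r) (h₀ : IsBlack ρ i) (h₁ : IsBlack ρ (i + 1)) :
      Rel N (fX k i * fC k i * fE k ρ) (fC k i * fX k (i + 1) * fE k ρ + fE k ρ)
  -- The black/red relations.
  | dot_red_left (i : ℕ) (ρ : Comp b r) (h₀ : IsRed ρ i) (h₁ : IsBlack ρ (i + 1)) :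
      Rel N (fX k i * fC k i * fE k ρ) (fC k i * fX k (i + 1) * fE k ρ)
  | dot_red_right (i : ℕ) (ρ : Comp b r) (h₀ : IsBlack ρ i) (h₁ : IsRed ρ (i + 1)) :
      Rel N (fC k i * fX k i * fE k ρ) (fX k (i + 1) * fC k i * fE k ρ)
  | red_sq_left (i : ℕ) (ρ : Comp b r) (j : Fin r) (h₀ : redPos ρ j = i)
      (h₁ : IsBlack ρ (i + 1)) :
      Rel N (fC k i * fC k i * fE k ρ) (fX k (i + 1) ^ N j * fE k ρ)
  | red_sq_right (i : ℕ) (ρ : Comp b r) (j : Fin r) (h₀ : IsBlack ρ i)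
      (h₁ : redPos ρ j = i + 1) :
      Rel N (fC k i * fC k i * fE k ρ) (fX k i ^ N j * fE k ρ)
  | braid_red_left (i : ℕ) (ρ : Comp b r) (h₀ : IsRed ρ i) (h₁ : IsBlack ρ (i + 1))
      (h₂ : IsBlack ρ (i + 2)) :
      Rel N (fC k i * fC k (i + 1) * fC k i * fE k ρ)
        (fC k (i + 1) * fC k i * fC k (i + 1) * fE k ρ)
  | braid_red_right (i : ℕ) (ρ : Comp b r) (h₀ : IsBlack ρ i) (h₁ : IsBlack ρ (i + 1))
      (h₂ : IsRed ρ (i + 2)) :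
      Rel N (fC k i * fC k (i + 1) * fC k i * fE k ρ)
        (fC k (i + 1) * fC k i * fC k (i + 1) * fE k ρ)
  | braid_red_mid (i : ℕ) (ρ : Comp b r) (j : Fin r) (h₀ : IsBlack ρ i)
      (h₁ : redPos ρ j = i + 1) (h₂ : IsBlack ρ (i + 2)) :
      Rel N (fC k i * fC k (i + 1) * fC k i * fE k ρ)
        (fC k (i + 1) * fC k i * fC k (i + 1) * fE k ρ +
          ∑ m ∈ Finset.range (N j), fX k i ^ m * fX k (i + 2) ^ (N j - 1 - m) * fE k ρ)
  -- The relations of the nail.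
  | nail_dot_zero (ρ : Comp b r) (h₀ : IsBlack ρ 0) :
      Rel N (fN k * fX k 0 * fE k ρ) (fX k 0 * fN k * fE k ρ)
  | nail_nail (ρ : Comp b r) (h₀ : IsBlack ρ 0) (h₁ : IsBlack ρ 1) :
      Rel N (fC k 0 * fN k * fC k 0 * fN k * fE k ρ)
        (-(fN k * fC k 0 * fN k * fC k 0 * fE k ρ))
  | nail_sq (ρ : Comp b r) (h₀ : IsBlack ρ 0) : Rel N (fN k * fN k * fE k ρ) 0

/-- The dg-enhanced KLRW algebra `T_b^{λ,N}` over `k`. -/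
abbrev T (b : ℕ) {r : ℕ} (N : Fin r → ℕ) : Type _ := RingQuot (Rel k (b := b) N)

variable (N : Fin r → ℕ)

/-- The idempotent `1_ρ` of `T_b^{λ,N}`. -/
def idem (ρ : Comp b r) : T k b N := RingQuot.mkAlgHom k (Rel k N) (fE k ρ)

/-- The element of `T_b^{λ,N}` given by an elementary piece. -/
def piece (a : Letter) : T k b N :=
  RingQuot.mkAlgHom k (Rel k N) (FreeAlgebra.ι k (Gen.piece a))

/-- The diagram with bottom `1_ρ` obtained by stacking the pieces of the word `u`
(listed from top to bottom); it is zero if it is not a legal diagram. -/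
def diagram (ρ : Comp b r) (u : List Letter) : T k b N :=
  (u.map (piece k N)).prod * idem k N ρ

/-- The map `t ↦ 1_κ t 1_ρ`. -/
def corner (κ ρ : Comp b r) : T k b N →ₗ[k] T k b N :=
  LinearMap.mulLeftRight k (idem k N κ, idem k N ρ)

end Algebra

/-! ### The grading -/

/-- The permutation `σ_{i_1} ⋯ σ_{i_m}` of the positions, where `σ_i` exchanges `i` and `i + 1`:
the strand at the bottom position `p` of the diagram with these crossings (from top to bottom)
ends at the top in position `permOf [i_1, …, i_m] p`. -/
def permOf (u : List ℕ) : Equiv.Perm ℕ :=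
  (u.map fun i => Equiv.swap i (i + 1)).prod

/-- The crossings of a word. -/
def crossings (u : List Letter) : List ℕ :=
  u.filterMap fun a => match a with
    | Letter.cross i => some i
    | _ => none

/-- The degree `(h, q, λ)` of an elementary piece placed at a height where the red strands have
the positions `R`: a black/black crossing has `q`-degree `-2`, and a crossing of a black strand
with the `j`-th red strand has `q`-degree `N_j`. -/
def pieceDeg {r : ℕ} (N : Fin r → ℕ) (R : Fin r → ℕ) : Letter → ℤ × ℤ × ℤ
  | Letter.dot _ => (0, 2, 0)
  | Letter.cross i =>
      (0, if ∀ j, R j ≠ i ∧ R j ≠ i + 1 then -2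
        else ∑ j : Fin r with R j = i ∨ R j = i + 1, (N j : ℤ), 0)
  | Letter.nail => (1, 0, 2)

/-- The degree `(h, q, λ)` of the diagram `u` with bottom `1_ρ`. -/
def diagramDeg {b r : ℕ} (N : Fin r → ℕ) (ρ : Comp b r) : List Letter → ℤ × ℤ × ℤ
  | [] => 0
  | a :: u => pieceDeg N (fun j => permOf (crossings u) (redPos ρ j)) a + diagramDeg N ρ u

/-- The homogeneous part of degree `g` of `T_b^{λ,N}`: the span of the diagrams of degree `g`. -/
def homogeneousPart (k : Type*) [CommRing k] (b : ℕ) {r : ℕ} (N : Fin r → ℕ)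
    (g : ℤ × ℤ × ℤ) : Submodule k (T k b N) :=
  Submodule.span k {t | ∃ (ρ : Comp b r) (u : List Letter),
    diagramDeg N ρ u = g ∧ diagram k N ρ u = t}

/-! ### Left-adjusted expressions -/

/-- `u` is an expression of `w ∈ S_n` as a product of simple transpositions. -/
def IsExpression {n : ℕ} (w : Equiv.Perm (Fin n)) (u : List ℕ) : Prop :=
  (∀ i ∈ u, i + 1 < n) ∧ ∀ p : Fin n, permOf u p = w p

/-- `u` is a reduced expression of `w ∈ S_n`. -/
def IsReduced {n : ℕ} (w : Equiv.Perm (Fin n)) (u : List ℕ) : Prop :=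
  IsExpression w u ∧ ∀ u', IsExpression w u' → u.length ≤ u'.length

/-- `u` is a left-adjusted expression of `w ∈ S_n`: a reduced expression in which the sum of the
indices is minimal among all reduced expressions. -/
def IsLeftAdjusted {n : ℕ} (w : Equiv.Perm (Fin n)) (u : List ℕ) : Prop :=
  IsReduced w u ∧ ∀ u', IsReduced w u' → u.sum ≤ u'.sum

/-- The set `_κS_ρ` of permutations of the strands, ordered at the bottom by `1_ρ` and at the top
by `1_κ`, without red/red crossing: two strands cross in a reduced expression of `w` if and only
if `w` reverses their order. -/
def redOrdered {b r : ℕ} (κ ρ : Comp b r) : Set (Equiv.Perm (Fin (b + r))) :=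
  {w | (∀ p : Fin (b + r), IsRed κ (w p) ↔ IsRed ρ p) ∧
    ∀ p q : Fin (b + r), IsRed ρ p → IsRed ρ q → p < q → w p < w q}

/-! ### The elements of the basis -/

/-- Building blocks of the basis elements: a crossing, and the tightened nail of the strand at
position `p`. -/
inductive Block where
  | cross (i : ℕ)
  | theta (p : ℕ)

/-- The crossings of a word of blocks, the tightened nails being removed. -/
def blockCrossings (v : List Block) : List ℕ :=
  v.filterMap fun a => match a with
    | Block.cross i => some i
    | Block.theta _ => none

/-- The strands (given by their bottom positions) that are nailed in a word of blocks.  A tightened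
nail brings its strand back to where it was, so that only the blocks `cross` move strands. -/
def nailedStrands : List Block → List ℕ
  | [] => []
  | Block.cross _ :: v => nailedStrands v
  | Block.theta p :: v => (permOf (blockCrossings v)).symm p :: nailedStrands v

/-- The diagram of a block.  The tightened nail at position `p` pulls the strand at position `p`
to the left over all strands on its left, nails it on the blue strand, and pulls it back. -/
def Block.letters : Block → List Letter
  | Block.cross i => [Letter.cross i]
  | Block.theta p =>
      (List.range p).reverse.map Letter.cross ++ [Letter.nail] ++ (List.range p).map Letter.cross

/-- `v` is obtained from a left-adjusted expression of `w` by nailing (once each), for every `i`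
with `l i = 1`, the `i`-th black strand at the top, from its leftmost position.  All the choices
left open by this description are allowed: the left-adjusted expression, the height at which a
strand is nailed among those where it is at its leftmost position, and the relative order of
the nails. -/
structure IsNailing {b r : ℕ} (κ : Comp b r) (w : Equiv.Perm (Fin (b + r)))
    (l : Fin b → Fin 2) (v : List Block) : Prop where
  leftAdjusted : IsLeftAdjusted w (blockCrossings v)
  nodup : (nailedStrands v).Nodup
  nailed : ∀ s : ℕ, s ∈ nailedStrands v ↔
    ∃ i : Fin b, l i = 1 ∧ permOf (blockCrossings v) s = blackPos κ i
  leftmost : ∀ (v₁ v₂ : List Block) (p : ℕ), v = v₁ ++ Block.theta p :: v₂ →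
    ∀ u : List ℕ, u <:+ blockCrossings v →
      p ≤ permOf u ((permOf (blockCrossings v₂)).symm p)

/-- `a i` dots on the `i`-th black strand of `1_κ`, for all `i`. -/
def dotLetters {b r : ℕ} (κ : Comp b r) (a : Fin b → ℕ) : List Letter :=
  (List.ofFn fun i : Fin b => List.replicate (a i) (Letter.dot (blackPos κ i))).flatten

/-- The word of the diagram `b_{w,l,a}`, where `v` is the nailed left-adjusted expression chosen
for `w` and `l`: the dots are put on top of `v`. -/
def basisWord {b r : ℕ} (κ : Comp b r) (v : List Block) (a : Fin b → ℕ) : List Letter :=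
  dotLetters κ a ++ v.flatMap Block.letters

/-- The index set of the basis: triples `(w, l, a)`. -/
abbrev BasisIndex {b r : ℕ} (κ ρ : Comp b r) : Type :=
  redOrdered κ ρ × (Fin b → Fin 2) × (Fin b → ℕ)

end KLRW

/-!
Forgetting the dots, a diagram is a word in the simple reflections of the Coxeter group of type `B`
acting on `b + r` strands: a crossing exchanges two neighbours and the nail changes the sign of the
leftmost strand.  The pairs `(w, l)` are exactly the signed permutations that are compatible with
the colours and neither nail nor permute the red strands, and the theorem says that reduced words of
these, with dots on top, form a basis.

*The chosen words are reduced.*  In a left-adjusted expression a strand never moves left after it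
has moved right (`IsLeftAdjusted.not_right_left`).  Hence, at a height where a strand is at its
leftmost position, the strands on its left are those that started on its left and have not crossed
it, and above that height it never moves left.  So each letter of its tightened nail, and each
crossing above it, increases the length of type `B` (`IsNailing.ascending`).  Such words exist by
`exists_isNailing`.

*Spanning.*  Modulo diagrams of the same degree with fewer crossings and nails, dots slide to the
top, squares of crossings and nails vanish, and the braid relations of type `B` hold up to a unit
(`eqv_braid`, `eqv_cross_cross`, `eqv_nail_cross`, `eqv_nail_four`).  Matsumoto's argument then shows
that two reduced words of the same signed permutation agree up to a unit modulo such diagrams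
(`eqv_of_reduced`), and that words that are not reduced are combinations of such diagrams
(`low_of_not_reduced`).  An induction gives `Path.mem_span`.  All reductions preserve the degree,
which yields the graded statement at the same time.

*Linear independence.* The algebra acts from the right on functions on the arrangements of the
strands, with values in an exterior algebra on `b` generators over the total ring of fractions `K`
of a polynomial ring over `k`: the dots act by the variables, the crossings of black strands by
divided differences `(φ + φ ∘ s) / (x - y)`, those of a black and a red strand by exchanging them,
with a factor `x ^ N` for one of the two orders, and the nail by creation operators (`genericData`,
`act_rel`). Apply this to the function supported at the arrangement `1_κ`, with value `1`. Dots at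
the top then act by scalars (`row_basisWord`). Over `K` the translates of this function generate all
functions on the arrangements with the colours of `1_ρ`, since a crossing combines two neighbouring
arrangements with an invertible coefficient (`reach_extendPerm`). So the elements `b_{w,l,0}` give
generators of a free `K`-module (`span_evalAt_row`), and there are as many of them as its rank; over
a commutative ring such generators are linearly independent. As the monomials in the variables are
linearly independent over `k`, so are the elements `b_{w,l,a}`.
-/

namespace KLRW

/-! ### Positions of the strands -/

section Positions

variable {b r : ℕ}

lemma comp_sum (ρ : Comp b r) : ∑ j, ρ.1 j = b :=
  (Finset.mem_piAntidiag.1 ρ.2).1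

lemma blacksBefore_eq_sum_range (ρ : Comp b r) (i : Fin r) :
    blacksBefore ρ i = ∑ j ∈ Finset.range (i + 1), if h : j < r + 1 then ρ.1 ⟨j, h⟩ else 0 := by
  unfold blacksBefore
  refine Finset.sum_bij (fun j _ => (j : ℕ)) ?_ ?_ ?_ ?_
  · intro j hj
    simp only [Finset.mem_filter, Finset.mem_univ, true_and] at hj
    simp only [Finset.mem_range]
    omega
  · intro j _ j' _ h
    exact Fin.ext h
  · intro j hj
    rw [Finset.mem_range] at hj
    exact ⟨⟨j, by omega⟩, by simp; omega, rfl⟩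
  · intro j _
    rw [dif_pos j.2]

lemma comp_sum_range (ρ : Comp b r) :
    ∑ j ∈ Finset.range (r + 1), (if h : j < r + 1 then ρ.1 ⟨j, h⟩ else 0) = b := by
  rw [Finset.sum_range]
  exact (Finset.sum_congr rfl fun j _ => by rw [dif_pos j.2]).trans (comp_sum ρ)

lemma blacksBefore_mono (ρ : Comp b r) : Monotone (blacksBefore ρ) := by
  intro i j h
  unfold blacksBefore
  apply Finset.sum_le_sum_of_subset
  intro x hx
  simp only [Finset.mem_filter, Finset.mem_univ, true_and] at hx ⊢
  exact hx.trans h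

lemma blacksBefore_le (ρ : Comp b r) (i : Fin r) : blacksBefore ρ i ≤ b := by
  exact (Finset.sum_le_sum_of_subset (Finset.filter_subset _ _)).trans_eq (comp_sum ρ)

lemma redPos_lt (ρ : Comp b r) (i : Fin r) : redPos ρ i < b + r := by
  have := blacksBefore_le ρ i
  unfold redPos
  omega

lemma redPos_strictMono (ρ : Comp b r) : StrictMono (redPos ρ) := by
  intro i j h
  have := blacksBefore_mono ρ h.le
  have h' : (i : ℕ) < j := h
  unfold redPos
  omega

lemma redPos_injective (ρ : Comp b r) : Function.Injective (redPos ρ) :=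
  (redPos_strictMono ρ).injective

/-- A composition is determined by the positions of the red strands. -/
lemma comp_ext {ρ κ : Comp b r} (h : ∀ j, redPos ρ j = redPos κ j) : ρ = κ := by
  have key : ∀ m ≤ r + 1,
      ∑ j ∈ Finset.range m, (if h : j < r + 1 then ρ.1 ⟨j, h⟩ else 0) =
        ∑ j ∈ Finset.range m, (if h : j < r + 1 then κ.1 ⟨j, h⟩ else 0) := by
    intro m hm
    rcases Nat.lt_or_ge r m with h1 | h1
    · obtain rfl : m = r + 1 := by omega
      rw [comp_sum_range, comp_sum_range]
    · rcases m with _ | m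
      · simp
      · have := h ⟨m, by omega⟩
        unfold redPos at this
        rw [blacksBefore_eq_sum_range, blacksBefore_eq_sum_range] at this
        simpa using this
  apply Subtype.ext
  funext j
  have h1 := key (j + 1) (by omega)
  have h2 := key j (by omega)
  rw [Finset.sum_range_succ, Finset.sum_range_succ, h2] at h1
  simpa only [dif_pos j.2, add_right_inj] using h1

/-- Any increasing choice of positions is the set of positions of the red strands of a
composition. -/
lemma exists_comp_redPos (R : Fin r → ℕ) (hR : StrictMono R) (hlt : ∀ j, R j < b + r) :
    ∃ ρ : Comp b r, ∀ j, redPos ρ j = R j := by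
  -- the partial sums of the composition
  let S : ℕ → ℕ := fun m => if h : m - 1 < r ∧ 0 < m then R ⟨m - 1, h.1⟩ - (m - 1) else
    if m = 0 then 0 else b
  have hge : ∀ (m : ℕ) (h : m < r), m ≤ R ⟨m, h⟩ := by
    intro m
    induction m with
    | zero => intro h; exact Nat.zero_le _
    | succ m ih =>
      intro h
      have h1 := ih (by omega)
      have h2 : R ⟨m, by omega⟩ < R ⟨m + 1, h⟩ := hR (by simp [Fin.lt_def])
      omega
  have hub : ∀ (m : ℕ) (h : m < r), R ⟨m, h⟩ + (r - m) ≤ b + r := by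
    intro m h
    obtain ⟨d, hd⟩ : ∃ d, r = m + 1 + d := ⟨r - (m + 1), by omega⟩
    induction d generalizing m with
    | zero => have := hlt ⟨m, h⟩; omega
    | succ d ih =>
      have h1 := ih (m + 1) (by omega) (by omega)
      have h2 : R ⟨m, h⟩ < R ⟨m + 1, by omega⟩ := hR (by simp [Fin.lt_def])
      omega
  have hS0 : S 0 = 0 := by simp [S]
  have hS1 : ∀ (m : ℕ) (h : m < r), S (m + 1) = R ⟨m, h⟩ - m := by
    intro m h; simp [S, h]
  have hSr : S (r + 1) = b := by simp [S]
  have hmono : ∀ m ≤ r, S m ≤ S (m + 1) := by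
    intro m hm
    rcases m with _ | m
    · rw [hS0]; exact Nat.zero_le _
    · rw [hS1 m (by omega)]
      rcases Nat.lt_or_ge (m + 1) r with h | h
      · rw [hS1 (m + 1) h]
        have h2 : R ⟨m, by omega⟩ < R ⟨m + 1, h⟩ := hR (by simp [Fin.lt_def])
        omega
      · have e : m + 1 = r := by omega
        rw [e, hSr]
        have := hub m (by omega)
        omega
  have htel : ∀ m ≤ r + 1, ∑ j ∈ Finset.range m, (S (j + 1) - S j) = S m := by
    intro m
    induction m with
    | zero => intro _; simp [hS0]
    | succ m ih =>
      intro h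
      rw [Finset.sum_range_succ, ih (by omega)]
      have := hmono m (by omega)
      omega
  refine ⟨⟨fun j => S (j + 1) - S j, ?_⟩, ?_⟩
  · rw [Finset.mem_piAntidiag]
    refine ⟨?_, by simp⟩
    rw [← hSr, ← htel (r + 1) le_rfl, Finset.sum_range]
  · intro j
    unfold redPos
    rw [blacksBefore_eq_sum_range]
    have : ∑ m ∈ Finset.range (j + 1),
        (if h : m < r + 1 then S (m + 1) - S m else 0) = S (j + 1) := by
      rw [← htel (j + 1) (by omega)]
      refine Finset.sum_congr rfl fun m hm => ?_
      rw [Finset.mem_range] at hm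
      rw [dif_pos (by omega)]
    rw [show ((j : ℕ) + 1) = ↑j + 1 from rfl] at this
    simp only [this]
    rw [hS1 j j.2]
    have := hge j j.2
    simp only [Fin.eta] at this ⊢
    omega

lemma isRed_lt {ρ : Comp b r} {p : ℕ} (h : IsRed ρ p) : p < b + r := by
  obtain ⟨j, rfl⟩ := h
  exact redPos_lt ρ j

lemma swap_lt {n i p : ℕ} (hi : i + 1 < n) (hp : p < n) : Equiv.swap i (i + 1) p < n := by
  rw [Equiv.swap_apply_def]
  split_ifs <;> omega

/-- Exchanging two neighbouring strands that are not both red yields a composition again. -/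
lemma exists_comp_swap (ρ : Comp b r) {i : ℕ} (hi : i + 1 < b + r)
    (h : ¬ (IsRed ρ i ∧ IsRed ρ (i + 1))) :
    ∃ κ : Comp b r, ∀ j, redPos κ j = Equiv.swap i (i + 1) (redPos ρ j) := by
  refine exists_comp_redPos _ ?_ fun j => swap_lt hi (redPos_lt ρ j)
  intro j j' hj
  have h1 := redPos_strictMono ρ hj
  have h2 : ¬ (redPos ρ j = i ∧ redPos ρ j' = i + 1) := fun e => h ⟨⟨j, e.1⟩, ⟨j', e.2⟩⟩
  simp only [Equiv.swap_apply_def]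
  split_ifs <;> omega

lemma blackPos_lt (ρ : Comp b r) (i : Fin b) : blackPos ρ i < b + r := by
  have : (Finset.univ.filter fun j : Fin r => blacksBefore ρ j ≤ (i : ℕ)).card ≤ r := by
    simpa using Finset.card_filter_le (Finset.univ : Finset (Fin r)) _
  unfold blackPos
  omega

lemma blackPos_strictMono (ρ : Comp b r) : StrictMono (blackPos ρ) := by
  intro i j h
  have h' : (i : ℕ) < j := h
  have : (Finset.univ.filter fun m : Fin r => blacksBefore ρ m ≤ (i : ℕ)).card ≤
      (Finset.univ.filter fun m : Fin r => blacksBefore ρ m ≤ (j : ℕ)).card := by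
    apply Finset.card_le_card
    intro m hm
    simp only [Finset.mem_filter, Finset.mem_univ, true_and] at hm ⊢
    omega
  unfold blackPos
  omega

lemma isBlack_blackPos (ρ : Comp b r) (i : Fin b) : IsBlack ρ (blackPos ρ i) := by
  refine ⟨blackPos_lt ρ i, ?_⟩
  rintro ⟨j, hj⟩
  unfold redPos blackPos at hj
  by_cases h : blacksBefore ρ j ≤ i
  · have h1 : (Finset.Iic j).card ≤
        (Finset.univ.filter fun m : Fin r => blacksBefore ρ m ≤ (i : ℕ)).card := by
      apply Finset.card_le_card
      intro m hm
      simp only [Finset.mem_filter, Finset.mem_univ, true_and, Finset.mem_Iic] at hm ⊢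
      exact (blacksBefore_mono ρ hm).trans h
    rw [Fin.card_Iic] at h1
    omega
  · have h1 : (Finset.univ.filter fun m : Fin r => blacksBefore ρ m ≤ (i : ℕ)).card ≤
        (Finset.Iio j).card := by
      apply Finset.card_le_card
      intro m hm
      simp only [Finset.mem_filter, Finset.mem_univ, true_and, Finset.mem_Iio] at hm ⊢
      by_contra hc
      exact h ((blacksBefore_mono ρ (not_lt.1 hc)).trans hm)
    rw [Fin.card_Iio] at h1
    omega

/-- The black strands are exactly those at the positions `blackPos`. -/
lemma exists_blackPos {ρ : Comp b r} {p : ℕ} (h : IsBlack ρ p) : ∃ i, blackPos ρ i = p := by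
  classical
  by_contra hc
  have hsub : insert p (Finset.univ.image (blackPos ρ) ∪ Finset.univ.image (redPos ρ)) ⊆
      Finset.range (b + r) := by
    intro q hq
    simp only [Finset.mem_insert, Finset.mem_union, Finset.mem_image, Finset.mem_univ,
      true_and] at hq
    rw [Finset.mem_range]
    rcases hq with rfl | ⟨i, rfl⟩ | ⟨j, rfl⟩
    exacts [h.1, blackPos_lt ρ i, redPos_lt ρ j]
  have h1 := Finset.card_le_card hsub
  rw [Finset.card_insert_of_notMem, Finset.card_union_of_disjoint,
    Finset.card_image_of_injective _ (blackPos_strictMono ρ).injective,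
    Finset.card_image_of_injective _ (redPos_injective ρ)] at h1
  · simp at h1
  · rw [Finset.disjoint_left]
    intro q hq hq'
    simp only [Finset.mem_image, Finset.mem_univ, true_and] at hq hq'
    obtain ⟨i, rfl⟩ := hq
    exact (isBlack_blackPos ρ i).2 hq'
  · simp only [Finset.mem_union, Finset.mem_image, Finset.mem_univ, true_and, not_or]
    exact ⟨hc, h.2⟩

end Positions

/-! ### Signed arrangements -/

/-- An arrangement `f` of strands records at each position the number (counted from `1`) of the
strand, with a minus sign if it has been nailed an odd number of times.  A crossing exchanges two
neighbours, the nail changes the sign of the leftmost strand: these are the simple reflections of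
the Coxeter group of type `B`. -/
def signedStep : Letter → (ℕ → ℤ) → ℕ → ℤ
  | Letter.dot _, f => f
  | Letter.cross i, f => f ∘ Equiv.swap i (i + 1)
  | Letter.nail, f => Function.update f 0 (-f 0)

/-- The arrangement at the top of a word, if the strands are numbered `1, 2, …` at the bottom. -/
def signedState (u : List Letter) : ℕ → ℤ :=
  u.foldr signedStep fun p => p + 1

@[simp] lemma signedState_nil : signedState [] = fun p : ℕ => (p : ℤ) + 1 := rfl

@[simp] lemma signedState_cons (a : Letter) (u : List Letter) :
    signedState (a :: u) = signedStep a (signedState u) := rfl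

lemma signedStep_signedStep (a : Letter) (f : ℕ → ℤ) :
    signedStep a (signedStep a f) = f := by
  cases a with
  | dot p => rfl
  | cross i => funext p; simp [signedStep]
  | nail => simp [signedStep]

/-- The contribution of position `n` to the length of an arrangement. -/
def lengthAt (f : ℕ → ℤ) (n : ℕ) : ℕ :=
  ∑ p ∈ Finset.range n, ((if f n < f p then 1 else 0) + (if f p + f n < 0 then 1 else 0)) +
    if f n < 0 then 1 else 0

/-- The Coxeter length of type `B` of an arrangement of `n` strands: the number of pairs
`p < q` with `f q < f p`, plus that of pairs with `f p + f q < 0`, plus that of negative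
entries. -/
def signedLength (n : ℕ) (f : ℕ → ℤ) : ℕ := ∑ m ∈ Finset.range n, lengthAt f m

lemma signedLength_init (n : ℕ) : signedLength n (fun p => p + 1) = 0 := by
  refine Finset.sum_eq_zero fun m _ => ?_
  simp only [lengthAt]
  rw [if_neg (by omega), add_zero]
  refine Finset.sum_eq_zero fun p hp => ?_
  rw [Finset.mem_range] at hp
  rw [if_neg (by omega), if_neg (by omega)]
  rfl

lemma lengthAt_cross (f : ℕ → ℤ) {i n : ℕ} (h : i + 1 < n) :
    lengthAt (f ∘ Equiv.swap i (i + 1)) n = lengthAt f n := by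
  have hn : Equiv.swap i (i + 1) n = n :=
    Equiv.swap_apply_of_ne_of_ne (by omega) (by omega)
  unfold lengthAt
  simp only [Function.comp, hn]
  congr 1
  refine Finset.sum_equiv (Equiv.swap i (i + 1)) (fun p => ?_) fun p _ => rfl
  rw [Finset.mem_range, Finset.mem_range, Equiv.swap_apply_def]
  split_ifs <;> omega

lemma signedLength_cross (f : ℕ → ℤ) {i n : ℕ} (h : i + 1 < n) (hf : f i < f (i + 1)) :
    signedLength n (f ∘ Equiv.swap i (i + 1)) = signedLength n f + 1 := by
  obtain ⟨d, rfl⟩ : ∃ d, n = i + 2 + d := ⟨n - (i + 2), by omega⟩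
  clear h
  induction d with
  | zero =>
    have hlow : ∀ p ∈ Finset.range i, (f ∘ Equiv.swap i (i + 1)) p = f p := by
      intro p hp
      rw [Finset.mem_range] at hp
      simp only [Function.comp]
      rw [Equiv.swap_apply_of_ne_of_ne (by omega) (by omega)]
    have h0 : (f ∘ Equiv.swap i (i + 1)) i = f (i + 1) := by simp
    have h1 : (f ∘ Equiv.swap i (i + 1)) (i + 1) = f i := by simp
    have e1 : ∑ m ∈ Finset.range i, lengthAt (f ∘ Equiv.swap i (i + 1)) m =
        ∑ m ∈ Finset.range i, lengthAt f m := by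
      refine Finset.sum_congr rfl fun m hm => ?_
      unfold lengthAt
      rw [hlow m hm]
      congr 1
      refine Finset.sum_congr rfl fun p hp => ?_
      rw [hlow p]
      simp only [Finset.mem_range] at hp hm ⊢
      omega
    have e2 : ∀ z : ℤ, ∑ p ∈ Finset.range i,
        ((if z < (f ∘ Equiv.swap i (i + 1)) p then 1 else 0) +
          (if (f ∘ Equiv.swap i (i + 1)) p + z < 0 then 1 else 0)) =
        ∑ p ∈ Finset.range i, ((if z < f p then 1 else 0) + (if f p + z < 0 then 1 else 0)) := by
      intro z
      exact Finset.sum_congr rfl fun p hp => by rw [hlow p hp]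
    unfold signedLength
    simp only [add_zero, Finset.sum_range_succ, e1]
    unfold lengthAt
    simp only [Finset.sum_range_succ, e2, h0, h1]
    rw [if_pos hf, if_neg (not_lt.2 hf.le), add_comm (f (i + 1)) (f i)]
    ring
  | succ d ih =>
    have e : i + 2 + (d + 1) = (i + 2 + d) + 1 := rfl
    unfold signedLength at ih ⊢
    rw [e, Finset.sum_range_succ, Finset.sum_range_succ, ih, lengthAt_cross f (by omega)]
    ring

lemma signedLength_nail (f : ℕ → ℤ) {n : ℕ} (h : 0 < n) (hf : 0 < f 0) :
    signedLength n (Function.update f 0 (-f 0)) = signedLength n f + 1 := by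
  obtain ⟨d, rfl⟩ : ∃ d, n = d + 1 := ⟨n - 1, by omega⟩
  unfold signedLength
  rw [Finset.sum_range_succ', Finset.sum_range_succ']
  have e : ∀ m, lengthAt (Function.update f 0 (-f 0)) (m + 1) = lengthAt f (m + 1) := by
    intro m
    unfold lengthAt
    have h1 : ∀ p : ℕ, Function.update f 0 (-f 0) (p + 1) = f (p + 1) := fun p => by simp
    simp only [Finset.sum_range_succ', h1, Function.update_self]
    congr 2
    rw [add_comm]
    congr 1 <;> refine if_congr ?_ rfl rfl <;> constructor <;> intro _ <;> omega
  simp only [e]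
  simp only [lengthAt, Function.update_self, Finset.range_zero, Finset.sum_empty, zero_add]
  rw [if_pos (by omega), if_neg (by omega), add_zero]

/-- The letter `a`, put on top of the arrangement `f` of `n` strands, increases the length. -/
def Ascent (n : ℕ) : Letter → (ℕ → ℤ) → Prop
  | Letter.dot _, _ => False
  | Letter.cross i, f => i + 1 < n ∧ f i < f (i + 1)
  | Letter.nail, f => 0 < n ∧ 0 < f 0

/-- The letter `a`, put on top of the arrangement `f` of `n` strands, decreases the length. -/
def Descent (n : ℕ) : Letter → (ℕ → ℤ) → Prop
  | Letter.dot _, _ => False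
  | Letter.cross i, f => i + 1 < n ∧ f (i + 1) < f i
  | Letter.nail, f => 0 < n ∧ f 0 < 0

lemma Ascent.signedLength {n : ℕ} {a : Letter} {f : ℕ → ℤ} (h : Ascent n a f) :
    signedLength n (signedStep a f) = signedLength n f + 1 := by
  cases a with
  | dot p => exact h.elim
  | cross i => exact signedLength_cross f h.1 h.2
  | nail => exact signedLength_nail f h.1 h.2

lemma Descent.ascent {n : ℕ} {a : Letter} {f : ℕ → ℤ} (h : Descent n a f) :
    Ascent n a (signedStep a f) := by
  cases a with
  | dot p => exact h.elim
  | cross i => exact ⟨h.1, by simpa [signedStep] using h.2⟩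
  | nail => exact ⟨h.1, by simpa [signedStep] using h.2⟩

lemma Descent.signedLength {n : ℕ} {a : Letter} {f : ℕ → ℤ} (h : Descent n a f) :
    signedLength n f = signedLength n (signedStep a f) + 1 := by
  have := h.ascent.signedLength
  rwa [signedStep_signedStep] at this

section Legal

variable {b r : ℕ}

/-- The elementary piece `a` exists above `1_κ` and its top is `1_κ'`. -/
def Step : Letter → Comp b r → Comp b r → Prop
  | Letter.dot p, κ, κ' => IsBlack κ p ∧ κ' = κ
  | Letter.cross i, κ, κ' => i + 1 < b + r ∧ ¬ (IsRed κ i ∧ IsRed κ (i + 1)) ∧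
      ∀ j, redPos κ' j = Equiv.swap i (i + 1) (redPos κ j)
  | Letter.nail, κ, κ' => IsBlack κ 0 ∧ κ' = κ

/-- The word `u` is a legal diagram with bottom `1_ρ` and top `1_κ`. -/
def Path (ρ : Comp b r) : Comp b r → List Letter → Prop
  | κ, [] => κ = ρ
  | κ, a :: u => ∃ κ', Path ρ κ' u ∧ Step a κ' κ

/-- A letter is a crossing or the nail, not a dot. -/
def NotDot : Letter → Prop
  | Letter.dot _ => False
  | _ => True

/-- The arrangement `f` is a signed permutation of `b + r` strands whose colours are those of
`1_ρ` at the bottom and of `1_κ` at the top, such that the red strands are neither nailed nor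
permuted.  Beyond the `b + r` strands it is trivial. -/
structure Colours (ρ κ : Comp b r) (f : ℕ → ℤ) : Prop where
  abs_le : ∀ p < b + r, 1 ≤ |f p| ∧ |f p| ≤ (b + r : ℕ)
  abs_inj : ∀ p < b + r, ∀ q < b + r, |f p| = |f q| → p = q
  out : ∀ p, b + r ≤ p → f p = p + 1
  red : ∀ j, f (redPos κ j) = redPos ρ j + 1

lemma colours_init (ρ : Comp b r) : Colours ρ ρ (fun p => p + 1) where
  abs_le p hp := by rw [abs_of_nonneg (by positivity)]; omega
  abs_inj p _ q _ h := by
    rw [abs_of_nonneg (by positivity), abs_of_nonneg (by positivity)] at h; omega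
  out p _ := rfl
  red j := rfl

lemma Colours.ne {ρ κ : Comp b r} {f : ℕ → ℤ} (h : Colours ρ κ f) {p q : ℕ} (hp : p < b + r)
    (hq : q < b + r) (hpq : p ≠ q) : f p ≠ f q :=
  fun e => hpq (h.abs_inj p hp q hq (by rw [e]))

lemma Colours.ne_zero {ρ κ : Comp b r} {f : ℕ → ℤ} (h : Colours ρ κ f) {p : ℕ}
    (hp : p < b + r) : f p ≠ 0 := fun e => by
  have := (h.abs_le p hp).1
  rw [e] at this
  simp at this

lemma Step.redPos_eq {a : Letter} {κ κ' : Comp b r} (h : Step a κ κ') (j : Fin r) :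
    redPos κ' j = permOf (crossings [a]) (redPos κ j) := by
  cases a with
  | dot p => rw [h.2]; rfl
  | cross i => rw [h.2.2 j]; simp [crossings, permOf]
  | nail => rw [h.2]; rfl

lemma Step.unique {a : Letter} {κ κ₁ κ₂ : Comp b r} (h₁ : Step a κ κ₁) (h₂ : Step a κ κ₂) :
    κ₁ = κ₂ :=
  comp_ext fun j => by rw [h₁.redPos_eq, h₂.redPos_eq]

lemma Step.unique' {a : Letter} {κ κ₁ κ₂ : Comp b r} (h₁ : Step a κ₁ κ) (h₂ : Step a κ₂ κ) :
    κ₁ = κ₂ :=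
  comp_ext fun j => (permOf (crossings [a])).injective (by rw [← h₁.redPos_eq, ← h₂.redPos_eq])

lemma isRed_swap {κ κ' : Comp b r} {i : ℕ}
    (h : ∀ j, redPos κ' j = Equiv.swap i (i + 1) (redPos κ j)) (p : ℕ) :
    IsRed κ' p ↔ IsRed κ (Equiv.swap i (i + 1) p) := by
  constructor
  · rintro ⟨j, rfl⟩
    exact ⟨j, by rw [h j, Equiv.swap_apply_self]⟩
  · rintro ⟨j, hj⟩
    exact ⟨j, by rw [h j, hj, Equiv.swap_apply_self]⟩

lemma isBlack_swap {κ κ' : Comp b r} {i : ℕ} (hi : i + 1 < b + r)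
    (h : ∀ j, redPos κ' j = Equiv.swap i (i + 1) (redPos κ j)) (p : ℕ) :
    IsBlack κ' p ↔ IsBlack κ (Equiv.swap i (i + 1) p) := by
  unfold IsBlack
  rw [isRed_swap h]
  have h1 : p < b + r → Equiv.swap i (i + 1) p < b + r := swap_lt hi
  have h2 : Equiv.swap i (i + 1) p < b + r → p < b + r := fun h => by
    simpa using swap_lt hi h
  tauto

/-- The mirror image of an elementary piece is an elementary piece. -/
lemma Step.symm {a : Letter} {κ κ' : Comp b r} (h : Step a κ κ') : Step a κ' κ := by
  cases a with
  | dot p => obtain ⟨h1, rfl⟩ := h; exact ⟨h1, rfl⟩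
  | cross i =>
    refine ⟨h.1, ?_, fun j => by rw [h.2.2 j, Equiv.swap_apply_self]⟩
    have := h.2.1
    rw [isRed_swap h.2.2, isRed_swap h.2.2]
    simpa [and_comm] using this
  | nail => obtain ⟨h1, rfl⟩ := h; exact ⟨h1, rfl⟩

lemma Colours.step {ρ κ κ' : Comp b r} {f : ℕ → ℤ} (h : Colours ρ κ f) {a : Letter}
    (ha : Step a κ κ') : Colours ρ κ' (signedStep a f) := by
  cases a with
  | dot p => obtain ⟨-, rfl⟩ := ha; exact h
  | cross i =>
    have hi := ha.1
    refine ⟨fun p hp => h.abs_le _ (swap_lt hi hp), fun p hp q hq e => ?_, fun p hp => ?_,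
      fun j => ?_⟩
    · exact (Equiv.swap i (i + 1)).injective (h.abs_inj _ (swap_lt hi hp) _ (swap_lt hi hq) e)
    · simp only [signedStep, Function.comp]
      rw [Equiv.swap_apply_of_ne_of_ne (by omega) (by omega), h.out p hp]
    · simp only [signedStep, Function.comp]
      rw [ha.2.2 j, Equiv.swap_apply_self, h.red]
  | nail =>
    obtain ⟨h0, rfl⟩ := ha
    have habs : ∀ p, |Function.update f 0 (-f 0) p| = |f p| := by
      intro p
      by_cases hp : p = 0
      · subst hp; simp
      · rw [Function.update_of_ne hp]
    refine ⟨fun p hp => ?_, fun p hp q hq e => ?_, fun p hp => ?_, fun j => ?_⟩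
    · simp only [signedStep, habs]; exact h.abs_le p hp
    · simp only [signedStep, habs] at e; exact h.abs_inj p hp q hq e
    · have := h0.1
      simp only [signedStep]
      rw [Function.update_of_ne (by omega), h.out p hp]
    · have : redPos κ' j ≠ 0 := fun e => h0.2 ⟨j, e⟩
      simp only [signedStep]
      rw [Function.update_of_ne this, h.red]

lemma Path.colours {ρ κ : Comp b r} {u : List Letter} (h : Path ρ κ u) :
    Colours ρ κ (signedState u) := by
  induction u generalizing κ with
  | nil => obtain rfl : κ = ρ := h; exact colours_init _
  | cons a u ih =>
    obtain ⟨κ', h1, h2⟩ := h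
    exact (ih h1).step h2

lemma Path.unique {ρ κ κ' : Comp b r} {u : List Letter} (h : Path ρ κ u) (h' : Path ρ κ' u) :
    κ = κ' := by
  induction u generalizing κ κ' with
  | nil => exact Eq.trans h (Eq.symm h')
  | cons a u ih =>
    obtain ⟨κ₁, h1, h2⟩ := h
    obtain ⟨κ₂, h3, h4⟩ := h'
    obtain rfl := ih h1 h3
    exact h2.unique h4

lemma Colours.unique {ρ κ κ' : Comp b r} {f : ℕ → ℤ} (h : Colours ρ κ f)
    (h' : Colours ρ κ' f) : κ = κ' :=
  comp_ext fun j => h.abs_inj _ (redPos_lt _ _) _ (redPos_lt _ _) (by rw [h.red, h'.red])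

lemma Colours.ascent_or_descent {ρ κ κ' : Comp b r} {f : ℕ → ℤ} (h : Colours ρ κ f)
    {a : Letter} (ha : Step a κ κ') (hd : NotDot a) :
    Ascent (b + r) a f ∨ Descent (b + r) a f := by
  cases a with
  | dot p => exact hd.elim
  | cross i =>
    have := h.ne (p := i) (q := i + 1) (by have := ha.1; omega) ha.1 (by omega)
    rcases lt_or_gt_of_ne this with h1 | h1
    · exact Or.inl ⟨ha.1, h1⟩
    · exact Or.inr ⟨ha.1, h1⟩
  | nail =>
    have := h.ne_zero ha.1.1
    rcases lt_or_gt_of_ne this with h1 | h1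
    · exact Or.inr ⟨ha.1.1, h1⟩
    · exact Or.inl ⟨ha.1.1, h1⟩

/-- A descent of an arrangement never involves two red strands or nails a red strand. -/
lemma Colours.exists_step_of_descent {ρ κ : Comp b r} {f : ℕ → ℤ} (h : Colours ρ κ f)
    {a : Letter} (ha : Descent (b + r) a f) :
    ∃ κ', Step a κ' κ ∧ Colours ρ κ' (signedStep a f) := by
  have hs : ∃ κ', Step a κ κ' := by
    cases a with
    | dot p => exact ha.elim
    | cross i =>
      have hred : ¬ (IsRed κ i ∧ IsRed κ (i + 1)) := by
        rintro ⟨⟨j, hj⟩, ⟨j', hj'⟩⟩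
        have h1 : j < j' := (redPos_strictMono κ).lt_iff_lt.1 (by omega)
        have h2 := redPos_strictMono ρ h1
        have h3 := ha.2
        rw [← hj, show redPos κ j + 1 = redPos κ j' by omega, h.red, h.red] at h3
        omega
      obtain ⟨κ', hκ'⟩ := exists_comp_swap κ ha.1 hred
      exact ⟨κ', ha.1, hred, hκ'⟩
    | nail =>
      refine ⟨κ, ⟨ha.1, ?_⟩, rfl⟩
      rintro ⟨j, hj⟩
      have h3 := ha.2
      rw [← hj, h.red] at h3
      omega
  obtain ⟨κ', hκ'⟩ := hs
  exact ⟨κ', hκ'.symm, h.step hκ'⟩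

/-- An arrangement without descents is the trivial one. -/
lemma Colours.eq_init {ρ κ : Comp b r} {f : ℕ → ℤ} (h : Colours ρ κ f)
    (hf : ∀ a, ¬ Descent (b + r) a f) : f = fun p : ℕ => (p : ℤ) + 1 := by
  have hlow : ∀ p < b + r, (p : ℤ) + 1 ≤ f p := by
    intro p
    induction p with
    | zero =>
      intro hp
      have h1 := h.ne_zero hp
      have h2 : ¬ f 0 < 0 := fun h' => hf Letter.nail ⟨hp, h'⟩
      push_cast
      omega
    | succ p ih =>
      intro hp
      have h1 := ih (by omega)
      have h2 : ¬ f (p + 1) < f p := fun h' => hf (Letter.cross p) ⟨hp, h'⟩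
      have h3 := h.ne (p := p) (q := p + 1) (by omega) hp (by omega)
      push_cast
      omega
  have hup : ∀ d p, p + d + 1 = b + r → f p ≤ p + 1 := by
    intro d
    induction d with
    | zero =>
      intro p hp
      have h1 := (h.abs_le p (by omega)).2
      have h2 := le_abs_self (f p)
      omega
    | succ d ih =>
      intro p hp
      have h1 := ih (p + 1) (by omega)
      have h2 : ¬ f (p + 1) < f p := fun h' => hf (Letter.cross p) ⟨by omega, h'⟩
      have h3 := h.ne (p := p) (q := p + 1) (by omega) (by omega) (by omega)
      push_cast at h1
      omega
  funext p
  rcases Nat.lt_or_ge p (b + r) with hp | hp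
  · have h1 := hlow p hp
    have h2 := hup (b + r - (p + 1)) p (by omega)
    omega
  · exact h.out p hp

/-- Every coloured arrangement is the top of a reduced word. -/
lemma Colours.exists_reduced {ρ κ : Comp b r} {f : ℕ → ℤ} (h : Colours ρ κ f) :
    ∃ u : List Letter, Path ρ κ u ∧ (∀ a ∈ u, NotDot a) ∧ signedState u = f ∧
      u.length = signedLength (b + r) f := by
  induction hm : signedLength (b + r) f generalizing f κ with
  | zero =>
    have hf := h.eq_init fun a ha => by have := ha.signedLength; omega
    subst hf
    refine ⟨[], ?_, by simp, rfl, rfl⟩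
    exact h.unique (colours_init ρ)
  | succ m ih =>
    have : ∃ a, Descent (b + r) a f := by
      by_contra hc
      have hf := h.eq_init fun a ha => hc ⟨a, ha⟩
      rw [hf, signedLength_init] at hm
      omega
    obtain ⟨a, ha⟩ := this
    obtain ⟨κ', h1, h2⟩ := h.exists_step_of_descent ha
    obtain ⟨u, hu, hnd, hs, hl⟩ := ih h2 (by have := ha.signedLength; omega)
    refine ⟨a :: u, ⟨κ', hu, h1⟩, ?_, ?_, by simp [hl]⟩
    · intro c hc
      rcases List.mem_cons.1 hc with rfl | hc
      · cases c with
        | dot p => exact ha.elim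
        | cross i => trivial
        | nail => trivial
      · exact hnd c hc
    · rw [signedState_cons, hs, signedStep_signedStep]

lemma Path.signedLength_le {ρ κ : Comp b r} {u : List Letter} (h : Path ρ κ u)
    (hd : ∀ a ∈ u, NotDot a) : signedLength (b + r) (signedState u) ≤ u.length := by
  induction u generalizing κ with
  | nil => rw [signedState_nil, signedLength_init]; exact Nat.zero_le _
  | cons a u ih =>
    obtain ⟨κ', h1, h2⟩ := h
    have := ih h1 fun c hc => hd c (List.mem_cons_of_mem _ hc)
    rw [signedState_cons, List.length_cons]
    rcases h1.colours.ascent_or_descent h2 (hd a List.mem_cons_self) with ha | ha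
    · rw [ha.signedLength]; omega
    · have := ha.signedLength; omega

end Legal

/-! ### Left-adjusted expressions -/

lemma permOf_cons (i : ℕ) (u : List ℕ) : permOf (i :: u) = Equiv.swap i (i + 1) * permOf u := rfl

lemma permOf_append (u v : List ℕ) : permOf (u ++ v) = permOf u * permOf v := by
  simp [permOf]

lemma permOf_lt {n : ℕ} {u : List ℕ} (hu : ∀ i ∈ u, i + 1 < n) {p : ℕ} (hp : p < n) :
    permOf u p < n := by
  induction u with
  | nil => exact hp
  | cons i u ih =>
    exact swap_lt (hu i List.mem_cons_self) (ih fun j hj => hu j (List.mem_cons_of_mem _ hj))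

lemma permOf_of_le {n : ℕ} {u : List ℕ} (hu : ∀ i ∈ u, i + 1 < n) {p : ℕ} (hp : n ≤ p) :
    permOf u p = p := by
  induction u with
  | nil => rfl
  | cons i u ih =>
    have := hu i List.mem_cons_self
    rw [permOf_cons, Equiv.Perm.mul_apply, ih fun j hj => hu j (List.mem_cons_of_mem _ hj)]
    exact Equiv.swap_apply_of_ne_of_ne (by omega) (by omega)

lemma commute_swap_permOf {p : ℕ} {u : List ℕ} (hu : ∀ q ∈ u, q ≠ p ∧ q + 1 ≠ p ∧ q ≠ p + 1) :
    Equiv.swap p (p + 1) * permOf u = permOf u * Equiv.swap p (p + 1) := by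
  induction u with
  | nil => rfl
  | cons q u ih =>
    have h := hu q List.mem_cons_self
    have hc : Equiv.swap p (p + 1) * Equiv.swap q (q + 1) =
        Equiv.swap q (q + 1) * Equiv.swap p (p + 1) := by
      refine (Equiv.Perm.Disjoint.commute ?_)
      intro x
      by_cases hx : x = p ∨ x = p + 1
      · right
        exact Equiv.swap_apply_of_ne_of_ne (by omega) (by omega)
      · left
        exact Equiv.swap_apply_of_ne_of_ne (by omega) (by omega)
    rw [permOf_cons, ← mul_assoc, hc, mul_assoc, ih fun j hj => hu j (List.mem_cons_of_mem _ hj),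
      mul_assoc]

lemma swap_braid (p : ℕ) :
    Equiv.swap (p + 1) (p + 2) * Equiv.swap p (p + 1) * Equiv.swap (p + 1) (p + 2) =
      Equiv.swap p (p + 1) * Equiv.swap (p + 1) (p + 2) * Equiv.swap p (p + 1) := by
  rw [Equiv.swap_mul_swap_mul_swap (by omega) (by omega), Equiv.swap_comm p (p + 1),
    Equiv.swap_comm (p + 1) (p + 2), Equiv.swap_mul_swap_mul_swap (by omega) (by omega),
    Equiv.swap_comm]

section Reduced

variable {n : ℕ} {w : Equiv.Perm (Fin n)}

lemma IsReduced.le_length {u u' : List ℕ} (h : IsReduced w u) (hu' : ∀ i ∈ u', i + 1 < n)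
    (hp : permOf u' = permOf u) : u.length ≤ u'.length :=
  h.2 u' ⟨hu', fun p => by rw [hp]; exact h.1.2 p⟩

lemma IsLeftAdjusted.le_sum {u u' : List ℕ} (h : IsLeftAdjusted w u)
    (hu' : ∀ i ∈ u', i + 1 < n) (hp : permOf u' = permOf u) (hl : u'.length = u.length) :
    u.sum ≤ u'.sum :=
  h.2 u' ⟨⟨hu', fun p => by rw [hp]; exact h.1.1.2 p⟩, fun u'' h'' => hl ▸ h.1.2 u'' h''⟩

/-- In a left-adjusted expression, between two consecutive occurrences of `p` there is an
occurrence of `p + 1`.  Otherwise there is exactly one `p - 1` between them, because by induction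
two of them would enclose a `p`; a braid move then lowers the sum of the indices. -/
lemma IsLeftAdjusted.succ_mem_between (m : List ℕ) : ∀ (c₁ c₂ : List ℕ) (p : ℕ),
    IsLeftAdjusted w (c₁ ++ p :: m ++ p :: c₂) → p ∉ m → p + 1 ∈ m := by
  induction hlen : m.length using Nat.strong_induction_on generalizing m with
  | _ len ih =>
  intro c₁ c₂ p h hpm
  by_contra hpm'
  have hmem : ∀ i ∈ c₁ ++ p :: m ++ p :: c₂, i + 1 < n := h.1.1.1
  by_cases hex : ∃ q ∈ m, q + 1 = p
  · obtain ⟨q, hq, rfl⟩ := hex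
    obtain ⟨m₁, m₂, rfl, hm₁⟩ := List.eq_append_cons_of_mem hq
    -- `q` occurs only once between the two occurrences of `q + 1`
    have hm₂ : q ∉ m₂ := by
      intro hq₂
      obtain ⟨m₃, m₄, rfl, hm₃⟩ := List.eq_append_cons_of_mem hq₂
      have := ih m₃.length (by rw [← hlen]; simp; omega) m₃ rfl (c₁ ++ (q + 1) :: m₁)
        (m₄ ++ (q + 1) :: c₂) q (by simpa using h) hm₃
      apply hpm
      simp [this]
    have hc₁ : Equiv.swap (q + 1) (q + 1 + 1) * permOf m₁ =
        permOf m₁ * Equiv.swap (q + 1) (q + 1 + 1) := by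
      refine commute_swap_permOf fun x hx => ⟨?_, ?_, ?_⟩
      · rintro rfl; exact hpm (by simp [hx])
      · intro e; obtain rfl : x = q := by omega
        exact hm₁ hx
      · rintro rfl; exact hpm' (by simp [hx])
    have hc₂ : Equiv.swap (q + 1) (q + 1 + 1) * permOf m₂ =
        permOf m₂ * Equiv.swap (q + 1) (q + 1 + 1) := by
      refine commute_swap_permOf fun x hx => ⟨?_, ?_, ?_⟩
      · rintro rfl; exact hpm (by simp [hx])
      · intro e; obtain rfl : x = q := by omega
        exact hm₂ hx
      · rintro rfl; exact hpm' (by simp [hx])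
    have hperm : permOf (c₁ ++ (m₁ ++ (q :: (q + 1) :: q :: (m₂ ++ c₂)))) =
        permOf (c₁ ++ (q + 1) :: (m₁ ++ q :: m₂) ++ (q + 1) :: c₂) := by
      simp only [permOf_append, permOf_cons, List.append_assoc, List.cons_append]
      rw [← mul_assoc (permOf m₂) (Equiv.swap (q + 1) (q + 1 + 1)), ← hc₂,
        ← mul_assoc (Equiv.swap (q + 1) (q + 1 + 1)) (permOf m₁), hc₁]
      have := swap_braid q
      simp only [← mul_assoc] at this ⊢
      rw [mul_assoc (permOf c₁ * permOf m₁), mul_assoc (permOf c₁ * permOf m₁),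
        mul_assoc (permOf c₁ * permOf m₁), mul_assoc (permOf c₁ * permOf m₁), ← this]
      simp only [← mul_assoc]
    have hle := h.le_sum (u' := c₁ ++ (m₁ ++ (q :: (q + 1) :: q :: (m₂ ++ c₂)))) ?_ hperm
      (by simp; omega)
    · simp at hle; omega
    · intro i hi
      apply hmem
      simp only [List.mem_append, List.mem_cons] at hi ⊢
      tauto
  · -- the two occurrences of `p` cancel
    have hc : Equiv.swap p (p + 1) * permOf m = permOf m * Equiv.swap p (p + 1) := by
      refine commute_swap_permOf fun x hx => ⟨?_, ?_, ?_⟩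
      · rintro rfl; exact hpm hx
      · exact fun e => hex ⟨x, hx, e⟩
      · rintro rfl; exact hpm' hx
    have hperm : permOf (c₁ ++ (m ++ c₂)) = permOf (c₁ ++ p :: m ++ p :: c₂) := by
      simp only [permOf_append, permOf_cons, List.append_assoc, List.cons_append]
      rw [← mul_assoc (Equiv.swap p (p + 1)), hc, mul_assoc (permOf m),
        ← mul_assoc (Equiv.swap p (p + 1)), Equiv.swap_mul_self, one_mul]
    have hle := h.1.le_length (u' := c₁ ++ (m ++ c₂)) ?_ hperm
    · simp at hle
    · intro i hi
      apply hmem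
      simp only [List.mem_append, List.mem_cons] at hi ⊢
      tauto

/-- In a left-adjusted expression a strand never moves left after it has moved right. -/
lemma IsLeftAdjusted.not_right_left (m : List ℕ) : ∀ (c₁ c₂ : List ℕ) (i j s : ℕ),
    IsLeftAdjusted w (c₁ ++ i :: (m ++ j :: c₂)) → permOf c₂ s = j →
      permOf (m ++ j :: c₂) s ≠ i + 1 := by
  induction hlen : m.length using Nat.strong_induction_on generalizing m with
  | _ len ih =>
  intro c₁ c₂ i j s h hj hi
  -- By induction no letter of `m` moves the strand, so that it stays at position `j + 1`.
  have hstay : ∀ m₁ m₂, m = m₁ ++ m₂ → permOf (m₂ ++ j :: c₂) s = j + 1 := by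
    intro m₁ m₂
    induction m₂ generalizing m₁ with
    | nil =>
      intro _
      rw [List.nil_append, permOf_cons, Equiv.Perm.mul_apply, hj, Equiv.swap_apply_left]
    | cons x m₂ ih₂ =>
      intro hm
      have h1 := ih₂ (m₁ ++ [x]) (by simp [hm])
      have hx1 : x ≠ j + 1 := by
        rintro rfl
        exact ih m₁.length (by rw [← hlen, hm]; simp) m₁ rfl c₁ (m₂ ++ j :: c₂) i (j + 1) s
          (by simpa [hm] using h) h1 (by simpa [hm] using hi)
      have hx2 : x ≠ j := by
        rintro rfl
        exact ih m₂.length (by rw [← hlen, hm]; simp; omega) m₂ rfl (c₁ ++ i :: m₁) c₂ x x s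
          (by simpa [hm] using h) hj h1
      rw [List.cons_append, permOf_cons, Equiv.Perm.mul_apply, h1]
      exact Equiv.swap_apply_of_ne_of_ne (by omega) (by omega)
  have hfin := hstay [] m rfl
  rw [hi] at hfin
  obtain rfl : i = j := by omega
  have hi' : i ∉ m := by
    intro him
    obtain ⟨m₁, m₂, rfl⟩ := List.append_of_mem him
    have h1 := hstay (m₁ ++ [i]) m₂ (by simp)
    have h2 := hstay m₁ (i :: m₂) rfl
    rw [List.cons_append, permOf_cons, Equiv.Perm.mul_apply, h1, Equiv.swap_apply_right] at h2
    omega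
  have hs := IsLeftAdjusted.succ_mem_between m c₁ c₂ i (by simpa using h) hi'
  obtain ⟨m₁, m₂, rfl⟩ := List.append_of_mem hs
  have h1 := hstay (m₁ ++ [i + 1]) m₂ (by simp)
  have h2 := hstay m₁ ((i + 1) :: m₂) rfl
  rw [List.cons_append, permOf_cons, Equiv.Perm.mul_apply, h1, Equiv.swap_apply_left] at h2
  omega

end Reduced

/-- Two strands whose order is reversed have crossed. -/
lemma exists_crossing {s t : ℕ} (hst : s < t) (u : List ℕ) (h : permOf u t < permOf u s) :
    ∃ u₁ j u₂, u = u₁ ++ j :: u₂ ∧ permOf u₂ s = j ∧ permOf u₂ t = j + 1 := by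
  induction u with
  | nil => exact absurd h (not_lt.2 hst.le)
  | cons i u ih =>
    by_cases h' : permOf u t < permOf u s
    · obtain ⟨u₁, j, u₂, rfl, h1, h2⟩ := ih h'
      exact ⟨i :: u₁, j, u₂, rfl, h1, h2⟩
    · have hne : permOf u t ≠ permOf u s := fun e => hst.ne' ((permOf u).injective e)
      refine ⟨[], i, u, rfl, ?_⟩
      rw [permOf_cons, Equiv.Perm.mul_apply, Equiv.Perm.mul_apply, Equiv.swap_apply_def,
        Equiv.swap_apply_def] at h
      split_ifs at h <;> omega

lemma exists_right_move {s : ℕ} (u₁ u₂ : List ℕ) (h : permOf u₂ s < permOf (u₁ ++ u₂) s) :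
    ∃ v₁ j v₂, u₁ = v₁ ++ j :: v₂ ∧ permOf (v₂ ++ u₂) s = j := by
  induction u₁ with
  | nil => exact absurd h (lt_irrefl _)
  | cons i u ih =>
    by_cases h' : permOf u₂ s < permOf (u ++ u₂) s
    · obtain ⟨v₁, j, v₂, rfl, h1⟩ := ih h'
      exact ⟨i :: v₁, j, v₂, rfl, h1⟩
    · refine ⟨[], i, u, rfl, ?_⟩
      rw [List.cons_append, permOf_cons, Equiv.Perm.mul_apply, Equiv.swap_apply_def] at h
      split_ifs at h <;> omega

lemma exists_left_move {s : ℕ} (u₁ u₂ : List ℕ) (h : permOf (u₁ ++ u₂) s < permOf u₂ s) :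
    ∃ v₁ j v₂, u₁ = v₁ ++ j :: v₂ ∧ permOf (v₂ ++ u₂) s = j + 1 := by
  induction u₁ with
  | nil => exact absurd h (lt_irrefl _)
  | cons i u ih =>
    by_cases h' : permOf (u ++ u₂) s < permOf u₂ s
    · obtain ⟨v₁, j, v₂, rfl, h1⟩ := ih h'
      exact ⟨i :: v₁, j, v₂, rfl, h1⟩
    · refine ⟨[], i, u, rfl, ?_⟩
      rw [List.cons_append, permOf_cons, Equiv.Perm.mul_apply, Equiv.swap_apply_def] at h
      split_ifs at h <;> omega

/-- In a reduced expression two strands that have already crossed do not cross again: the two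
crossings could be removed. -/
lemma IsReduced.symm_lt_symm {n : ℕ} {w : Equiv.Perm (Fin n)} {c₁ c₂ : List ℕ} {i : ℕ}
    (h : IsReduced w (c₁ ++ i :: c₂)) : (permOf c₂).symm i < (permOf c₂).symm (i + 1) := by
  by_contra hc
  have hne : (permOf c₂).symm i ≠ (permOf c₂).symm (i + 1) := fun e => by
    have := (permOf c₂).symm.injective e
    omega
  obtain ⟨u₁, j, u₂, rfl, h1, h2⟩ := exists_crossing
    (s := (permOf c₂).symm (i + 1)) (t := (permOf c₂).symm i) (by omega) c₂ (by simp)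
  have e1 : permOf u₁ (j + 1) = i + 1 := by
    have e : permOf (u₁ ++ j :: u₂) ((permOf (u₁ ++ j :: u₂)).symm (i + 1)) = i + 1 := by simp
    rwa [permOf_append, permOf_cons, Equiv.Perm.mul_apply, Equiv.Perm.mul_apply,
      ← permOf_cons, ← permOf_append, h1, Equiv.swap_apply_left] at e
  have e2 : permOf u₁ j = i := by
    have e : permOf (u₁ ++ j :: u₂) ((permOf (u₁ ++ j :: u₂)).symm i) = i := by simp
    rwa [permOf_append, permOf_cons, Equiv.Perm.mul_apply, Equiv.Perm.mul_apply,
      ← permOf_cons, ← permOf_append, h2, Equiv.swap_apply_right] at e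
  have hp : permOf (c₁ ++ (u₁ ++ u₂)) = permOf (c₁ ++ i :: (u₁ ++ j :: u₂)) := by
    simp only [permOf_append, permOf_cons]
    congr 1
    rw [← mul_assoc (permOf u₁), Equiv.mul_swap_eq_swap_mul, e1, e2]
    simp only [← mul_assoc, Equiv.swap_mul_self, one_mul]
  have := h.le_length (u' := c₁ ++ (u₁ ++ u₂)) (fun x hx => h.1.1 x (by
    simp only [List.mem_append, List.mem_cons] at hx ⊢; tauto)) hp
  simp at this

lemma exists_isExpression {n : ℕ} (w : Equiv.Perm (Fin n)) : ∃ u, IsExpression w u := by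
  rcases n with _ | n
  · exact ⟨[], by simp, fun p => p.elim0⟩
  have hw : w ∈ Submonoid.closure
      (Set.range fun i : Fin n => Equiv.swap i.castSucc i.succ) := by
    rw [Equiv.Perm.mclosure_swap_castSucc_succ]; trivial
  induction hw using Submonoid.closure_induction with
  | mem x hx =>
    obtain ⟨i, rfl⟩ := hx
    refine ⟨[i], by simp, fun p => ?_⟩
    have e : permOf [(i : ℕ)] = Equiv.swap (i : ℕ) (i + 1) := mul_one _
    rw [e, Equiv.swap_apply_def, Equiv.swap_apply_def]
    simp only [Fin.ext_iff, Fin.val_castSucc, Fin.val_succ]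
    split_ifs <;> simp
  | one => exact ⟨[], by simp, fun p => rfl⟩
  | mul x y _ _ hx hy =>
    obtain ⟨u, hu⟩ := hx
    obtain ⟨v, hv⟩ := hy
    refine ⟨u ++ v, fun i hi => ?_, fun p => ?_⟩
    · rcases List.mem_append.1 hi with h | h
      exacts [hu.1 i h, hv.1 i h]
    · rw [permOf_append, Equiv.Perm.mul_apply, hv.2, hu.2]
      rfl

lemma exists_isLeftAdjusted {n : ℕ} (w : Equiv.Perm (Fin n)) : ∃ u, IsLeftAdjusted w u := by
  have h1 : ∃ u, IsReduced w u :=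
    ⟨_, Function.argminOn_mem List.length {u | IsExpression w u} (exists_isExpression w),
      fun u' hu' => Function.argminOn_le List.length {u | IsExpression w u} hu'⟩
  exact ⟨_, Function.argminOn_mem List.sum {u | IsReduced w u} h1,
    fun u' hu' => Function.argminOn_le List.sum {u | IsReduced w u} hu'⟩

/-! ### Nailed left-adjusted expressions are reduced words of type `B` -/

/-- Read from bottom to top, each letter of the word increases the length of the arrangement. -/
def Ascending (n : ℕ) : List Letter → Prop
  | [] => True
  | a :: u => Ascent n a (signedState u) ∧ Ascending n u

lemma Ascending.signedLength {n : ℕ} {u : List Letter} (h : Ascending n u) :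
    signedLength n (signedState u) = u.length := by
  induction u with
  | nil => exact signedLength_init n
  | cons a u ih => rw [signedState_cons, h.1.signedLength, ih h.2, List.length_cons]

lemma Ascending.notDot {n : ℕ} {u : List Letter} (h : Ascending n u) : ∀ a ∈ u, NotDot a := by
  induction u with
  | nil => simp
  | cons a u ih =>
    intro c hc
    rcases List.mem_cons.1 hc with rfl | hc
    · cases c with
      | dot p => exact h.1.elim
      | cross i => trivial
      | nail => trivial
    · exact ih h.2 c hc

lemma Ascent.descent {n : ℕ} {a : Letter} {f : ℕ → ℤ} (h : Ascent n a f) :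
    Descent n a (signedStep a f) := by
  cases a with
  | dot p => exact h.elim
  | cross i => exact ⟨h.1, by simpa [signedStep] using h.2⟩
  | nail => exact ⟨h.1, by simpa [signedStep] using h.2⟩

/-- A reduced word whose top arrangement respects the colours is a legal diagram. -/
lemma Ascending.path {b r : ℕ} {ρ κ : Comp b r} {u : List Letter} (h : Ascending (b + r) u)
    (hc : Colours ρ κ (signedState u)) : Path ρ κ u := by
  induction u generalizing κ with
  | nil => exact hc.unique (colours_init ρ)
  | cons a u ih =>
    obtain ⟨κ', h1, h2⟩ := hc.exists_step_of_descent h.1.descent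
    rw [signedState_cons, signedStep_signedStep] at h2
    exact ⟨κ', ih h.2 h2, h1⟩

lemma letters_theta_succ (p : ℕ) : (Block.theta (p + 1)).letters =
    Letter.cross p :: ((Block.theta p).letters ++ [Letter.cross p]) := by
  simp [Block.letters, List.range_succ]

lemma signedState_theta (p : ℕ) (u : List Letter) :
    signedState ((Block.theta p).letters ++ u) =
      Function.update (signedState u) p (-signedState u p) := by
  induction p generalizing u with
  | zero => rfl
  | succ p ih =>
    rw [letters_theta_succ, List.cons_append, List.append_assoc, signedState_cons, ih]
    funext q
    simp only [List.singleton_append, signedState_cons, signedStep, Function.comp,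
      Function.update_apply]
    by_cases hq : q = p + 1
    · subst hq; simp
    · have : Equiv.swap p (p + 1) q ≠ p := by
        intro e
        apply hq
        rw [← Equiv.swap_apply_self p (p + 1) q, e, Equiv.swap_apply_left]
      rw [if_neg this, if_neg hq, Equiv.swap_apply_self]

/-- A tightened nail keeps a word reduced if its strand has not been nailed and started to the right
of all strands on its left, nailed or not. -/
lemma Ascending.theta {n p : ℕ} {u : List Letter} (h : Ascending n u) (hp : p < n)
    (hpos : 0 < signedState u p) (hlt : ∀ q < p, |signedState u q| < signedState u p) :
    Ascending n ((Block.theta p).letters ++ u) := by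
  induction p generalizing u with
  | zero => exact ⟨⟨hp, hpos⟩, h⟩
  | succ p ih =>
    have hlast := hlt p (by omega)
    rw [abs_lt] at hlast
    have h1 : Ascending n (Letter.cross p :: u) := ⟨⟨hp, hlast.2⟩, h⟩
    have e0 : signedState (Letter.cross p :: u) p = signedState u (p + 1) := by
      simp [signedStep]
    have e1 : signedState (Letter.cross p :: u) (p + 1) = signedState u p := by
      simp [signedStep]
    have h2 := ih h1 (by omega) (by rw [e0]; exact hpos) fun q hq => by
      have : signedState (Letter.cross p :: u) q = signedState u q := by
        simp only [signedState_cons, signedStep, Function.comp]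
        rw [Equiv.swap_apply_of_ne_of_ne (by omega) (by omega)]
      rw [e0, this]
      exact hlt q (by omega)
    rw [letters_theta_succ, List.cons_append, List.append_assoc]
    refine ⟨⟨hp, ?_⟩, h2⟩
    rw [List.singleton_append, signedState_theta, Function.update_self,
      Function.update_of_ne (by omega), e0, e1]
    exact hlast.1

/-- The top arrangement of a word of blocks in which no strand is nailed twice: the crossings of the
tightened nails cancel. -/
lemma signedState_blocks (v : List Block) (hv : (nailedStrands v).Nodup) (s : ℕ) :
    signedState (v.flatMap Block.letters) (permOf (blockCrossings v) s) =
      if s ∈ nailedStrands v then -((s : ℤ) + 1) else (s : ℤ) + 1 := by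
  induction v with
  | nil => simp [nailedStrands, blockCrossings, permOf]
  | cons B v ih =>
    cases B with
    | cross i =>
      have e : blockCrossings (Block.cross i :: v) = i :: blockCrossings v := rfl
      rw [e, permOf_cons, Equiv.Perm.mul_apply]
      simp only [List.flatMap_cons, Block.letters, List.singleton_append, signedState_cons,
        signedStep, Function.comp, Equiv.swap_apply_self]
      exact ih hv
    | theta p =>
      have e : blockCrossings (Block.theta p :: v) = blockCrossings v := rfl
      rw [nailedStrands, List.nodup_cons] at hv
      rw [e, List.flatMap_cons, signedState_theta, Function.update_apply]
      simp only [nailedStrands, List.mem_cons, Equiv.eq_symm_apply]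
      have hi := ih hv.2
      by_cases hs : permOf (blockCrossings v) s = p
      · rw [if_pos hs, if_pos (Or.inl hs), ← hs, hi, if_neg]
        rw [← hs, Equiv.symm_apply_apply] at hv
        exact hv.1
      · rw [if_neg hs, hi]
        simp only [hs, false_or]

lemma blockCrossings_append (v₁ v₂ : List Block) :
    blockCrossings (v₁ ++ v₂) = blockCrossings v₁ ++ blockCrossings v₂ := by
  simp [blockCrossings]

lemma nailedStrands_subset_append (v₁ v₂ : List Block) :
    ∀ s ∈ nailedStrands v₂, s ∈ nailedStrands (v₁ ++ v₂) := by
  intro s hs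
  induction v₁ with
  | nil => exact hs
  | cons B v ih =>
    cases B with
    | cross i => exact ih
    | theta p => exact List.mem_cons_of_mem _ ih

lemma nodup_nailedStrands_of_append (v₁ v₂ : List Block) (h : (nailedStrands (v₁ ++ v₂)).Nodup) :
    (nailedStrands v₂).Nodup := by
  induction v₁ with
  | nil => exact h
  | cons B v ih =>
    cases B with
    | cross i => exact ih h
    | theta p => exact ih (List.nodup_cons.1 h).2

lemma exists_theta_of_mem (v : List Block) : ∀ s ∈ nailedStrands v,
    ∃ v₁ p v₂, v = v₁ ++ Block.theta p :: v₂ ∧ (permOf (blockCrossings v₂)).symm p = s := by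
  intro s hs
  induction v with
  | nil => simp [nailedStrands] at hs
  | cons B v ih =>
    cases B with
    | cross i =>
      obtain ⟨v₁, p, v₂, rfl, h⟩ := ih hs
      exact ⟨Block.cross i :: v₁, p, v₂, rfl, h⟩
    | theta p =>
      rcases List.mem_cons.1 hs with rfl | hs
      · exact ⟨[], p, v, rfl, rfl⟩
      · obtain ⟨v₁, q, v₂, rfl, h⟩ := ih hs
        exact ⟨Block.theta p :: v₁, q, v₂, rfl, h⟩

section Nailing

variable {b r : ℕ} {κ ρ : Comp b r} {w : Equiv.Perm (Fin (b + r))} {l : Fin b → Fin 2}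
  {v : List Block}

lemma IsNailing.mem_lt (h : IsNailing κ w l v) : ∀ i ∈ blockCrossings v, i + 1 < b + r :=
  h.leftAdjusted.1.1.1

lemma IsNailing.strand_lt (h : IsNailing κ w l v) {s : ℕ} (hs : s ∈ nailedStrands v) :
    s < b + r := by
  obtain ⟨i, -, hi⟩ := (h.nailed s).1 hs
  by_contra hc
  rw [permOf_of_le h.mem_lt (not_lt.1 hc)] at hi
  exact hc (hi ▸ blackPos_lt κ i)

/-- A nailed strand does not move left above its nail. -/
lemma IsNailing.ascent_cross (h : IsNailing κ w l v) {v₁ v₂ : List Block} {i : ℕ}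
    (hv : v = v₁ ++ Block.cross i :: v₂) :
    Ascent (b + r) (Letter.cross i) (signedState (v₂.flatMap Block.letters)) := by
  have hc : blockCrossings v = blockCrossings v₁ ++ i :: blockCrossings v₂ := by
    rw [hv, blockCrossings_append]; rfl
  have hnd : (nailedStrands v₂).Nodup :=
    nodup_nailedStrands_of_append (v₁ ++ [Block.cross i]) v₂ (by simpa [hv] using h.nodup)
  have hlt := (hc ▸ h.leftAdjusted).1.symm_lt_symm
  set s := (permOf (blockCrossings v₂)).symm i with hs
  set t := (permOf (blockCrossings v₂)).symm (i + 1) with ht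
  have hs' : permOf (blockCrossings v₂) s = i := by simp [hs]
  have ht' : permOf (blockCrossings v₂) t = i + 1 := by simp [ht]
  have hnt : t ∉ nailedStrands v₂ := by
    intro hmem
    obtain ⟨v₃, p, v₄, rfl, hp⟩ := exists_theta_of_mem _ _ hmem
    -- the strand comes from the position `p ≤ i` of its nail, and moves back to `i`
    have hleft := h.leftmost (v₁ ++ Block.cross i :: v₃) v₄ p (by simp [hv])
      (i :: blockCrossings (v₃ ++ Block.theta p :: v₄)) (by rw [hc]; exact List.suffix_append _ _)
    have e : blockCrossings (v₃ ++ Block.theta p :: v₄) =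
        blockCrossings v₃ ++ blockCrossings v₄ := by
      rw [blockCrossings_append]; rfl
    rw [hp, permOf_cons, Equiv.Perm.mul_apply, ht', Equiv.swap_apply_right] at hleft
    have hp' : permOf (blockCrossings v₄) t = p := by rw [← hp]; simp
    rw [e] at ht'
    obtain ⟨u₁, j, u₂, hu, hj⟩ := exists_right_move (blockCrossings v₃) (blockCrossings v₄)
      (s := t) (by omega)
    have hla : IsLeftAdjusted w
        (blockCrossings v₁ ++ i :: (u₁ ++ j :: (u₂ ++ blockCrossings v₄))) := by
      have := h.leftAdjusted
      rw [hc, e, hu] at this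
      simpa using this
    refine IsLeftAdjusted.not_right_left u₁ _ _ i j t hla hj ?_
    rw [hu] at ht'
    simpa using ht'
  refine ⟨h.mem_lt i (by rw [hc]; simp), ?_⟩
  have e1 := signedState_blocks v₂ hnd s
  have e2 := signedState_blocks v₂ hnd t
  rw [hs'] at e1
  rw [ht', if_neg hnt] at e2
  rw [e1, e2]
  split_ifs <;> omega

/-- The strands on the left of a strand at its leftmost position have been on its left all the
time. -/
lemma IsNailing.ascending_theta (h : IsNailing κ w l v) {v₁ v₂ : List Block} {p : ℕ}
    (hv : v = v₁ ++ Block.theta p :: v₂)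
    (ha : Ascending (b + r) (v₂.flatMap Block.letters)) :
    Ascending (b + r) ((Block.theta p).letters ++ v₂.flatMap Block.letters) := by
  have hc : blockCrossings v = blockCrossings v₁ ++ blockCrossings v₂ := by
    rw [hv, blockCrossings_append]; rfl
  have hnd' : (nailedStrands (Block.theta p :: v₂)).Nodup :=
    nodup_nailedStrands_of_append v₁ _ (hv ▸ h.nodup)
  have hnd := (List.nodup_cons.1 hnd').2
  have hns := (List.nodup_cons.1 hnd').1
  have hsv : (permOf (blockCrossings v₂)).symm p ∈ nailedStrands v := by
    rw [hv]
    exact nailedStrands_subset_append v₁ _ _ List.mem_cons_self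
  have hleft := h.leftmost v₁ v₂ p hv
  set s := (permOf (blockCrossings v₂)).symm p with hs
  have hs' : permOf (blockCrossings v₂) s = p := by simp [hs]
  have hmem : ∀ i ∈ blockCrossings v₂, i + 1 < b + r := fun i hi =>
    h.mem_lt i (by rw [hc]; exact List.mem_append_right _ hi)
  have e1 := signedState_blocks v₂ hnd s
  rw [hs', if_neg hns] at e1
  refine ha.theta (by rw [← hs']; exact permOf_lt hmem (h.strand_lt hsv)) (by rw [e1]; omega) ?_
  intro q hq
  set t := (permOf (blockCrossings v₂)).symm q with ht
  have ht' : permOf (blockCrossings v₂) t = q := by simp [ht]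
  have hts : t < s := by
    by_contra hcon
    have hne : s ≠ t := fun e => by rw [← e, hs'] at ht'; omega
    obtain ⟨u₁, j, u₂, hu, h1, h2⟩ := exists_crossing (s := s) (t := t) (by omega)
      (blockCrossings v₂) (by omega)
    have hj := hleft u₂ ⟨blockCrossings v₁ ++ u₁ ++ [j], by rw [hc, hu]; simp⟩
    rw [h1] at hj
    have h3 : permOf (j :: u₂) s = j + 1 := by
      rw [permOf_cons, Equiv.Perm.mul_apply, h1, Equiv.swap_apply_left]
    obtain ⟨u₃, i, u₄, hu', h4⟩ := exists_left_move (s := s) u₁ (j :: u₂) (by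
      rw [← hu, hs', h3]; omega)
    have hla : IsLeftAdjusted w (blockCrossings v₁ ++ u₃ ++ i :: (u₄ ++ j :: u₂)) := by
      have := h.leftAdjusted
      rw [hc, hu, hu'] at this
      simpa using this
    exact IsLeftAdjusted.not_right_left u₄ _ u₂ i j s hla h1 h4
  have e2 := signedState_blocks v₂ hnd t
  rw [ht'] at e2
  rw [e1, e2]
  split_ifs
  · rw [abs_neg, abs_of_nonneg (by positivity)]; omega
  · rw [abs_of_nonneg (by positivity)]; omega

lemma IsNailing.ascending (h : IsNailing κ w l v) :
    Ascending (b + r) (v.flatMap Block.letters) := by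
  suffices H : ∀ v₂ v₁, v = v₁ ++ v₂ → Ascending (b + r) (v₂.flatMap Block.letters) from
    H v [] rfl
  intro v₂
  induction v₂ with
  | nil => intro _ _; trivial
  | cons B v₂ ih =>
    intro v₁ hv
    have ha := ih (v₁ ++ [B]) (by simp [hv])
    cases B with
    | cross i => exact ⟨h.ascent_cross hv, ha⟩
    | theta p => exact h.ascending_theta hv ha

lemma redOrdered_redPos (hw : w ∈ redOrdered κ ρ) (j : Fin r) :
    w ⟨redPos ρ j, redPos_lt ρ j⟩ = ⟨redPos κ j, redPos_lt κ j⟩ := by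
  have h1 : StrictMono fun j : Fin r => w ⟨redPos ρ j, redPos_lt ρ j⟩ := fun i j hij =>
    hw.2 _ _ ⟨i, rfl⟩ ⟨j, rfl⟩ (Fin.lt_def.2 (redPos_strictMono ρ hij))
  have h2 : StrictMono fun j : Fin r => (⟨redPos κ j, redPos_lt κ j⟩ : Fin (b + r)) :=
    fun i j hij => Fin.lt_def.2 (redPos_strictMono κ hij)
  refine congrFun ((h1.range_inj h2).1 ?_) j
  ext p
  constructor
  · rintro ⟨i, rfl⟩
    obtain ⟨m, hm⟩ := (hw.1 ⟨redPos ρ i, redPos_lt ρ i⟩).2 ⟨i, rfl⟩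
    exact ⟨m, Fin.ext hm⟩
  · rintro ⟨i, rfl⟩
    obtain ⟨m, hm⟩ := (hw.1 (w.symm ⟨redPos κ i, redPos_lt κ i⟩)).1
      (by rw [Equiv.apply_symm_apply]; exact ⟨i, rfl⟩)
    refine ⟨m, ?_⟩
    have : (⟨redPos ρ m, redPos_lt ρ m⟩ : Fin (b + r)) = w.symm ⟨redPos κ i, redPos_lt κ i⟩ :=
      Fin.ext hm
    simp [this]

lemma IsNailing.colours (h : IsNailing κ w l v) (hw : w ∈ redOrdered κ ρ) :
    Colours ρ κ (signedState (v.flatMap Block.letters)) := by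
  set π := permOf (blockCrossings v) with hπ
  have key := signedState_blocks v h.nodup
  have habs : ∀ s, |signedState (v.flatMap Block.letters) (π s)| = s + 1 := by
    intro s
    rw [key s]
    split_ifs
    · rw [abs_neg, abs_of_nonneg (by positivity)]
    · rw [abs_of_nonneg (by positivity)]
  have hlt : ∀ p, p < b + r → π.symm p < b + r := by
    intro p hp
    by_contra hc
    have h1 := permOf_of_le h.mem_lt (not_lt.1 hc)
    rw [← hπ, Equiv.apply_symm_apply] at h1
    omega
  have habs' : ∀ p, |signedState (v.flatMap Block.letters) p| = π.symm p + 1 := by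
    intro p
    rw [← habs, Equiv.apply_symm_apply]
  refine ⟨fun p hp => ?_, fun p hp q hq e => ?_, fun p hp => ?_, fun j => ?_⟩
  · have := hlt p hp
    rw [habs']
    omega
  · rw [habs', habs'] at e
    exact π.symm.injective (by omega)
  · have h1 := permOf_of_le h.mem_lt hp
    have h2 := key p
    rwa [h1, if_neg fun hm => by have := h.strand_lt hm; omega] at h2
  · have h1 : permOf (blockCrossings v) (redPos ρ j) = redPos κ j := by
      have := h.leftAdjusted.1.1.2 ⟨redPos ρ j, redPos_lt ρ j⟩
      rwa [redOrdered_redPos hw] at this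
    have h2 := key (redPos ρ j)
    rwa [h1, if_neg] at h2
    rw [h.nailed, h1]
    rintro ⟨i, -, hi⟩
    exact (isBlack_blackPos κ i).2 ⟨j, hi⟩

lemma IsNailing.path (h : IsNailing κ w l v) (hw : w ∈ redOrdered κ ρ) :
    Path ρ κ (v.flatMap Block.letters) :=
  h.ascending.path (h.colours hw)

/-- Every coloured arrangement is that of a nailed left-adjusted expression. -/
lemma Colours.exists_index {f : ℕ → ℤ} (h : Colours ρ κ f) :
    ∃ w ∈ redOrdered κ ρ, ∃ l : Fin b → Fin 2, ∀ v, IsNailing κ w l v →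
      signedState (v.flatMap Block.letters) = f := by
  classical
  -- the strand at the top position `p` comes from the bottom position `|f p| - 1`
  let g : Fin (b + r) → Fin (b + r) := fun p => ⟨(|f p|).toNat - 1, by
    have := h.abs_le p p.2; omega⟩
  have hg : ∀ p : Fin (b + r), ((g p : ℕ) : ℤ) + 1 = |f p| := fun p => by
    have := h.abs_le p p.2
    simp only [g]
    omega
  have hinj : Function.Injective g := fun p q e => Fin.ext (h.abs_inj p p.2 q q.2 (by
    rw [← hg, ← hg, e]))
  let e := Equiv.ofBijective g (Finite.injective_iff_bijective.1 hinj)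
  have hred : ∀ j, e ⟨redPos κ j, redPos_lt κ j⟩ = ⟨redPos ρ j, redPos_lt ρ j⟩ := by
    intro j
    apply Fin.ext
    have h1 := hg ⟨redPos κ j, redPos_lt κ j⟩
    have h2 := h.red j
    simp only at h1
    rw [h2, abs_of_nonneg (by positivity)] at h1
    have : (e ⟨redPos κ j, redPos_lt κ j⟩ : ℕ) = g ⟨redPos κ j, redPos_lt κ j⟩ := rfl
    simp only
    omega
  have hred' : ∀ j, e.symm ⟨redPos ρ j, redPos_lt ρ j⟩ = ⟨redPos κ j, redPos_lt κ j⟩ := fun j => by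
    rw [Equiv.symm_apply_eq, hred]
  refine ⟨e.symm, ⟨fun p => ?_, ?_⟩, fun i => if f (blackPos κ i) < 0 then 1 else 0,
    fun v hv => ?_⟩
  · constructor
    · rintro ⟨j, hj⟩
      have h1 : e.symm p = ⟨redPos κ j, redPos_lt κ j⟩ := Fin.ext hj.symm
      rw [Equiv.symm_apply_eq, hred] at h1
      exact ⟨j, by rw [h1]⟩
    · rintro ⟨j, hj⟩
      have h1 : p = ⟨redPos ρ j, redPos_lt ρ j⟩ := Fin.ext hj.symm
      exact ⟨j, by rw [h1, hred']⟩
  · rintro p q ⟨i, hi⟩ ⟨j, hj⟩ hpq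
    have h1 : p = ⟨redPos ρ i, redPos_lt ρ i⟩ := Fin.ext hi.symm
    have h2 : q = ⟨redPos ρ j, redPos_lt ρ j⟩ := Fin.ext hj.symm
    rw [h1, h2] at hpq ⊢
    rw [hred', hred']
    exact redPos_strictMono κ ((redPos_strictMono ρ).lt_iff_lt.1 hpq)
  · funext p
    have key := signedState_blocks v hv.nodup
    rcases Nat.lt_or_ge p (b + r) with hp | hp
    · have h1 := hv.leftAdjusted.1.1.2 (e ⟨p, hp⟩)
      rw [Equiv.symm_apply_apply] at h1
      have h2 := key (e ⟨p, hp⟩)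
      rw [h1] at h2
      rw [h2]
      have h3 : ((e ⟨p, hp⟩ : ℕ) : ℤ) + 1 = |f p| := hg ⟨p, hp⟩
      rw [h3]
      simp only [hv.nailed, h1]
      by_cases hneg : f p < 0
      · rw [if_pos, abs_of_neg hneg, neg_neg]
        have hb : IsBlack κ p := ⟨hp, by
          rintro ⟨j, rfl⟩
          rw [h.red] at hneg
          omega⟩
        obtain ⟨i, rfl⟩ := exists_blackPos hb
        exact ⟨i, if_pos hneg, rfl⟩
      · rw [if_neg, abs_of_nonneg (not_lt.1 hneg)]
        rintro ⟨i, hi, hi'⟩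
        rw [← hi', if_neg] at hi
        · exact absurd hi (by decide)
        · exact hneg
    · have h1 := permOf_of_le hv.mem_lt hp
      have h2 := key p
      rw [h1, if_neg fun hm => by have := hv.strand_lt hm; omega] at h2
      rw [h2, h.out p hp]

end Nailing

/-- The leftmost condition of `IsNailing`, block by block. -/
def LeftmostIn (c : List ℕ) : List Block → Prop
  | [] => True
  | Block.cross _ :: v => LeftmostIn c v
  | Block.theta p :: v =>
      (∀ u, u <:+ c → p ≤ permOf u ((permOf (blockCrossings v)).symm p)) ∧ LeftmostIn c v

lemma LeftmostIn.leftmost {c : List ℕ} {v₁ v₂ : List Block} {p : ℕ}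
    (h : LeftmostIn c (v₁ ++ Block.theta p :: v₂)) :
    ∀ u, u <:+ c → p ≤ permOf u ((permOf (blockCrossings v₂)).symm p) := by
  induction v₁ with
  | nil => exact h.1
  | cons B v₁ ih =>
    cases B with
    | cross i => exact ih h
    | theta q => exact ih h.2

/-- A strand can be nailed at any height where it is at its leftmost position. -/
lemma exists_insert_theta {c u : List ℕ} {s : ℕ} (hs : ∀ u', u' <:+ c → permOf u s ≤ permOf u' s)
    (v : List Block) (hu : u <:+ blockCrossings v) (hv : LeftmostIn c v) :
    ∃ v', blockCrossings v' = blockCrossings v ∧ (nailedStrands v').Perm (s :: nailedStrands v) ∧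
      LeftmostIn c v' := by
  induction v with
  | nil =>
    obtain rfl : u = [] := List.suffix_nil.1 hu
    exact ⟨[Block.theta s], rfl, List.Perm.refl _, hs, trivial⟩
  | cons B v ih =>
    by_cases he : u = blockCrossings (B :: v)
    · refine ⟨Block.theta (permOf u s) :: B :: v, rfl, ?_, ?_, hv⟩
      · rw [nailedStrands, ← he, Equiv.symm_apply_apply]
      · rw [← he, Equiv.symm_apply_apply]
        exact hs
    · cases B with
      | cross i =>
        have hu' : u <:+ blockCrossings v := (List.suffix_cons_iff.1 hu).resolve_left he
        obtain ⟨v', h1, h2, h3⟩ := ih hu' hv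
        refine ⟨Block.cross i :: v', ?_, h2, h3⟩
        change i :: blockCrossings v' = i :: blockCrossings v
        rw [h1]
      | theta p =>
        obtain ⟨v', h1, h2, h3⟩ := ih hu hv.2
        refine ⟨Block.theta p :: v', h1, ?_, ?_, h3⟩
        · rw [nailedStrands, nailedStrands, h1]
          exact (h2.cons _).trans (List.Perm.swap _ _ _)
        · rw [h1]; exact hv.1

lemma exists_leftmost_suffix (c : List ℕ) (s : ℕ) :
    ∃ u, u <:+ c ∧ ∀ u', u' <:+ c → permOf u s ≤ permOf u' s :=
  ⟨_, Function.argminOn_mem (fun u => permOf u s) {u | u <:+ c} ⟨c, List.suffix_refl c⟩,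
    fun _ hu' => Function.argminOn_le (fun u => permOf u s) {u | u <:+ c} hu'⟩

lemma exists_isNailing {b r : ℕ} (κ : Comp b r) (w : Equiv.Perm (Fin (b + r)))
    (l : Fin b → Fin 2) : ∃ v, IsNailing κ w l v := by
  classical
  obtain ⟨c, hc⟩ := exists_isLeftAdjusted w
  have hL : ∀ L : List ℕ, ∃ v, blockCrossings v = c ∧ (nailedStrands v).Perm L ∧
      LeftmostIn c v := by
    intro L
    induction L with
    | nil =>
      have h : ∀ c' : List ℕ, blockCrossings (c'.map Block.cross) = c' ∧
          nailedStrands (c'.map Block.cross) = [] ∧ LeftmostIn c (c'.map Block.cross) := by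
        intro c'
        induction c' with
        | nil => exact ⟨rfl, rfl, trivial⟩
        | cons i c' ih => exact ⟨congrArg (i :: ·) ih.1, ih.2⟩
      exact ⟨_, (h c).1, by rw [(h c).2.1], (h c).2.2⟩
    | cons s L ih =>
      obtain ⟨v, h1, h2, h3⟩ := ih
      obtain ⟨u, hu, hu'⟩ := exists_leftmost_suffix c s
      obtain ⟨v', h4, h5, h6⟩ := exists_insert_theta hu' v (by rw [h1]; exact hu) h3
      exact ⟨v', h4.trans h1, h5.trans (h2.cons s), h6⟩
  obtain ⟨v, h1, h2, h3⟩ := hL ((Finset.univ.filter fun i => l i = 1).toList.map fun i =>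
    (permOf c).symm (blackPos κ i))
  refine ⟨v, by rw [h1]; exact hc, ?_, fun s => ?_, fun v₁ v₂ p hv => ?_⟩
  · rw [h2.nodup_iff]
    exact (Finset.nodup_toList _).map
      ((permOf c).symm.injective.comp (blackPos_strictMono κ).injective)
  · rw [h2.mem_iff, h1]
    simp only [List.mem_map, Finset.mem_toList, Finset.mem_filter, Finset.mem_univ, true_and]
    refine exists_congr fun i => and_congr_right fun _ => ?_
    rw [Equiv.symm_apply_eq, eq_comm]
  · subst hv
    rw [h1]
    exact h3.leftmost

/-! ### Legal diagrams and their degrees -/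

section Diagrams

variable {k : Type*} [CommRing k] {b r : ℕ} {N : Fin r → ℕ} {ρ κ κ' : Comp b r}

lemma idem_mul_self (ρ : Comp b r) : idem k N ρ * idem k N ρ = idem k N ρ := by
  simpa [idem] using RingQuot.mkAlgHom_rel k (Rel.idem_mul_self (k := k) (N := N) ρ)

lemma idem_mul_ne {κ ρ : Comp b r} (h : κ ≠ ρ) : idem k N κ * idem k N ρ = 0 := by
  simpa [idem] using RingQuot.mkAlgHom_rel k (Rel.idem_mul_ne (k := k) (N := N) κ ρ h)

lemma sum_idem : ∑ ρ : Comp b r, idem k N ρ = 1 := by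
  simpa [idem] using RingQuot.mkAlgHom_rel k (Rel.idem_sum (k := k) (b := b) (N := N))

lemma mk_fE (ρ : Comp b r) : RingQuot.mkAlgHom k (Rel k N) (fE k ρ) = idem k N ρ := rfl

lemma mk_fX (p : ℕ) : RingQuot.mkAlgHom k (Rel k (b := b) N) (fX k p) =
    piece k N (Letter.dot p) := rfl

lemma mk_fC (i : ℕ) : RingQuot.mkAlgHom k (Rel k (b := b) N) (fC k i) =
    piece k N (Letter.cross i) := rfl

lemma mk_fN : RingQuot.mkAlgHom k (Rel k (b := b) N) (fN k) = piece k N Letter.nail := rfl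

lemma Step.piece_mul_idem {a : Letter} (h : Step a κ κ') :
    piece k N a * idem k N κ = idem k N κ' * piece k N a := by
  cases a with
  | dot p =>
    obtain ⟨-, rfl⟩ := h
    simpa [mk_fE, mk_fX] using RingQuot.mkAlgHom_rel k (Rel.dot_idem (k := k) (N := N) p κ')
  | cross i =>
    simpa [mk_fE, mk_fC] using
      RingQuot.mkAlgHom_rel k (Rel.cross_idem (k := k) (N := N) i κ' κ h.1 h.2.2)
  | nail =>
    obtain ⟨-, rfl⟩ := h
    simpa [mk_fE, mk_fN] using RingQuot.mkAlgHom_rel k (Rel.nail_idem (k := k) (N := N) κ')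

lemma piece_mul_idem_eq_zero {a : Letter} (h : ∀ κ', ¬ Step a κ κ') :
    piece k N a * idem k N κ = 0 := by
  cases a with
  | dot p =>
    have hb : ¬ IsBlack κ p := fun hb => h κ ⟨hb, rfl⟩
    simpa [mk_fE, mk_fX] using RingQuot.mkAlgHom_rel k (Rel.dot_zero (k := k) (N := N) p κ hb)
  | cross i =>
    have hb : b + r ≤ i + 1 ∨ (IsRed κ i ∧ IsRed κ (i + 1)) := by
      by_contra hc
      rw [not_or, not_le] at hc
      obtain ⟨κ', hκ'⟩ := exists_comp_swap κ hc.1 hc.2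
      exact h κ' ⟨hc.1, hc.2, hκ'⟩
    simpa [mk_fE, mk_fC] using RingQuot.mkAlgHom_rel k (Rel.cross_zero (k := k) (N := N) i κ hb)
  | nail =>
    have hb : ¬ IsBlack κ 0 := fun hb => h κ ⟨hb, rfl⟩
    simpa [mk_fE, mk_fN] using RingQuot.mkAlgHom_rel k (Rel.nail_zero (k := k) (N := N) κ hb)

@[simp] lemma diagram_nil (ρ : Comp b r) : diagram k N ρ [] = idem k N ρ := one_mul _

@[simp] lemma diagram_cons (ρ : Comp b r) (a : Letter) (u : List Letter) :
    diagram k N ρ (a :: u) = piece k N a * diagram k N ρ u := by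
  simp [diagram, mul_assoc]

lemma Path.idem_mul {u : List Letter} (h : Path ρ κ u) :
    idem k N κ * diagram k N ρ u = diagram k N ρ u := by
  induction u generalizing κ with
  | nil => obtain rfl : κ = ρ := h; rw [diagram_nil, idem_mul_self]
  | cons a u ih =>
    obtain ⟨κ', h1, h2⟩ := h
    rw [diagram_cons, ← ih h1, ← mul_assoc, ← mul_assoc, ← h2.piece_mul_idem, mul_assoc,
      mul_assoc, ← mul_assoc (idem k N κ'), idem_mul_self]

lemma path_or_diagram_eq_zero (ρ : Comp b r) (u : List Letter) :
    (∃ κ, Path ρ κ u) ∨ diagram k N ρ u = 0 := by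
  induction u with
  | nil => exact Or.inl ⟨ρ, rfl⟩
  | cons a u ih =>
    rcases ih with ⟨κ, h⟩ | h
    · by_cases hs : ∃ κ', Step a κ κ'
      · obtain ⟨κ', hs⟩ := hs
        exact Or.inl ⟨κ', κ, h, hs⟩
      · right
        rw [diagram_cons, ← h.idem_mul, ← mul_assoc, piece_mul_idem_eq_zero (not_exists.1 hs),
          zero_mul]
    · right
      rw [diagram_cons, h, mul_zero]

/-- A local relation may be applied on top of any diagram. -/
lemma Path.mul_eq_mul {z : List Letter} (h : Path ρ κ z) {x y : T k b N}
    (hxy : x * idem k N κ = y * idem k N κ) : x * diagram k N ρ z = y * diagram k N ρ z := by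
  rw [← h.idem_mul, ← mul_assoc, hxy, mul_assoc]

lemma Path.redPos_eq {u : List Letter} (h : Path ρ κ u) (j : Fin r) :
    redPos κ j = permOf (crossings u) (redPos ρ j) := by
  induction u generalizing κ with
  | nil => obtain rfl : κ = ρ := h; rfl
  | cons a u ih =>
    obtain ⟨κ', h1, h2⟩ := h
    have e : crossings (a :: u) = crossings [a] ++ crossings u := by
      simp only [crossings]
      rw [← List.filterMap_append, List.singleton_append]
    rw [e, permOf_append, Equiv.Perm.mul_apply, ← ih h1, h2.redPos_eq]

lemma Path.diagramDeg_cons {u : List Letter} (h : Path ρ κ u) (a : Letter) :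
    diagramDeg N ρ (a :: u) = pieceDeg N (redPos κ) a + diagramDeg N ρ u := by
  have : redPos κ = fun j => permOf (crossings u) (redPos ρ j) := funext h.redPos_eq
  rw [this]
  rfl

lemma pieceDeg_black {i : ℕ} (h₀ : ¬ IsRed κ i) (h₁ : ¬ IsRed κ (i + 1)) :
    pieceDeg N (redPos κ) (Letter.cross i) = (0, -2, 0) := by
  have : ∀ j, redPos κ j ≠ i ∧ redPos κ j ≠ i + 1 :=
    fun j => ⟨fun e => h₀ ⟨j, e⟩, fun e => h₁ ⟨j, e⟩⟩
  simp only [pieceDeg]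
  rw [if_pos this]

lemma pieceDeg_red_left {i : ℕ} {j : Fin r} (h₀ : redPos κ j = i) (h₁ : ¬ IsRed κ (i + 1)) :
    pieceDeg N (redPos κ) (Letter.cross i) = (0, (N j : ℤ), 0) := by
  have h : ¬ ∀ j, redPos κ j ≠ i ∧ redPos κ j ≠ i + 1 := fun h => (h j).1 h₀
  have hf : (Finset.univ.filter fun m : Fin r => redPos κ m = i ∨ redPos κ m = i + 1) = {j} := by
    ext m
    simp only [Finset.mem_filter, Finset.mem_univ, true_and, Finset.mem_singleton]
    constructor
    · rintro (e | e)
      · exact redPos_injective κ (e.trans h₀.symm)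
      · exact (h₁ ⟨m, e⟩).elim
    · rintro rfl
      exact Or.inl h₀
  simp only [pieceDeg]
  rw [if_neg h, hf, Finset.sum_singleton]

lemma pieceDeg_red_right {i : ℕ} {j : Fin r} (h₀ : ¬ IsRed κ i) (h₁ : redPos κ j = i + 1) :
    pieceDeg N (redPos κ) (Letter.cross i) = (0, (N j : ℤ), 0) := by
  have h : ¬ ∀ j, redPos κ j ≠ i ∧ redPos κ j ≠ i + 1 := fun h => (h j).2 h₁
  have hf : (Finset.univ.filter fun m : Fin r => redPos κ m = i ∨ redPos κ m = i + 1) = {j} := by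
    ext m
    simp only [Finset.mem_filter, Finset.mem_univ, true_and, Finset.mem_singleton]
    constructor
    · rintro (e | e)
      · exact (h₀ ⟨m, e⟩).elim
      · exact redPos_injective κ (e.trans h₁.symm)
    · rintro rfl
      exact Or.inr h₁
  simp only [pieceDeg]
  rw [if_neg h, hf, Finset.sum_singleton]

/-- The number of crossings and nails of a letter. -/
def Letter.size : Letter → ℕ
  | Letter.dot _ => 0
  | _ => 1

/-- The number of crossings and nails of a word. -/
def wordSize (u : List Letter) : ℕ := (u.map Letter.size).sum

@[simp] lemma wordSize_cons (a : Letter) (u : List Letter) :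
    wordSize (a :: u) = a.size + wordSize u := by simp [wordSize]

variable (k N) in
/-- The span of the diagrams from `1_ρ` to `1_κ` of degree `g` with fewer than `m` crossings and
nails. -/
def lower (ρ κ : Comp b r) (g : ℤ × ℤ × ℤ) (m : ℕ) : Submodule k (T k b N) :=
  Submodule.span k {t | ∃ u, Path ρ κ u ∧ diagramDeg N ρ u = g ∧ wordSize u < m ∧
    diagram k N ρ u = t}

lemma Path.mem_lower {u : List Letter} (h : Path ρ κ u) {g : ℤ × ℤ × ℤ}
    (hg : diagramDeg N ρ u = g) {m : ℕ} (hm : wordSize u < m) :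
    diagram k N ρ u ∈ lower k N ρ κ g m :=
  Submodule.subset_span ⟨u, h, hg, hm, rfl⟩

lemma Step.piece_mul_mem_lower {a : Letter} (h : Step a κ κ') {g : ℤ × ℤ × ℤ} {m : ℕ}
    {t : T k b N} (ht : t ∈ lower k N ρ κ g m) :
    piece k N a * t ∈ lower k N ρ κ' (pieceDeg N (redPos κ) a + g) (a.size + m) := by
  induction ht using Submodule.span_induction with
  | mem t ht =>
    obtain ⟨u, h1, h2, h3, rfl⟩ := ht
    rw [← diagram_cons]
    refine Path.mem_lower (show Path ρ κ' (a :: u) from ⟨κ, h1, h⟩) ?_ ?_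
    · rw [h1.diagramDeg_cons, h2]
    · rw [wordSize_cons]; omega
  | zero => rw [mul_zero]; exact Submodule.zero_mem _
  | add x y _ _ hx hy => rw [mul_add]; exact Submodule.add_mem _ hx hy
  | smul c x _ hx => rw [mul_smul_comm]; exact Submodule.smul_mem _ _ hx

variable (k N) in
/-- The words `u` and `v` are diagrams with the same ends, degree and number of crossings and
nails, and are equal up to a unit of `k` modulo diagrams with fewer crossings and nails. -/
structure Eqv (ρ κ : Comp b r) (u v : List Letter) : Prop where
  left : Path ρ κ u
  right : Path ρ κ v
  deg : diagramDeg N ρ u = diagramDeg N ρ v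
  size : wordSize u = wordSize v
  sub_mem : ∃ ε : kˣ, diagram k N ρ u - (ε : k) • diagram k N ρ v ∈
    lower k N ρ κ (diagramDeg N ρ u) (wordSize u)

variable (k N) in
/-- The diagram `u` is a combination of diagrams with fewer crossings and nails. -/
structure Low (ρ κ : Comp b r) (u : List Letter) : Prop where
  path : Path ρ κ u
  mem : diagram k N ρ u ∈ lower k N ρ κ (diagramDeg N ρ u) (wordSize u)

variable {u v w : List Letter}

lemma Eqv.of_eq (hu : Path ρ κ u) (hv : Path ρ κ v) (hd : diagramDeg N ρ u = diagramDeg N ρ v)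
    (hs : wordSize u = wordSize v) (h : diagram k N ρ u = diagram k N ρ v) : Eqv k N ρ κ u v :=
  ⟨hu, hv, hd, hs, 1, by rw [h, Units.val_one, one_smul, sub_self]; exact Submodule.zero_mem _⟩

lemma Eqv.refl (hu : Path ρ κ u) : Eqv k N ρ κ u u := Eqv.of_eq hu hu rfl rfl rfl

lemma Eqv.symm (h : Eqv k N ρ κ u v) : Eqv k N ρ κ v u := by
  obtain ⟨ε, hε⟩ := h.sub_mem
  refine ⟨h.right, h.left, h.deg.symm, h.size.symm, ε⁻¹, ?_⟩
  rw [← h.deg, ← h.size]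
  have := Submodule.smul_mem _ (-((ε⁻¹ : kˣ) : k)) hε
  rwa [smul_sub, smul_smul, neg_smul, neg_mul, Units.inv_mul, neg_smul, one_smul,
    sub_neg_eq_add, add_comm, ← sub_eq_add_neg] at this

lemma Eqv.trans (h : Eqv k N ρ κ u v) (h' : Eqv k N ρ κ v w) : Eqv k N ρ κ u w := by
  obtain ⟨ε, hε⟩ := h.sub_mem
  obtain ⟨ε', hε'⟩ := h'.sub_mem
  refine ⟨h.left, h'.right, h.deg.trans h'.deg, h.size.trans h'.size, ε * ε', ?_⟩
  rw [← h.deg, ← h.size] at hε'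
  have := Submodule.add_mem _ hε (Submodule.smul_mem _ (ε : k) hε')
  rwa [smul_sub, smul_smul, sub_add_sub_cancel, ← Units.val_mul] at this

lemma Eqv.cons (h : Eqv k N ρ κ u v) {a : Letter} (ha : Step a κ κ') :
    Eqv k N ρ κ' (a :: u) (a :: v) := by
  obtain ⟨ε, hε⟩ := h.sub_mem
  refine ⟨⟨κ, h.left, ha⟩, ⟨κ, h.right, ha⟩, ?_, ?_, ε, ?_⟩
  · rw [h.left.diagramDeg_cons, h.right.diagramDeg_cons, h.deg]
  · rw [wordSize_cons, wordSize_cons, h.size]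
  · have := ha.piece_mul_mem_lower hε
    rwa [mul_sub, mul_smul_comm, ← diagram_cons, ← diagram_cons, ← h.left.diagramDeg_cons,
      ← wordSize_cons] at this

lemma Low.cons (h : Low k N ρ κ u) {a : Letter} (ha : Step a κ κ') :
    Low k N ρ κ' (a :: u) := by
  refine ⟨⟨κ, h.path, ha⟩, ?_⟩
  have := ha.piece_mul_mem_lower h.mem
  rwa [← diagram_cons, ← h.path.diagramDeg_cons, ← wordSize_cons] at this

lemma Eqv.low (h : Eqv k N ρ κ u v) (hv : Low k N ρ κ v) : Low k N ρ κ u := by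
  obtain ⟨ε, hε⟩ := h.sub_mem
  refine ⟨h.left, ?_⟩
  have h1 := hv.mem
  rw [← h.deg, ← h.size] at h1
  have := Submodule.add_mem _ hε (Submodule.smul_mem _ (ε : k) h1)
  rwa [sub_add_cancel] at this

lemma Path.of_append_dots {ds z : List Letter} (hd : ∀ a ∈ ds, ¬ NotDot a)
    (h : Path ρ κ (ds ++ z)) : Path ρ κ z := by
  induction ds with
  | nil => exact h
  | cons a ds ih =>
    obtain ⟨κ', h1, h2⟩ := h
    have := hd a List.mem_cons_self
    cases a with
    | dot p =>
      obtain ⟨-, rfl⟩ := h2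
      exact ih (fun c hc => hd c (List.mem_cons_of_mem _ hc)) h1
    | cross i => exact (this trivial).elim
    | nail => exact (this trivial).elim

lemma Eqv.append_left {x : List Letter} (h : Eqv k N ρ κ u v) (hx : Path ρ κ' (x ++ u)) :
    Eqv k N ρ κ' (x ++ u) (x ++ v) := by
  induction x generalizing κ' with
  | nil =>
    obtain rfl := Path.unique hx h.left
    exact h
  | cons a x ih =>
    obtain ⟨κ₁, h1, h2⟩ := hx
    exact (ih h1).cons h2

lemma Low.append_left {x : List Letter} (h : Low k N ρ κ u) (hx : Path ρ κ' (x ++ u)) :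
    Low k N ρ κ' (x ++ u) := by
  induction x generalizing κ' with
  | nil =>
    obtain rfl := Path.unique hx h.path
    exact h
  | cons a x ih =>
    obtain ⟨κ₁, h1, h2⟩ := hx
    exact (ih h1).cons h2

lemma path_replicate_dot {z : List Letter} {p : ℕ} (hz : Path ρ κ z) (hp : IsBlack κ p) (m : ℕ) :
    Path ρ κ (List.replicate m (Letter.dot p) ++ z) := by
  induction m with
  | zero => exact hz
  | succ m ih => exact ⟨κ, ih, hp, rfl⟩

lemma diagram_replicate_dot (z : List Letter) (p m : ℕ) :
    diagram k N ρ (List.replicate m (Letter.dot p) ++ z) =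
      piece k N (Letter.dot p) ^ m * diagram k N ρ z := by
  induction m with
  | zero => simp
  | succ m ih => rw [List.replicate_succ, List.cons_append, diagram_cons, ih, pow_succ', mul_assoc]

lemma diagramDeg_replicate_dot (z : List Letter) (p m : ℕ) :
    diagramDeg N ρ (List.replicate m (Letter.dot p) ++ z) =
      (0, 2 * (m : ℤ), 0) + diagramDeg N ρ z := by
  induction m with
  | zero => simp
  | succ m ih =>
    rw [List.replicate_succ, List.cons_append, diagramDeg, ih, ← add_assoc]
    congr 1
    simp only [pieceDeg, Prod.mk_add_mk, add_zero]
    push_cast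
    ring_nf

lemma wordSize_replicate_dot (z : List Letter) (p m : ℕ) :
    wordSize (List.replicate m (Letter.dot p) ++ z) = wordSize z := by
  simp [wordSize, Letter.size]

end Diagrams

/-! ### Local moves -/

section Moves

variable {k : Type*} [CommRing k] {b r : ℕ} {N : Fin r → ℕ} {ρ κ κ' : Comp b r}
  {z : List Letter}

lemma pieceDeg_congr {i i' : ℕ} (h : ∀ j, (redPos κ j = i ∨ redPos κ j = i + 1) ↔
    (redPos κ' j = i' ∨ redPos κ' j = i' + 1)) :
    pieceDeg N (redPos κ) (Letter.cross i) = pieceDeg N (redPos κ') (Letter.cross i') := by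
  have h' : (∀ j, redPos κ j ≠ i ∧ redPos κ j ≠ i + 1) ↔
      ∀ j, redPos κ' j ≠ i' ∧ redPos κ' j ≠ i' + 1 :=
    forall_congr' fun j => by have := h j; tauto
  simp only [pieceDeg, h', h]

lemma Step.pieceDeg_eq {i : ℕ} (h : Step (Letter.cross i) κ κ') :
    pieceDeg N (redPos κ') (Letter.cross i) = pieceDeg N (redPos κ) (Letter.cross i) := by
  refine pieceDeg_congr fun j => ?_
  rw [h.2.2 j, Equiv.swap_apply_def]
  split_ifs <;> omega

/-- Two black strands may be exchanged without changing the colours. -/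
lemma Step.eq_of_black {i : ℕ} (h : Step (Letter.cross i) κ κ') (h₀ : ¬ IsRed κ i)
    (h₁ : ¬ IsRed κ (i + 1)) : κ' = κ :=
  comp_ext fun j => by
    rw [h.2.2 j]
    exact Equiv.swap_apply_of_ne_of_ne (fun e => h₀ ⟨j, e⟩) (fun e => h₁ ⟨j, e⟩)

lemma low_cross_cross {i : ℕ} (hz : Path ρ κ z) (hs : Step (Letter.cross i) κ κ') :
    Low k N ρ κ (Letter.cross i :: Letter.cross i :: z) := by
  have hp : Path ρ κ' (Letter.cross i :: z) := ⟨κ, hz, hs⟩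
  refine ⟨⟨κ', hp, hs.symm⟩, ?_⟩
  rw [hp.diagramDeg_cons, hz.diagramDeg_cons, hs.pieceDeg_eq, ← add_assoc]
  have hi := hs.1
  have hdots : ∀ (p : ℕ) (j : Fin r), IsBlack κ p →
      pieceDeg N (redPos κ) (Letter.cross i) = (0, (N j : ℤ), 0) →
      piece k N (Letter.cross i) * piece k N (Letter.cross i) * idem k N κ =
        piece k N (Letter.dot p) ^ N j * idem k N κ →
      diagram k N ρ (Letter.cross i :: Letter.cross i :: z) ∈ lower k N ρ κ
        (pieceDeg N (redPos κ) (Letter.cross i) + pieceDeg N (redPos κ) (Letter.cross i) +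
          diagramDeg N ρ z) (wordSize (Letter.cross i :: Letter.cross i :: z)) := by
    intro p j hpb hdeg hrel
    rw [diagram_cons, diagram_cons, ← mul_assoc, hz.mul_eq_mul hrel, ← diagram_replicate_dot]
    refine (path_replicate_dot hz hpb _).mem_lower ?_ ?_
    · rw [diagramDeg_replicate_dot, hdeg]
      simp [two_mul]
    · rw [wordSize_replicate_dot]
      simp [Letter.size]
      omega
  by_cases h0 : IsRed κ i
  · have h1 : IsBlack κ (i + 1) := ⟨hi, fun h1 => hs.2.1 ⟨h0, h1⟩⟩
    obtain ⟨j, hj⟩ := h0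
    exact hdots (i + 1) j h1 (pieceDeg_red_left hj h1.2) (by
      simpa [mk_fE, mk_fC, mk_fX] using
        RingQuot.mkAlgHom_rel k (Rel.red_sq_left (k := k) (N := N) i κ j hj h1))
  · have h0' : IsBlack κ i := ⟨by omega, h0⟩
    by_cases h1 : IsRed κ (i + 1)
    · obtain ⟨j, hj⟩ := h1
      exact hdots i j h0' (pieceDeg_red_right h0 hj) (by
        simpa [mk_fE, mk_fC, mk_fX] using
          RingQuot.mkAlgHom_rel k (Rel.red_sq_right (k := k) (N := N) i κ j h0' hj))
    · have h1' : IsBlack κ (i + 1) := ⟨hi, h1⟩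
      have hrel : piece k N (Letter.cross i) * piece k N (Letter.cross i) * idem k N κ =
          0 * idem k N κ := by
        simpa [mk_fE, mk_fC, mk_fX] using
          RingQuot.mkAlgHom_rel k (Rel.cross_sq (k := k) (N := N) i κ h0' h1')
      rw [diagram_cons, diagram_cons, ← mul_assoc, hz.mul_eq_mul hrel, zero_mul]
      exact Submodule.zero_mem _

lemma low_nail_nail (hz : Path ρ κ z) (h0 : IsBlack κ 0) :
    Low k N ρ κ (Letter.nail :: Letter.nail :: z) := by
  refine ⟨⟨κ, ⟨κ, hz, h0, rfl⟩, h0, rfl⟩, ?_⟩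
  have hrel : piece k N Letter.nail * piece k N Letter.nail * idem k N κ = 0 * idem k N κ := by
    simpa [mk_fE, mk_fN] using RingQuot.mkAlgHom_rel k (Rel.nail_sq (k := k) (N := N) κ h0)
  rw [diagram_cons, diagram_cons, ← mul_assoc, hz.mul_eq_mul hrel, zero_mul]
  exact Submodule.zero_mem _

lemma low_square {a : Letter} (ha : NotDot a) (hz : Path ρ κ z) (hs : Step a κ κ') :
    Low k N ρ κ (a :: a :: z) := by
  cases a with
  | dot p => exact ha.elim
  | cross i => exact low_cross_cross hz hs
  | nail => exact low_nail_nail hz hs.1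

lemma eqv_cross_cross {i j : ℕ} (hij : i + 1 < j)
    (h₁ : Path ρ κ (Letter.cross i :: Letter.cross j :: z))
    (h₂ : Path ρ κ (Letter.cross j :: Letter.cross i :: z)) :
    Eqv k N ρ κ (Letter.cross i :: Letter.cross j :: z)
      (Letter.cross j :: Letter.cross i :: z) := by
  refine Eqv.of_eq h₁ h₂ ?_ (by simp [Letter.size]) ?_
  · obtain ⟨κ₁, ⟨κ₀, h3, h4⟩, h5⟩ := h₁
    obtain ⟨κ₂, ⟨κ₀', h6, h7⟩, h8⟩ := h₂
    obtain rfl := h3.unique h6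
    have p1 : Path ρ κ₁ (Letter.cross j :: z) := ⟨κ₀, h3, h4⟩
    have p2 : Path ρ κ₂ (Letter.cross i :: z) := ⟨κ₀, h3, h7⟩
    rw [p1.diagramDeg_cons, p2.diagramDeg_cons, h3.diagramDeg_cons, h3.diagramDeg_cons,
      ← add_assoc, ← add_assoc, add_comm (pieceDeg N (redPos κ₁) _)]
    congr 2
    · refine pieceDeg_congr fun m => ?_
      rw [h7.2.2 m, Equiv.swap_apply_def]
      split_ifs <;> omega
    · refine pieceDeg_congr fun m => ?_
      rw [h4.2.2 m, Equiv.swap_apply_def]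
      split_ifs <;> omega
  · have := RingQuot.mkAlgHom_rel k (Rel.cross_cross (k := k) (b := b) (N := N) i j hij)
    simp only [map_mul, mk_fC] at this
    rw [diagram_cons, diagram_cons, diagram_cons, diagram_cons, ← mul_assoc, ← mul_assoc, this]

lemma eqv_nail_cross {i : ℕ} (hi : 0 < i)
    (h₁ : Path ρ κ (Letter.nail :: Letter.cross i :: z))
    (h₂ : Path ρ κ (Letter.cross i :: Letter.nail :: z)) :
    Eqv k N ρ κ (Letter.nail :: Letter.cross i :: z) (Letter.cross i :: Letter.nail :: z) := by
  refine Eqv.of_eq h₁ h₂ ?_ (by simp [Letter.size]) ?_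
  · obtain ⟨κ₁, ⟨κ₀, h3, h4⟩, -, rfl⟩ := h₁
    obtain ⟨κ₂, ⟨κ₀', h6, h7⟩, h8⟩ := h₂
    obtain ⟨h7, rfl⟩ := h7
    obtain rfl := h3.unique h6
    have p1 : Path ρ κ (Letter.cross i :: z) := ⟨κ₀, h3, h4⟩
    have p2 : Path ρ κ₀ (Letter.nail :: z) := ⟨κ₀, h3, h7, rfl⟩
    rw [p1.diagramDeg_cons, p2.diagramDeg_cons, h3.diagramDeg_cons, h3.diagramDeg_cons,
      ← add_assoc, ← add_assoc, add_comm (pieceDeg N (redPos κ) _)]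
    rfl
  · have := RingQuot.mkAlgHom_rel k (Rel.nail_cross (k := k) (b := b) (N := N) i hi)
    simp only [map_mul, mk_fC, mk_fN] at this
    rw [diagram_cons, diagram_cons, diagram_cons, diagram_cons, ← mul_assoc, ← mul_assoc, this]

lemma eqv_nail_four
    (h₁ : Path ρ κ
      (Letter.cross 0 :: Letter.nail :: Letter.cross 0 :: Letter.nail :: z))
    (h₂ : Path ρ κ
      (Letter.nail :: Letter.cross 0 :: Letter.nail :: Letter.cross 0 :: z)) :
    Eqv k N ρ κ (Letter.cross 0 :: Letter.nail :: Letter.cross 0 :: Letter.nail :: z)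
      (Letter.nail :: Letter.cross 0 :: Letter.nail :: Letter.cross 0 :: z) := by
  have h₁' := h₁
  have h₂' := h₂
  obtain ⟨κ₁, ⟨κ₂, ⟨κ₃, ⟨κ₄, hz, hs0, rfl⟩, hs1⟩, hs2, rfl⟩, hs3⟩ := h₁'
  have hz1 : IsBlack κ₃ 1 := by
    have := (isBlack_swap hs1.1 hs1.2.2 0).1 hs2
    simpa using this
  obtain rfl := hs1.eq_of_black hs0.2 hz1.2
  obtain rfl := hs3.eq_of_black hs0.2 hz1.2
  refine ⟨h₁, h₂, ?_, by simp [Letter.size], -1, ?_⟩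
  · have p1 : Path ρ κ (Letter.nail :: z) := ⟨κ, hz, hs0, rfl⟩
    have p2 : Path ρ κ (Letter.cross 0 :: Letter.nail :: z) := ⟨κ, p1, hs1⟩
    have p3 : Path ρ κ (Letter.nail :: Letter.cross 0 :: Letter.nail :: z) := ⟨κ, p2, hs0, rfl⟩
    have q1 : Path ρ κ (Letter.cross 0 :: z) := ⟨κ, hz, hs1⟩
    have q2 : Path ρ κ (Letter.nail :: Letter.cross 0 :: z) := ⟨κ, q1, hs0, rfl⟩
    have q3 : Path ρ κ (Letter.cross 0 :: Letter.nail :: Letter.cross 0 :: z) := ⟨κ, q2, hs1⟩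
    rw [p3.diagramDeg_cons, p2.diagramDeg_cons, p1.diagramDeg_cons, hz.diagramDeg_cons,
      q3.diagramDeg_cons, q2.diagramDeg_cons, q1.diagramDeg_cons, hz.diagramDeg_cons]
    abel
  · have hrel := RingQuot.mkAlgHom_rel k (Rel.nail_nail (k := k) (N := N) κ hs0 hz1)
    simp only [map_mul, map_neg, mk_fC, mk_fN, mk_fE] at hrel
    have hneg : ∀ y : T k b N, -(y * idem k N κ) = ((-1 : k) • y) * idem k N κ := fun y => by
      rw [smul_mul_assoc]
      exact (neg_one_smul k _).symm
    have := hz.mul_eq_mul (hrel.trans (hneg _))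
    rw [smul_mul_assoc] at this
    simp only [mul_assoc] at this
    simp only [diagram_cons, this, Units.val_neg, Units.val_one, sub_self]
    exact Submodule.zero_mem _

/-- The braid relations, uniformly in the colours of the three strands. -/
lemma eqv_braid {i : ℕ}
    (h₁ : Path ρ κ (Letter.cross i :: Letter.cross (i + 1) :: Letter.cross i :: z))
    (h₂ : Path ρ κ (Letter.cross (i + 1) :: Letter.cross i :: Letter.cross (i + 1) :: z)) :
    Eqv k N ρ κ (Letter.cross i :: Letter.cross (i + 1) :: Letter.cross i :: z)
      (Letter.cross (i + 1) :: Letter.cross i :: Letter.cross (i + 1) :: z) := by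
  have h₁' := h₁
  have h₂' := h₂
  obtain ⟨κ₂, ⟨κ₁, ⟨κ₀, hz, hs1⟩, hs2⟩, hs3⟩ := h₁'
  obtain ⟨l₂, ⟨l₁, ⟨κ₀', hz', ht1⟩, ht2⟩, ht3⟩ := h₂'
  obtain rfl := hz.unique hz'
  have hi : i + 2 < b + r := hs2.1
  have hr01 := hs1.2.1
  have hr12 := ht1.2.1
  have hr02 : ¬ (IsRed κ₀ i ∧ IsRed κ₀ (i + 2)) := by
    have := hs2.2.1
    rw [isRed_swap hs1.2.2, isRed_swap hs1.2.2, Equiv.swap_apply_right,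
      Equiv.swap_apply_of_ne_of_ne (by omega) (by omega)] at this
    exact this
  have p1 : Path ρ κ₁ (Letter.cross i :: z) := ⟨κ₀, hz, hs1⟩
  have p2 : Path ρ κ₂ (Letter.cross (i + 1) :: Letter.cross i :: z) := ⟨κ₁, p1, hs2⟩
  have q1 : Path ρ l₁ (Letter.cross (i + 1) :: z) := ⟨κ₀, hz, ht1⟩
  have q2 : Path ρ l₂ (Letter.cross i :: Letter.cross (i + 1) :: z) := ⟨l₁, q1, ht2⟩
  have hdeg : diagramDeg N ρ (Letter.cross i :: Letter.cross (i + 1) :: Letter.cross i :: z) =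
      diagramDeg N ρ (Letter.cross (i + 1) :: Letter.cross i :: Letter.cross (i + 1) :: z) := by
    rw [p2.diagramDeg_cons, p1.diagramDeg_cons, hz.diagramDeg_cons,
      q2.diagramDeg_cons, q1.diagramDeg_cons, hz.diagramDeg_cons]
    have e1 : pieceDeg N (redPos κ₂) (Letter.cross i) =
        pieceDeg N (redPos κ₀) (Letter.cross (i + 1)) := by
      refine pieceDeg_congr fun m => ?_
      rw [hs2.2.2 m, hs1.2.2 m]
      simp only [Equiv.swap_apply_def]
      split_ifs <;> omega
    have e2 : pieceDeg N (redPos l₂) (Letter.cross (i + 1)) =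
        pieceDeg N (redPos κ₀) (Letter.cross i) := by
      refine pieceDeg_congr fun m => ?_
      rw [ht2.2.2 m, ht1.2.2 m]
      simp only [Equiv.swap_apply_def]
      split_ifs <;> omega
    have e3 : pieceDeg N (redPos κ₁) (Letter.cross (i + 1)) =
        pieceDeg N (redPos l₁) (Letter.cross i) := by
      refine pieceDeg_congr fun m => ?_
      rw [hs1.2.2 m, ht1.2.2 m]
      simp only [Equiv.swap_apply_def]
      split_ifs <;> omega
    rw [e1, e2, e3]
    abel
  have hexact : piece k N (Letter.cross i) * piece k N (Letter.cross (i + 1)) *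
        piece k N (Letter.cross i) * idem k N κ₀ =
      piece k N (Letter.cross (i + 1)) * piece k N (Letter.cross i) *
        piece k N (Letter.cross (i + 1)) * idem k N κ₀ →
      Eqv k N ρ κ (Letter.cross i :: Letter.cross (i + 1) :: Letter.cross i :: z)
        (Letter.cross (i + 1) :: Letter.cross i :: Letter.cross (i + 1) :: z) := by
    intro hrel
    refine Eqv.of_eq h₁ h₂ hdeg (by simp [Letter.size]) ?_
    have := hz.mul_eq_mul hrel
    simpa only [diagram_cons, mul_assoc] using this
  by_cases hr1 : IsRed κ₀ (i + 1)
  · obtain ⟨j, hj⟩ := hr1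
    have hb0 : IsBlack κ₀ i := ⟨by omega, fun h => hr01 ⟨h, ⟨j, hj⟩⟩⟩
    have hb2 : IsBlack κ₀ (i + 2) := ⟨by omega, fun h => hr12 ⟨⟨j, hj⟩, h⟩⟩
    have hκ : κ = κ₀ := comp_ext fun m => by
      have e0 : redPos κ₀ m ≠ i := fun e => hb0.2 ⟨m, e⟩
      have e2 : redPos κ₀ m ≠ i + 2 := fun e => hb2.2 ⟨m, e⟩
      rw [hs3.2.2 m, hs2.2.2 m, hs1.2.2 m]
      simp only [Equiv.swap_apply_def]
      split_ifs <;> omega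
    subst hκ
    refine ⟨h₁, h₂, hdeg, by simp [Letter.size], 1, ?_⟩
    have hrel := RingQuot.mkAlgHom_rel k (Rel.braid_red_mid (k := k) (N := N) i κ j hb0 hj hb2)
    simp only [map_mul, map_add, map_sum, map_pow, mk_fC, mk_fX, mk_fE] at hrel
    rw [← Finset.sum_mul, ← add_mul] at hrel
    have := hz.mul_eq_mul hrel
    rw [add_mul, Finset.sum_mul] at this
    simp only [mul_assoc] at this
    simp only [diagram_cons, this, Units.val_one, one_smul, add_sub_cancel_left]
    refine Submodule.sum_mem _ fun m hm => ?_
    rw [Finset.mem_range] at hm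
    rw [← diagram_replicate_dot, ← diagram_replicate_dot]
    refine (path_replicate_dot (path_replicate_dot hz hb2 _) hb0 _).mem_lower ?_ ?_
    · rw [diagramDeg_replicate_dot, diagramDeg_replicate_dot, p2.diagramDeg_cons,
        p1.diagramDeg_cons, hz.diagramDeg_cons]
      have e1 : redPos κ₁ j = i := by rw [hs1.2.2 j, hj, Equiv.swap_apply_right]
      have e2 : redPos κ₂ j = i := by
        rw [hs2.2.2 j, e1, Equiv.swap_apply_of_ne_of_ne (by omega) (by omega)]
      have r11 : ¬ IsRed κ₁ (i + 1) := by
        rw [isRed_swap hs1.2.2, Equiv.swap_apply_right]; exact hb0.2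
      have r12 : ¬ IsRed κ₁ (i + 1 + 1) := by
        rw [isRed_swap hs1.2.2, Equiv.swap_apply_of_ne_of_ne (by omega) (by omega)]; exact hb2.2
      have r21 : ¬ IsRed κ₂ (i + 1) := by
        rw [isRed_swap hs2.2.2, Equiv.swap_apply_left]; exact r12
      rw [pieceDeg_red_left e2 r21, pieceDeg_black r11 r12, pieceDeg_red_right hb0.2 hj]
      simp only [← add_assoc, Prod.mk_add_mk, add_zero]
      congr 3
      omega
    · rw [wordSize_replicate_dot, wordSize_replicate_dot]
      simp [Letter.size]
      omega
  · have hb1 : IsBlack κ₀ (i + 1) := ⟨by omega, hr1⟩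
    by_cases hr0 : IsRed κ₀ i
    · have hb2 : IsBlack κ₀ (i + 2) := ⟨by omega, fun h => hr02 ⟨hr0, h⟩⟩
      apply hexact
      simpa [mk_fE, mk_fC] using
        RingQuot.mkAlgHom_rel k (Rel.braid_red_left (k := k) (N := N) i κ₀ hr0 hb1 hb2)
    · have hb0 : IsBlack κ₀ i := ⟨by omega, hr0⟩
      by_cases hr2 : IsRed κ₀ (i + 2)
      · apply hexact
        simpa [mk_fE, mk_fC] using
          RingQuot.mkAlgHom_rel k (Rel.braid_red_right (k := k) (N := N) i κ₀ hb0 hb1 hr2)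
      · have hb2 : IsBlack κ₀ (i + 2) := ⟨by omega, hr2⟩
        apply hexact
        simpa [mk_fE, mk_fC] using
          RingQuot.mkAlgHom_rel k (Rel.braid (k := k) (N := N) i κ₀ hb0 hb1 hb2)

/-- A dot below a nail may be moved above it. -/
lemma slide_nail {p : ℕ} (hz : Path ρ κ z) (hs : IsBlack κ 0) (hp : IsBlack κ p) :
    Eqv k N ρ κ (Letter.nail :: Letter.dot p :: z) (Letter.dot p :: Letter.nail :: z) := by
  have p1 : Path ρ κ (Letter.dot p :: z) := ⟨κ, hz, hp, rfl⟩
  have q1 : Path ρ κ (Letter.nail :: z) := ⟨κ, hz, hs, rfl⟩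
  refine Eqv.of_eq ⟨κ, p1, hs, rfl⟩ ⟨κ, q1, hp, rfl⟩ ?_ (by simp [Letter.size]) ?_
  · rw [p1.diagramDeg_cons, q1.diagramDeg_cons, hz.diagramDeg_cons, hz.diagramDeg_cons]
    abel
  · simp only [diagram_cons, ← mul_assoc]
    rcases Nat.eq_zero_or_pos p with rfl | hp0
    · exact hz.mul_eq_mul (by
        simpa [mk_fE, mk_fN, mk_fX] using
          RingQuot.mkAlgHom_rel k (Rel.nail_dot_zero (k := k) (N := N) κ hs))
    · have := RingQuot.mkAlgHom_rel k (Rel.nail_dot (k := k) (b := b) (N := N) p hp0)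
      simp only [map_mul, mk_fX, mk_fN] at this
      rw [this]

/-- A dot below a crossing may be moved above it, modulo the diagram without the crossing. -/
lemma slide_cross {i p : ℕ} (hz : Path ρ κ z) (hs : Step (Letter.cross i) κ κ')
    (hp : IsBlack κ p) :
    Eqv k N ρ κ' (Letter.cross i :: Letter.dot p :: z)
      (Letter.dot (Equiv.swap i (i + 1) p) :: Letter.cross i :: z) := by
  have p1 : Path ρ κ (Letter.dot p :: z) := ⟨κ, hz, hp, rfl⟩
  have q1 : Path ρ κ' (Letter.cross i :: z) := ⟨κ, hz, hs⟩
  have hq : IsBlack κ' (Equiv.swap i (i + 1) p) := by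
    rw [isBlack_swap hs.1 hs.2.2, Equiv.swap_apply_self]; exact hp
  have p2 : Path ρ κ' (Letter.cross i :: Letter.dot p :: z) := ⟨κ, p1, hs⟩
  have q2 : Path ρ κ' (Letter.dot (Equiv.swap i (i + 1) p) :: Letter.cross i :: z) :=
    ⟨κ', q1, hq, rfl⟩
  have hdeg : diagramDeg N ρ (Letter.cross i :: Letter.dot p :: z) =
      diagramDeg N ρ (Letter.dot (Equiv.swap i (i + 1) p) :: Letter.cross i :: z) := by
    rw [p1.diagramDeg_cons, q1.diagramDeg_cons, hz.diagramDeg_cons, hz.diagramDeg_cons]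
    simp only [pieceDeg]
    abel
  have hsize : wordSize (Letter.cross i :: Letter.dot p :: z) =
      wordSize (Letter.dot (Equiv.swap i (i + 1) p) :: Letter.cross i :: z) := by
    simp [Letter.size]
  have hexact : piece k N (Letter.cross i) * piece k N (Letter.dot p) * idem k N κ =
      piece k N (Letter.dot (Equiv.swap i (i + 1) p)) * piece k N (Letter.cross i) *
        idem k N κ →
      Eqv k N ρ κ' (Letter.cross i :: Letter.dot p :: z)
        (Letter.dot (Equiv.swap i (i + 1) p) :: Letter.cross i :: z) := by
    intro hrel
    refine Eqv.of_eq p2 q2 hdeg hsize ?_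
    have := hz.mul_eq_mul hrel
    simpa only [diagram_cons, mul_assoc] using this
  have hi := hs.1
  -- between two black strands there is an error term, the diagram `z`
  have hblack : ¬ IsRed κ i → ¬ IsRed κ (i + 1) → ∀ ε : k,
      piece k N (Letter.cross i) * piece k N (Letter.dot p) * idem k N κ =
      (piece k N (Letter.dot (Equiv.swap i (i + 1) p)) * piece k N (Letter.cross i) +
        ε • 1) * idem k N κ →
      Eqv k N ρ κ' (Letter.cross i :: Letter.dot p :: z)
        (Letter.dot (Equiv.swap i (i + 1) p) :: Letter.cross i :: z) := by
    intro h0 h1 ε hrel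
    refine ⟨p2, q2, hdeg, hsize, 1, ?_⟩
    have := hz.mul_eq_mul hrel
    rw [add_mul, smul_one_mul] at this
    simp only [mul_assoc] at this
    simp only [diagram_cons, this, Units.val_one, one_smul, add_sub_cancel_left]
    obtain rfl := hs.eq_of_black h0 h1
    refine Submodule.smul_mem _ _ (hz.mem_lower ?_ (by simp [Letter.size]))
    rw [p1.diagramDeg_cons, hz.diagramDeg_cons, pieceDeg_black h0 h1, ← add_assoc]
    simp [pieceDeg]
  by_cases hpi : p = i
  · subst hpi
    rw [Equiv.swap_apply_left] at hexact hblack ⊢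
    by_cases h1 : IsRed κ (p + 1)
    · apply hexact
      simpa [mk_fE, mk_fC, mk_fX] using
        RingQuot.mkAlgHom_rel k (Rel.dot_red_right (k := k) (N := N) p κ hp h1)
    · refine hblack hp.2 h1 1 ?_
      have := RingQuot.mkAlgHom_rel k (Rel.dot_slide_left (k := k) (N := N) p κ hp ⟨hi, h1⟩)
      simp only [map_mul, map_add, mk_fC, mk_fX, mk_fE] at this
      rw [this, add_mul, one_smul, one_mul]
  · by_cases hpi' : p = i + 1
    · subst hpi'
      rw [Equiv.swap_apply_right] at hexact hblack ⊢
      by_cases h0 : IsRed κ i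
      · apply hexact
        have := RingQuot.mkAlgHom_rel k (Rel.dot_red_left (k := k) (N := N) i κ h0 hp)
        simp only [map_mul, mk_fC, mk_fX, mk_fE] at this
        exact this.symm
      · refine hblack h0 hp.2 (-1) ?_
        have := RingQuot.mkAlgHom_rel k
          (Rel.dot_slide_right (k := k) (N := N) i κ ⟨by omega, h0⟩ hp)
        simp only [map_mul, map_add, mk_fC, mk_fX, mk_fE] at this
        rw [add_mul, this, smul_one_mul]
        module
    · rw [Equiv.swap_apply_of_ne_of_ne hpi hpi'] at hexact ⊢
      apply hexact
      have := RingQuot.mkAlgHom_rel k (Rel.dot_cross (k := k) (b := b) (N := N) p i hpi hpi')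
      simp only [map_mul, mk_fX, mk_fC] at this
      rw [this]

end Moves

/-! ### Reduced words of the same arrangement -/

section Matsumoto

variable {k : Type*} [CommRing k] {b r : ℕ} {N : Fin r → ℕ} {ρ κ κ' : Comp b r}

lemma notDot_of_descent {n : ℕ} {a : Letter} {f : ℕ → ℤ} (h : Descent n a f) : NotDot a := by
  cases a with
  | dot p => exact h.elim
  | cross i => trivial
  | nail => trivial

/-- A reduced word with a given first letter, for each descent of an arrangement. -/
lemma Colours.exists_reduced_cons {f : ℕ → ℤ} (h : Colours ρ κ f) {a : Letter}
    (ha : Descent (b + r) a f) : ∃ κ' u, Step a κ' κ ∧ Path ρ κ' u ∧ (∀ c ∈ u, NotDot c) ∧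
      signedState u = signedStep a f ∧ u.length + 1 = signedLength (b + r) f := by
  obtain ⟨κ', h1, h2⟩ := h.exists_step_of_descent ha
  obtain ⟨u, h3, h4, h5, h6⟩ := h2.exists_reduced
  exact ⟨κ', u, h1, h3, h4, h5, by rw [h6, ha.signedLength]⟩

/-- The word `x` can be put on top of a reduced word with top arrangement `g`, and the result is
a reduced word with top arrangement `f`. -/
def Extends (n : ℕ) (f : ℕ → ℤ) : List Letter → (ℕ → ℤ) → Prop
  | [], g => f = g
  | a :: x, g => Descent n a f ∧ Extends n (signedStep a f) x g

lemma Extends.path {x : List Letter} {f g : ℕ → ℤ} (hx : Extends (b + r) f x g)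
    (hf : Colours ρ κ f) {z : List Letter} (hz : Path ρ κ' z) (hg : signedState z = g) :
    Path ρ κ (x ++ z) ∧ signedState (x ++ z) = f ∧
      signedLength (b + r) f = x.length + signedLength (b + r) g := by
  induction x generalizing f κ with
  | nil =>
    obtain rfl : f = g := hx
    obtain rfl := hf.unique (hg ▸ hz.colours)
    exact ⟨hz, hg, by simp⟩
  | cons a x ih =>
    obtain ⟨h1, h2⟩ := hx
    obtain ⟨κ₁, h3, h4⟩ := hf.exists_step_of_descent h1
    obtain ⟨h5, h6, h7⟩ := ih h2 h4
    refine ⟨⟨κ₁, h5, h3⟩, ?_, ?_⟩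
    · rw [List.cons_append, signedState_cons, h6, signedStep_signedStep]
    · rw [h1.signedLength, h7, List.length_cons]; omega

lemma Extends.notDot {n : ℕ} {x : List Letter} {f g : ℕ → ℤ} (hx : Extends n f x g) :
    ∀ c ∈ x, NotDot c := by
  induction x generalizing f with
  | nil => simp
  | cons a x ih =>
    intro c hc
    rcases List.mem_cons.1 hc with rfl | hc
    · exact notDot_of_descent hx.1
    · exact ih hx.2 c hc

lemma Extends.exists_colours {x : List Letter} {f g : ℕ → ℤ} (hx : Extends (b + r) f x g)
    (hf : Colours ρ κ f) : ∃ κ', Colours ρ κ' g := by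
  induction x generalizing f κ with
  | nil => obtain rfl : f = g := hx; exact ⟨κ, hf⟩
  | cons a x ih =>
    obtain ⟨κ₁, -, h4⟩ := hf.exists_step_of_descent hx.1
    exact ih hx.2 h4

variable (k N) in
/-- There are equivalent reduced words of the arrangement `f` that start with `a` and `c`. -/
def Diamond (ρ κ : Comp b r) (f : ℕ → ℤ) (a c : Letter) : Prop :=
  ∃ x y, Eqv k N ρ κ (a :: x) (c :: y) ∧ (∀ e ∈ x, NotDot e) ∧ (∀ e ∈ y, NotDot e) ∧
    signedState (a :: x) = f ∧ signedState (c :: y) = f ∧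
    x.length + 1 = signedLength (b + r) f ∧ y.length + 1 = signedLength (b + r) f

lemma Diamond.symm {f : ℕ → ℤ} {a c : Letter} (h : Diamond k N ρ κ f a c) :
    Diamond k N ρ κ f c a := by
  obtain ⟨x, y, h1, h2, h3, h4, h5, h6, h7⟩ := h
  exact ⟨y, x, h1.symm, h3, h2, h5, h4, h7, h6⟩

/-- The two reduced words of the longest element of a rank two parabolic subgroup give a
diamond, if they are equivalent. -/
lemma Colours.diamond {f g : ℕ → ℤ} (hf : Colours ρ κ f) {a c : Letter} {x y : List Letter}
    (hx : Extends (b + r) f (a :: x) g) (hy : Extends (b + r) f (c :: y) g)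
    (hxy : ∀ z, Path ρ κ (a :: x ++ z) → Path ρ κ (c :: y ++ z) →
      Eqv k N ρ κ (a :: x ++ z) (c :: y ++ z)) : Diamond k N ρ κ f a c := by
  obtain ⟨κ', hg⟩ := hx.exists_colours hf
  obtain ⟨z, hz, hnd, hs, hl⟩ := hg.exists_reduced
  obtain ⟨p1, p2, p3⟩ := hx.path hf hz hs
  obtain ⟨q1, q2, q3⟩ := hy.path hf hz hs
  refine ⟨x ++ z, y ++ z, hxy z p1 q1, ?_, ?_, p2, q2, ?_, ?_⟩
  · intro e he
    rcases List.mem_append.1 he with he | he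
    exacts [hx.notDot e (List.mem_cons_of_mem _ he), hnd e he]
  · intro e he
    rcases List.mem_append.1 he with he | he
    exacts [hy.notDot e (List.mem_cons_of_mem _ he), hnd e he]
  · rw [List.length_append, p3, hl, List.length_cons]; omega
  · rw [List.length_append, q3, hl, List.length_cons]; omega

lemma signedStep_cross_apply_of_ne {i p : ℕ} (f : ℕ → ℤ) (h : p ≠ i) (h' : p ≠ i + 1) :
    signedStep (Letter.cross i) f p = f p := by
  simp only [signedStep, Function.comp]
  rw [Equiv.swap_apply_of_ne_of_ne h h']

@[simp] lemma signedStep_cross_left (i : ℕ) (f : ℕ → ℤ) :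
    signedStep (Letter.cross i) f i = f (i + 1) := by simp [signedStep]

@[simp] lemma signedStep_cross_right (i : ℕ) (f : ℕ → ℤ) :
    signedStep (Letter.cross i) f (i + 1) = f i := by simp [signedStep]

@[simp] lemma signedStep_nail_zero (f : ℕ → ℤ) :
    signedStep Letter.nail f 0 = - f 0 := by simp [signedStep]

lemma signedStep_nail_of_ne {p : ℕ} (f : ℕ → ℤ) (h : p ≠ 0) :
    signedStep Letter.nail f p = f p := by
  simp only [signedStep]
  rw [Function.update_of_ne h]

lemma Colours.diamond_cross_cross {f : ℕ → ℤ} (hf : Colours ρ κ f) {i j : ℕ} (hij : i < j)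
    (hi : Descent (b + r) (Letter.cross i) f) (hj : Descent (b + r) (Letter.cross j) f) :
    Diamond k N ρ κ f (Letter.cross i) (Letter.cross j) := by
  obtain ⟨hi1, hi2⟩ := hi
  obtain ⟨hj1, hj2⟩ := hj
  by_cases h : j = i + 1
  · subst h
    have e2 : signedStep (Letter.cross i) f (i + 1 + 1) = f (i + 1 + 1) :=
      signedStep_cross_apply_of_ne f (by omega) (by omega)
    have e0 : signedStep (Letter.cross (i + 1)) f i = f i :=
      signedStep_cross_apply_of_ne f (by omega) (by omega)
    refine hf.diamond (x := [Letter.cross (i + 1), Letter.cross i])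
      (y := [Letter.cross i, Letter.cross (i + 1)]) ⟨⟨hi1, hi2⟩, ⟨hj1, ?_⟩, ⟨hi1, ?_⟩, rfl⟩
      ⟨⟨hj1, hj2⟩, ⟨hi1, ?_⟩, ⟨hj1, ?_⟩, ?_⟩ fun z h1 h2 => eqv_braid h1 h2
    · rw [e2, signedStep_cross_right]; omega
    · rw [signedStep_cross_left, e2, signedStep_cross_apply_of_ne _ (by omega) (by omega),
        signedStep_cross_left]
      exact hj2
    · rw [e0, signedStep_cross_left]; omega
    · rw [signedStep_cross_right, signedStep_cross_apply_of_ne _ (by omega) (by omega), e0,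
        signedStep_cross_right]
      exact hi2
    · have := swap_braid i
      simp only [signedStep]
      funext p
      simp only [Function.comp]
      congr 1
      have h3 := congrArg (fun π : Equiv.Perm ℕ => π p) this
      simpa only [Equiv.Perm.mul_apply] using h3
  · have hij' : i + 1 < j := by omega
    refine hf.diamond (x := [Letter.cross j]) (y := [Letter.cross i])
      ⟨⟨hi1, hi2⟩, ⟨hj1, ?_⟩, rfl⟩ ⟨⟨hj1, hj2⟩, ⟨hi1, ?_⟩, ?_⟩
      fun z h1 h2 => eqv_cross_cross hij' h1 h2
    · rw [signedStep_cross_apply_of_ne _ (by omega) (by omega),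
        signedStep_cross_apply_of_ne _ (by omega) (by omega)]
      exact hj2
    · rw [signedStep_cross_apply_of_ne _ (by omega) (by omega),
        signedStep_cross_apply_of_ne _ (by omega) (by omega)]
      exact hi2
    · simp only [signedStep]
      funext p
      simp only [Function.comp]
      congr 1
      simp only [Equiv.swap_apply_def]
      split_ifs <;> omega

lemma Colours.diamond_nail_cross {f : ℕ → ℤ} (hf : Colours ρ κ f) {i : ℕ}
    (hn : Descent (b + r) Letter.nail f) (hi : Descent (b + r) (Letter.cross i) f) :
    Diamond k N ρ κ f Letter.nail (Letter.cross i) := by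
  obtain ⟨hn1, hn2⟩ := hn
  obtain ⟨hi1, hi2⟩ := hi
  rcases Nat.eq_zero_or_pos i with rfl | hi0
  · rw [zero_add] at hi1 hi2
    have l : ∀ g, signedStep (Letter.cross 0) g 0 = g 1 := fun g => signedStep_cross_left 0 g
    have l' : ∀ g, signedStep (Letter.cross 0) g 1 = g 0 := fun g => signedStep_cross_right 0 g
    have m : ∀ g, signedStep Letter.nail g 1 = g 1 := fun g =>
      signedStep_nail_of_ne g (by omega)
    refine hf.diamond (x := [Letter.cross 0, Letter.nail, Letter.cross 0])
      (y := [Letter.nail, Letter.cross 0, Letter.nail])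
      ⟨⟨hn1, hn2⟩, ⟨hi1, ?_⟩, ⟨hn1, ?_⟩, ⟨hi1, ?_⟩, rfl⟩
      ⟨⟨hi1, hi2⟩, ⟨hn1, ?_⟩, ⟨hi1, ?_⟩, ⟨hn1, ?_⟩, ?_⟩
      fun z h1 h2 => (eqv_nail_four h2 h1).symm
    · rw [zero_add, m, signedStep_nail_zero]; omega
    · rw [l, m]; omega
    · rw [zero_add, m, l', signedStep_nail_zero, signedStep_nail_zero, l, m]; omega
    · rw [l]; omega
    · rw [zero_add, m, l', signedStep_nail_zero, l]; omega
    · rw [l, m, l']; omega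
    · funext p
      by_cases h0 : p = 0
      · subst h0
        simp only [l, l', m, signedStep_nail_zero]
      · by_cases h1 : p = 1
        · subst h1
          simp only [l, l', m, signedStep_nail_zero]
        · have c0 : ∀ g, signedStep (Letter.cross 0) g p = g p := fun g =>
            signedStep_cross_apply_of_ne g h0 h1
          have n0 : ∀ g, signedStep Letter.nail g p = g p := fun g => signedStep_nail_of_ne g h0
          simp only [c0, n0]
  · refine hf.diamond (x := [Letter.cross i]) (y := [Letter.nail])
      ⟨⟨hn1, hn2⟩, ⟨hi1, ?_⟩, rfl⟩ ⟨⟨hi1, hi2⟩, ⟨hn1, ?_⟩, ?_⟩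
      fun z h1 h2 => eqv_nail_cross hi0 h1 h2
    · rw [signedStep_nail_of_ne _ (by omega), signedStep_nail_of_ne _ (by omega)]
      exact hi2
    · rw [signedStep_cross_apply_of_ne _ (by omega) (by omega)]
      exact hn2
    · funext p
      by_cases h0 : p = 0
      · subst h0
        rw [signedStep_nail_zero, signedStep_cross_apply_of_ne _ (by omega) (by omega),
          signedStep_cross_apply_of_ne _ (by omega) (by omega), signedStep_nail_zero]
      · rw [signedStep_nail_of_ne _ h0]
        simp only [signedStep, Function.comp]
        rw [Function.update_of_ne]
        rw [Equiv.swap_apply_def]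
        split_ifs <;> omega

lemma Colours.diamond_of_ne {f : ℕ → ℤ} (hf : Colours ρ κ f) {a c : Letter} (hac : a ≠ c)
    (ha : Descent (b + r) a f) (hc : Descent (b + r) c f) : Diamond k N ρ κ f a c := by
  cases a with
  | dot p => exact ha.elim
  | nail =>
    cases c with
    | dot p => exact hc.elim
    | nail => exact (hac rfl).elim
    | cross j => exact hf.diamond_nail_cross ha hc
  | cross i =>
    cases c with
    | dot p => exact hc.elim
    | nail => exact (hf.diamond_nail_cross hc ha).symm
    | cross j =>
      rcases lt_trichotomy i j with h | rfl | h
      · exact hf.diamond_cross_cross h ha hc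
      · exact (hac rfl).elim
      · exact (hf.diamond_cross_cross h hc ha).symm

lemma Path.descent_of_reduced {a : Letter} {u : List Letter} (h : Path ρ κ (a :: u))
    (hnd : ∀ c ∈ a :: u, NotDot c)
    (hl : (a :: u).length = signedLength (b + r) (signedState (a :: u))) :
    Descent (b + r) a (signedState (a :: u)) ∧
      u.length = signedLength (b + r) (signedState u) := by
  obtain ⟨κ', h1, h2⟩ := h
  have hle := h1.signedLength_le fun c hc => hnd c (List.mem_cons_of_mem _ hc)
  rw [signedState_cons, List.length_cons] at hl
  rcases h1.colours.ascent_or_descent h2 (hnd a List.mem_cons_self) with ha | ha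
  · rw [ha.signedLength] at hl
    exact ⟨ha.descent, by omega⟩
  · have := ha.signedLength
    omega

/-- Matsumoto's theorem in type `B`: two reduced words of the same arrangement are equivalent. -/
lemma eqv_of_reduced (m : ℕ) : ∀ {κ : Comp b r} {u v : List Letter}, Path ρ κ u → Path ρ κ v →
    (∀ a ∈ u, NotDot a) → (∀ a ∈ v, NotDot a) → signedState u = signedState v →
    u.length = m → v.length = m → signedLength (b + r) (signedState u) = m →
    Eqv k N ρ κ u v := by
  induction m with
  | zero =>
    intro κ u v hu hv _ _ _ hlu hlv _
    obtain rfl := List.length_eq_zero_iff.1 hlu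
    obtain rfl := List.length_eq_zero_iff.1 hlv
    exact Eqv.refl hu
  | succ m ih =>
    intro κ u v hu hv hdu hdv hs hlu hlv hl
    obtain ⟨a, u, rfl⟩ := List.exists_cons_of_length_eq_add_one hlu
    obtain ⟨c, v, rfl⟩ := List.exists_cons_of_length_eq_add_one hlv
    have hau := hu.descent_of_reduced hdu (by rw [hlu, hl])
    have hcv := hv.descent_of_reduced hdv (by rw [hlv, ← hs, hl])
    rw [List.length_cons] at hlu hlv
    have hdu' : ∀ e ∈ u, NotDot e := fun e he => hdu e (List.mem_cons_of_mem _ he)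
    have hdv' : ∀ e ∈ v, NotDot e := fun e he => hdv e (List.mem_cons_of_mem _ he)
    -- comparison of two reduced words with the same first letter
    have hcmp : ∀ {a : Letter} {u x : List Letter}, Path ρ κ (a :: u) → Path ρ κ (a :: x) →
        (∀ e ∈ u, NotDot e) → (∀ e ∈ x, NotDot e) → signedState (a :: u) = signedState (a :: x) →
        u.length = m → x.length = m → u.length = signedLength (b + r) (signedState u) →
        Eqv k N ρ κ (a :: u) (a :: x) := by
      intro a u x h1 h2 h3 h4 h5 h6 h7 h8
      obtain ⟨κ₁, h1, hs1⟩ := h1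
      obtain ⟨κ₂, h2, hs2⟩ := h2
      obtain rfl := hs1.unique' hs2
      refine (ih h1 h2 h3 h4 ?_ h6 h7 (by omega)).cons hs1
      rw [signedState_cons, signedState_cons] at h5
      rw [← signedStep_signedStep a (signedState u), h5, signedStep_signedStep]
    by_cases hac : a = c
    · subst hac
      exact hcmp hu hv hdu' hdv' hs (by omega) (by omega) hau.2
    · obtain ⟨x, y, hxy, hx, hy, hsx, hsy, hlx, hly⟩ :=
        hu.colours.diamond_of_ne (k := k) (N := N) hac hau.1 (hs ▸ hcv.1)
      have h1 := hcmp hu hxy.left hdu' hx hsx.symm (by omega) (by omega) hau.2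
      have h2 := hcmp hv hxy.right hdv' hy (hs.symm.trans hsy.symm) (by omega) (by omega) hcv.2
      exact h1.trans (hxy.trans h2.symm)

/-- A word that is not reduced is a combination of diagrams with fewer crossings and nails. -/
lemma low_of_not_reduced {u : List Letter} : ∀ {κ : Comp b r}, Path ρ κ u →
    (∀ a ∈ u, NotDot a) → signedLength (b + r) (signedState u) < u.length → Low k N ρ κ u := by
  induction u with
  | nil => intro κ _ _ h; simp at h
  | cons a u ih =>
    intro κ hu hd hl
    have hu' := hu
    obtain ⟨κ', h1, h2⟩ := hu'
    have hd' : ∀ e ∈ u, NotDot e := fun e he => hd e (List.mem_cons_of_mem _ he)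
    have hle := h1.signedLength_le hd'
    rcases hle.lt_or_eq with hlt | heq
    · exact (ih h1 hd' hlt).cons h2
    · rw [signedState_cons, List.length_cons] at hl
      have ha : Descent (b + r) a (signedState u) := by
        rcases h1.colours.ascent_or_descent h2 (hd a List.mem_cons_self) with ha | ha
        · rw [ha.signedLength] at hl; omega
        · exact ha
      obtain ⟨κ₁, x, hs, hx, hdx, hsx, hlx⟩ := h1.colours.exists_reduced_cons ha
      have hda := hd a List.mem_cons_self
      have he : Eqv k N ρ κ' u (a :: x) := by
        refine eqv_of_reduced u.length h1 ⟨κ₁, hx, hs⟩ hd' ?_ ?_ rfl ?_ heq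
        · intro e he
          rcases List.mem_cons.1 he with rfl | he
          exacts [hda, hdx e he]
        · rw [signedState_cons, hsx, signedStep_signedStep]
        · rw [List.length_cons]; omega
      have hκ : κ₁ = κ := hs.unique' h2.symm
      subst hκ
      exact (he.cons h2).low (low_square hda hx hs)

/-! ### Spanning -/

lemma exists_dot_of_not_notDot {a : Letter} (h : ¬ NotDot a) : ∃ p, a = Letter.dot p := by
  cases a with
  | dot p => exact ⟨p, rfl⟩
  | cross i => exact (h trivial).elim
  | nail => exact (h trivial).elim

lemma exists_slide {a : Letter} (ha : NotDot a) {p : ℕ} {z : List Letter} (hz : Path ρ κ z)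
    (hs : Step a κ κ') (hp : IsBlack κ p) :
    ∃ q, Eqv k N ρ κ' (a :: Letter.dot p :: z) (Letter.dot q :: a :: z) := by
  cases a with
  | dot p => exact ha.elim
  | cross i => exact ⟨_, slide_cross hz hs hp⟩
  | nail =>
    obtain ⟨h0, rfl⟩ := hs
    exact ⟨p, slide_nail hz h0 hp⟩

lemma exists_slide_dots {a : Letter} (ha : NotDot a) {ds z : List Letter}
    (hds : ∀ c ∈ ds, ¬ NotDot c) (hz : Path ρ κ (ds ++ z)) (hs : Step a κ κ') :
    ∃ ds', (∀ c ∈ ds', ¬ NotDot c) ∧ Eqv k N ρ κ' (a :: (ds ++ z)) (ds' ++ a :: z) := by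
  induction ds with
  | nil => exact ⟨[], by simp, Eqv.refl ⟨κ, hz, hs⟩⟩
  | cons d ds ih =>
    obtain ⟨p, rfl⟩ := exists_dot_of_not_notDot (hds d List.mem_cons_self)
    obtain ⟨κ₁, h1, hp, rfl⟩ := hz
    obtain ⟨q, hq⟩ := exists_slide (k := k) (N := N) ha h1 hs hp
    obtain ⟨ds', h2, h3⟩ := ih (fun c hc => hds c (List.mem_cons_of_mem _ hc)) h1
    obtain ⟨κ₂, h4, h5⟩ := hq.right
    obtain rfl := h4.unique h3.left
    refine ⟨Letter.dot q :: ds', ?_, hq.trans (h3.cons h5)⟩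
    intro c hc
    rcases List.mem_cons.1 hc with rfl | hc
    · exact fun h => h
    · exact h2 c hc

/-- All dots may be moved to the top. -/
lemma Path.exists_dots_top {u : List Letter} (hu : Path ρ κ u) :
    ∃ ds z, (∀ c ∈ ds, ¬ NotDot c) ∧ (∀ c ∈ z, NotDot c) ∧ Eqv k N ρ κ u (ds ++ z) := by
  induction u generalizing κ with
  | nil => exact ⟨[], [], by simp, by simp, Eqv.refl hu⟩
  | cons a u ih =>
    obtain ⟨κ', h1, h2⟩ := hu
    obtain ⟨ds, z, h3, h4, h5⟩ := ih h1
    by_cases ha : NotDot a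
    · obtain ⟨ds', h6, h7⟩ := exists_slide_dots (k := k) (N := N) ha h3 h5.right h2
      refine ⟨ds', a :: z, h6, ?_, (h5.cons h2).trans h7⟩
      intro c hc
      rcases List.mem_cons.1 hc with rfl | hc
      exacts [ha, h4 c hc]
    · refine ⟨a :: ds, z, ?_, h4, h5.cons h2⟩
      intro c hc
      rcases List.mem_cons.1 hc with rfl | hc
      exacts [ha, h3 c hc]

lemma dot_mul_dot (p q : ℕ) : piece k (b := b) N (Letter.dot p) * piece k N (Letter.dot q) =
    piece k N (Letter.dot q) * piece k N (Letter.dot p) := by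
  have := RingQuot.mkAlgHom_rel k (Rel.dot_dot (k := k) (b := b) (N := N) p q)
  simpa only [map_mul, mk_fX] using this

/-- The order of the dots does not matter. -/
lemma diagram_perm_dots {ds ds' : List Letter} (h : ds.Perm ds') (hd : ∀ c ∈ ds, ¬ NotDot c)
    (z : List Letter) : diagram k N ρ (ds ++ z) = diagram k N ρ (ds' ++ z) ∧
      diagramDeg N ρ (ds ++ z) = diagramDeg N ρ (ds' ++ z) := by
  have hdeg : ∀ {e : List Letter}, (∀ c ∈ e, ¬ NotDot c) →
      diagramDeg N ρ (e ++ z) = e.length • ((0, 2, 0) : ℤ × ℤ × ℤ) + diagramDeg N ρ z := by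
    intro e he
    induction e with
    | nil => simp
    | cons a e ih =>
      obtain ⟨p, rfl⟩ := exists_dot_of_not_notDot (he a List.mem_cons_self)
      rw [List.cons_append, diagramDeg, ih fun c hc => he c (List.mem_cons_of_mem _ hc),
        List.length_cons, succ_nsmul', add_assoc]
      rfl
  refine ⟨?_, by rw [hdeg hd, hdeg fun c hc => hd c (h.mem_iff.2 hc), h.length_eq]⟩
  clear hdeg
  induction h with
  | nil => rfl
  | cons a _ ih =>
    rw [List.cons_append, List.cons_append, diagram_cons, diagram_cons,
      ih fun c hc => hd c (List.mem_cons_of_mem _ hc)]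
  | swap x y l =>
    obtain ⟨p, rfl⟩ := exists_dot_of_not_notDot (hd x (by simp))
    obtain ⟨q, rfl⟩ := exists_dot_of_not_notDot (hd y (by simp))
    simp only [List.cons_append, diagram_cons, ← mul_assoc]
    rw [dot_mul_dot]
  | trans h1 _ ih1 ih2 =>
    rw [ih1 hd, ih2 fun c hc => hd c (h1.mem_iff.2 hc)]

lemma Path.isBlack_of_mem_dots {ds z : List Letter} (hd : ∀ c ∈ ds, ¬ NotDot c)
    (h : Path ρ κ (ds ++ z)) {p : ℕ} (hp : Letter.dot p ∈ ds) : IsBlack κ p := by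
  induction ds with
  | nil => simp at hp
  | cons a ds ih =>
    obtain ⟨q, rfl⟩ := exists_dot_of_not_notDot (hd a List.mem_cons_self)
    obtain ⟨κ', h1, h2, rfl⟩ := h
    rcases List.mem_cons.1 hp with e | hp
    · obtain rfl : p = q := by simpa using e
      exact h2
    · exact ih (fun c hc => hd c (List.mem_cons_of_mem _ hc)) h1 hp

lemma path_dots_append {ds z : List Letter} (hz : Path ρ κ z)
    (hd : ∀ c ∈ ds, ∃ p, c = Letter.dot p ∧ IsBlack κ p) : Path ρ κ (ds ++ z) := by
  induction ds with
  | nil => exact hz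
  | cons a ds ih =>
    obtain ⟨p, rfl, hp⟩ := hd a List.mem_cons_self
    exact ⟨κ, ih fun c hc => hd c (List.mem_cons_of_mem _ hc), hp, rfl⟩

lemma mem_dotLetters {a : Fin b → ℕ} {c : Letter} (hc : c ∈ dotLetters κ a) :
    ∃ i, c = Letter.dot (blackPos κ i) := by
  simp only [dotLetters, List.mem_flatten, List.mem_ofFn] at hc
  obtain ⟨_, ⟨i, rfl⟩, h⟩ := hc
  exact ⟨i, (List.mem_replicate.1 h).2⟩

lemma isBlack_of_mem_dotLetters {a : Fin b → ℕ} {c : Letter} (hc : c ∈ dotLetters κ a) :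
    ∃ p, c = Letter.dot p ∧ IsBlack κ p := by
  obtain ⟨i, rfl⟩ := mem_dotLetters hc
  exact ⟨_, rfl, isBlack_blackPos κ i⟩

/-- Any dots on black strands are those of `dotLetters` up to order. -/
lemma exists_perm_dotLetters {ds : List Letter}
    (hd : ∀ c ∈ ds, ∃ p, c = Letter.dot p ∧ IsBlack κ p) :
    ∃ a : Fin b → ℕ, ds.Perm (dotLetters κ a) := by
  classical
  induction ds with
  | nil =>
    refine ⟨0, ?_⟩
    have : dotLetters κ (0 : Fin b → ℕ) = [] := by
      simp [dotLetters]
    rw [this]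
  | cons c ds ih =>
    obtain ⟨a, ha⟩ := ih fun c hc => hd c (List.mem_cons_of_mem _ hc)
    obtain ⟨p, rfl, hp⟩ := hd c List.mem_cons_self
    obtain ⟨i, rfl⟩ := exists_blackPos hp
    refine ⟨fun j => a j + if j = i then 1 else 0, (ha.cons _).trans ?_⟩
    rw [List.perm_iff_count]
    intro x
    simp only [dotLetters, List.count_cons, List.count_flatten, List.map_ofFn, List.sum_ofFn,
      Function.comp, List.count_replicate]
    have hsum : ∀ j : Fin b,
        (if (Letter.dot (blackPos κ j) == x) = true then a j + if j = i then 1 else 0 else 0) =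
        (if (Letter.dot (blackPos κ j) == x) = true then a j else 0) +
          if j = i then (if (Letter.dot (blackPos κ j) == x) = true then 1 else 0) else 0 := by
      intro j
      split_ifs <;> rfl
    simp only [hsum, Finset.sum_add_distrib, Finset.sum_ite_eq', Finset.mem_univ, if_true]

/-- Every legal diagram is a combination of the basis elements of the same degree. -/
lemma Path.mem_span {v : redOrdered κ ρ → (Fin b → Fin 2) → List Block}
    (hv : ∀ (w : redOrdered κ ρ) (l : Fin b → Fin 2), IsNailing κ w.1 l (v w l)) (m : ℕ) :
    ∀ u, Path ρ κ u → wordSize u = m → diagram k N ρ u ∈ Submodule.span k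
      ((fun x : BasisIndex κ ρ => diagram k N ρ (basisWord κ (v x.1 x.2.1) x.2.2)) ''
        {x | diagramDeg N ρ (basisWord κ (v x.1 x.2.1) x.2.2) = diagramDeg N ρ u}) := by
  induction m using Nat.strong_induction_on with
  | _ m ih =>
  intro u hu hm
  have hlow : lower k N ρ κ (diagramDeg N ρ u) (wordSize u) ≤ Submodule.span k
      ((fun x : BasisIndex κ ρ => diagram k N ρ (basisWord κ (v x.1 x.2.1) x.2.2)) ''
        {x | diagramDeg N ρ (basisWord κ (v x.1 x.2.1) x.2.2) = diagramDeg N ρ u}) := by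
    refine Submodule.span_le.2 ?_
    rintro _ ⟨u', h1, h2, h3, rfl⟩
    rw [← h2]
    exact ih _ (hm ▸ h3) u' h1 rfl
  obtain ⟨ds, z, hds, hz, he⟩ := hu.exists_dots_top (k := k) (N := N)
  have hpz := Path.of_append_dots hds he.right
  rcases (hpz.signedLength_le hz).lt_or_eq with hlt | heq
  · exact hlow (he.low ((low_of_not_reduced hpz hz hlt).append_left he.right)).mem
  · obtain ⟨w, hw, l, hwl⟩ := hpz.colours.exists_index
    have hn := hv ⟨w, hw⟩ l
    have hst := hwl _ hn
    have hlen := hn.ascending.signedLength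
    rw [hst, heq] at hlen
    have h1 : Eqv k N ρ κ z ((v ⟨w, hw⟩ l).flatMap Block.letters) :=
      eqv_of_reduced z.length hpz (hn.path hw) hz hn.ascending.notDot hst.symm rfl hlen.symm heq
    have h2 := he.trans (h1.append_left he.right)
    obtain ⟨a, ha⟩ := exists_perm_dotLetters (κ := κ) (ds := ds) fun c hc => by
      obtain ⟨p, rfl⟩ := exists_dot_of_not_notDot (hds c hc)
      exact ⟨p, rfl, Path.isBlack_of_mem_dots hds he.right hc⟩
    obtain ⟨h3, h4⟩ := diagram_perm_dots (k := k) (N := N) (ρ := ρ) ha hds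
      ((v ⟨w, hw⟩ l).flatMap Block.letters)
    obtain ⟨ε, hε⟩ := h2.sub_mem
    rw [← sub_add_cancel (diagram k N ρ u) ((ε : k) • diagram k N ρ (ds ++
      (v ⟨w, hw⟩ l).flatMap Block.letters))]
    refine Submodule.add_mem _ (hlow hε) (Submodule.smul_mem _ _ ?_)
    refine Submodule.subset_span ⟨(⟨w, hw⟩, l, a), ?_, h3.symm⟩
    exact h4.symm.trans h2.deg.symm

end Matsumoto

/-! ### The generic representation -/

/-- Scalars and operators from which a right representation is built: elements `x a` of a
commutative ring `K`, indexed by labels, whose differences are invertible, with inverses `d`, and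
operators `eta a` on a `K`-module `V` that square to zero and anticommute. -/
structure RepData (K V : Type*) [CommRing K] [AddCommGroup V] [Module K V] where
  x : ℕ → K
  d : ℕ → ℕ → K
  d_mul : ∀ {a c}, a ≠ c → d a c * (x a - x c) = 1
  eta : ℕ → V →ₗ[K] V
  eta_sq : ∀ a v, eta a (eta a v) = 0
  eta_anti : ∀ a c v, eta a (eta c v) = -eta c (eta a v)

namespace RepData

variable {K V : Type*} [CommRing K] [AddCommGroup V] [Module K V] (D : RepData K V)

lemma d_swap {a c : ℕ} (h : a ≠ c) : D.d c a = -D.d a c := by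
  linear_combination (-D.d a c) * D.d_mul h.symm - D.d c a * D.d_mul h

lemma d_mul_d {a c e : ℕ} (h₁ : a ≠ c) (h₂ : c ≠ e) (h₃ : a ≠ e) :
    D.d a c * D.d c e = D.d a e * (D.d a c + D.d c e) := by
  linear_combination (-D.d a c * D.d c e) * D.d_mul h₃ +
    (D.d a e * D.d c e) * D.d_mul h₁ + (D.d a e * D.d a c) * D.d_mul h₂

end RepData

/-- The simple transposition of the positions `i` and `i + 1`. -/
abbrev sw (i : ℕ) : Equiv.Perm ℕ := Equiv.swap i (i + 1)

section Labels

variable (π : Equiv.Perm ℕ) (i : ℕ)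

lemma mul_sw_left : (π * sw i) i = π (i + 1) := by simp [sw]

lemma mul_sw_right : (π * sw i) (i + 1) = π i := by simp [sw]

lemma mul_sw_of_ne {p : ℕ} (h : p ≠ i) (h' : p ≠ i + 1) : (π * sw i) p = π p := by
  rw [Equiv.Perm.mul_apply, Equiv.swap_apply_of_ne_of_ne h h']

lemma mul_sw_succ_succ : (π * sw i) (i + 1 + 1) = π (i + 1 + 1) :=
  mul_sw_of_ne π i (by omega) (by omega)

lemma mul_sw_succ_apply : (π * sw (i + 1)) i = π i :=
  mul_sw_of_ne π (i + 1) (by omega) (by omega)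

lemma mul_sw_sw : π * sw i * sw i = π := by rw [mul_assoc, Equiv.swap_mul_self, mul_one]

lemma mul_sw_braid :
    π * sw i * sw (i + 1) * sw i = π * sw (i + 1) * sw i * sw (i + 1) := by
  have := swap_braid i
  simp only [mul_assoc] at this ⊢
  rw [this]

end Labels

section Operators

variable {K V : Type*} [CommRing K] [AddCommGroup V] [Module K V] (D : RepData K V)
  {b r : ℕ} (N : Fin r → ℕ) (κ : Comp b r)

/-- The labelled arrangement `π`, with the strand labelled `π p` at position `p`, has the colours
of `1_ρ` and its red strands are in the same order as those of `1_κ`; labels are positions in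
`1_κ`. -/
def Labels (ρ : Comp b r) (π : Equiv.Perm ℕ) : Prop :=
  (∀ p, b + r ≤ p → π p = p) ∧ ∀ j, π (redPos ρ j) = redPos κ j

variable {κ} in
lemma Labels.isRed {ρ : Comp b r} {π : Equiv.Perm ℕ} (h : Labels κ ρ π) (p : ℕ) :
    IsRed κ (π p) ↔ IsRed ρ p := by
  constructor
  · rintro ⟨j, hj⟩
    exact ⟨j, π.injective (by rw [h.2, hj])⟩
  · rintro ⟨j, rfl⟩
    exact ⟨j, (h.2 j).symm⟩

variable {κ} in
lemma Labels.unique {ρ ρ' : Comp b r} {π : Equiv.Perm ℕ} (h : Labels κ ρ π)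
    (h' : Labels κ ρ' π) : ρ = ρ' :=
  comp_ext fun j => π.injective (by rw [h.2, h'.2])

variable {κ} in
lemma Labels.mul_sw {ρ ρ' : Comp b r} {π : Equiv.Perm ℕ} (h : Labels κ ρ π) {i : ℕ}
    (hi : i + 1 < b + r) (hρ : ∀ j, redPos ρ' j = Equiv.swap i (i + 1) (redPos ρ j)) :
    Labels κ ρ' (π * sw i) := by
  refine ⟨fun p hp => ?_, fun j => ?_⟩
  · rw [mul_sw_of_ne _ _ (by omega) (by omega), h.1 p hp]
  · rw [hρ, Equiv.Perm.mul_apply, Equiv.swap_apply_self, h.2]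

/-- The number `N j` that labels the red strand at position `a` of `1_κ`; it is zero if there is
no such strand. -/
noncomputable def redExp (a : ℕ) : ℕ := ∑ j with redPos κ j = a, N j

lemma redExp_redPos (j : Fin r) : redExp N κ (redPos κ j) = N j := by
  unfold redExp
  rw [Finset.sum_eq_single j]
  · intro j' hj' hne
    exact (hne (redPos_injective κ (Finset.mem_filter.1 hj').2)).elim
  · intro h
    simp at h

open Classical in
/-- Right multiplication by the idempotent `1_ρ`. -/
noncomputable def opE (ρ : Comp b r) (φ : Equiv.Perm ℕ → V) : Equiv.Perm ℕ → V :=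
  fun π => if Labels κ ρ π then φ π else 0

open Classical in
/-- The scalar by which a dot at position `p` acts. -/
noncomputable def dotScalar (p : ℕ) (π : Equiv.Perm ℕ) : K :=
  if p < b + r ∧ ¬ IsRed κ (π p) then D.x (π p) else 0

/-- Right multiplication by a dot. -/
noncomputable def opX (p : ℕ) (φ : Equiv.Perm ℕ → V) : Equiv.Perm ℕ → V :=
  fun π => dotScalar D κ p π • φ π

open Classical in
/-- The coefficient of a crossing at the same arrangement: a divided difference for two black
strands. -/
noncomputable def coeffSame (a c : ℕ) : K := if IsRed κ a ∨ IsRed κ c then 0 else D.d a c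

open Classical in
/-- The coefficient of a crossing at the arrangement with the two strands exchanged. -/
noncomputable def coeffSwap (a c : ℕ) : K :=
  if IsRed κ a then (if IsRed κ c then 0 else D.x c ^ redExp N κ a)
  else if IsRed κ c then 1 else D.d a c

/-- Right multiplication by a crossing.  Two black strands with variables `x` and `y` give
`(φ + φ ∘ s) / (x - y)`; a black and a red strand are just exchanged, with a factor `x ^ N` for one
of the two orders. -/
noncomputable def opC (i : ℕ) (φ : Equiv.Perm ℕ → V) : Equiv.Perm ℕ → V :=
  fun π => if i + 1 < b + r then coeffSame D κ (π i) (π (i + 1)) • φ π +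
    coeffSwap D N κ (π i) (π (i + 1)) • φ (π * sw i) else 0

open Classical in
/-- Right multiplication by the nail. -/
noncomputable def opN (φ : Equiv.Perm ℕ → V) : Equiv.Perm ℕ → V :=
  fun π => if 0 < b + r ∧ ¬ IsRed κ (π 0) then D.eta (π 0) (φ π) else 0

variable {N κ} {φ : Equiv.Perm ℕ → V} {π : Equiv.Perm ℕ} {i : ℕ}

lemma opC_black (hi : i + 1 < b + r) (h₀ : ¬ IsRed κ (π i)) (h₁ : ¬ IsRed κ (π (i + 1))) :
    opC D N κ i φ π = D.d (π i) (π (i + 1)) • (φ π + φ (π * sw i)) := by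
  simp only [opC, coeffSame, coeffSwap, if_pos hi, h₀, h₁, or_self, if_false, smul_add]

lemma opC_red_right (hi : i + 1 < b + r) (h₀ : ¬ IsRed κ (π i)) (h₁ : IsRed κ (π (i + 1))) :
    opC D N κ i φ π = φ (π * sw i) := by
  simp only [opC, coeffSame, coeffSwap, if_pos hi, h₀, h₁, or_true, if_true, if_false, zero_smul,
    one_smul, zero_add]

lemma opC_red_left (hi : i + 1 < b + r) (h₀ : IsRed κ (π i)) (h₁ : ¬ IsRed κ (π (i + 1))) :
    opC D N κ i φ π = D.x (π (i + 1)) ^ redExp N κ (π i) • φ (π * sw i) := by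
  simp only [opC, coeffSame, coeffSwap, if_pos hi, h₀, h₁, true_or, if_true, if_false, zero_smul,
    zero_add]

lemma opX_black {p : ℕ} (hp : p < b + r) (h : ¬ IsRed κ (π p)) :
    opX D κ p φ π = D.x (π p) • φ π := by
  simp only [opX, dotScalar]
  rw [if_pos ⟨hp, h⟩]

lemma opN_black (h0 : 0 < b + r) (h : ¬ IsRed κ (π 0)) :
    opN D κ φ π = D.eta (π 0) (φ π) := by
  simp only [opN]
  rw [if_pos ⟨h0, h⟩]

lemma opN_red (h : IsRed κ (π 0)) : opN D κ φ π = 0 := if_neg fun h' => h'.2 h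

lemma opE_pos {ρ : Comp b r} (h : Labels κ ρ π) : opE κ ρ φ π = φ π := if_pos h

lemma opE_neg {ρ : Comp b r} (h : ¬ Labels κ ρ π) : opE κ ρ φ π = 0 := if_neg h

/-- A relation holds above `1_ρ` if it holds at all arrangements with the colours of `1_ρ`. -/
lemma opE_congr {ρ : Comp b r} {f g : Equiv.Perm ℕ → V}
    (h : ∀ π, Labels κ ρ π → f π = g π) : opE κ ρ f = opE κ ρ g := by
  funext π
  by_cases hπ : Labels κ ρ π
  · rw [opE_pos hπ, opE_pos hπ, h π hπ]
  · rw [opE_neg hπ, opE_neg hπ]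

lemma black_labels {ρ : Comp b r} (h : Labels κ ρ π) {p : ℕ} (hp : IsBlack ρ p) :
    p < b + r ∧ ¬ IsRed κ (π p) := ⟨hp.1, fun hr => hp.2 ((h.isRed p).1 hr)⟩

lemma red_labels {ρ : Comp b r} (h : Labels κ ρ π) {p : ℕ} (hp : IsRed ρ p) :
    IsRed κ (π p) := (h.isRed p).2 hp

lemma opE_opX (p : ℕ) (ρ : Comp b r) (φ : Equiv.Perm ℕ → V) :
    opE κ ρ (opX D κ p φ) = opX D κ p (opE κ ρ φ) := by
  funext π
  by_cases h : Labels κ ρ π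
  · simp only [opX, opE_pos h]
  · simp only [opX, opE_neg h, smul_zero]

lemma opE_opX_zero {p : ℕ} {ρ : Comp b r} (h : ¬ IsBlack ρ p) (φ : Equiv.Perm ℕ → V) :
    opE κ ρ (opX D κ p φ) = 0 := by
  funext π
  by_cases hπ : Labels κ ρ π
  · simp only [opE_pos hπ, opX, dotScalar]
    rw [if_neg, zero_smul]
    · rfl
    · rintro ⟨h1, h2⟩
      exact h ⟨h1, fun hr => h2 (red_labels hπ hr)⟩
  · rw [opE_neg hπ]; rfl

lemma opE_opN (ρ : Comp b r) (φ : Equiv.Perm ℕ → V) :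
    opE κ ρ (opN D κ φ) = opN D κ (opE κ ρ φ) := by
  funext π
  by_cases h : Labels κ ρ π
  · simp only [opN, opE_pos h]
  · simp only [opN, opE_neg h, map_zero, ite_self]

lemma opE_opN_zero {ρ : Comp b r} (h : ¬ IsBlack ρ 0) (φ : Equiv.Perm ℕ → V) :
    opE κ ρ (opN D κ φ) = 0 := by
  funext π
  by_cases hπ : Labels κ ρ π
  · simp only [opE_pos hπ, opN]
    rw [if_neg]
    · rfl
    · rintro ⟨h1, h2⟩
      exact h ⟨h1, fun hr => h2 (red_labels hπ hr)⟩
  · rw [opE_neg hπ]; rfl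

lemma opE_opC_zero {ρ : Comp b r} (h : b + r ≤ i + 1 ∨ (IsRed ρ i ∧ IsRed ρ (i + 1)))
    (φ : Equiv.Perm ℕ → V) : opE κ ρ (opC D N κ i φ) = 0 := by
  funext π
  by_cases hπ : Labels κ ρ π
  · simp only [opE_pos hπ, opC, Pi.zero_apply]
    split_ifs with hi
    · obtain ⟨h0, h1⟩ := h.resolve_left (by omega)
      simp only [coeffSame, coeffSwap, red_labels hπ h0, red_labels hπ h1, true_or, if_true,
        zero_smul, add_zero]
    · rfl
  · rw [opE_neg hπ]; rfl

lemma opE_opC {ρ ρ' : Comp b r} (hi : i + 1 < b + r)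
    (h : ∀ j, redPos ρ' j = Equiv.swap i (i + 1) (redPos ρ j)) (φ : Equiv.Perm ℕ → V) :
    opE κ ρ (opC D N κ i φ) = opC D N κ i (opE κ ρ' φ) := by
  have hsymm : ∀ j, redPos ρ j = Equiv.swap i (i + 1) (redPos ρ' j) := fun j => by
    rw [h j, Equiv.swap_apply_self]
  -- two black strands have the same colours before and after the crossing
  have heq : ∀ {σ τ : Comp b r}, (∀ j, redPos τ j = Equiv.swap i (i + 1) (redPos σ j)) →
      ¬ IsRed σ i → ¬ IsRed σ (i + 1) → τ = σ := fun hst h0 h1 => comp_ext fun j => by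
    rw [hst j]
    exact Equiv.swap_apply_of_ne_of_ne (fun e => h0 ⟨j, e⟩) (fun e => h1 ⟨j, e⟩)
  funext π
  have hsw : Labels κ ρ π ↔ Labels κ ρ' (π * sw i) :=
    ⟨fun hπ => hπ.mul_sw hi h, fun hπ => by
      have := hπ.mul_sw hi hsymm
      rwa [mul_sw_sw] at this⟩
  have hsame : coeffSame D κ (π i) (π (i + 1)) ≠ 0 → (Labels κ ρ π ↔ Labels κ ρ' π) := by
    intro hc
    have hb : ¬ (IsRed κ (π i) ∨ IsRed κ (π (i + 1))) := fun hb => hc (if_pos hb)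
    rw [not_or] at hb
    constructor
    · intro hπ
      rwa [heq h (fun hr => hb.1 (red_labels hπ hr)) (fun hr => hb.2 (red_labels hπ hr))]
    · intro hπ
      rwa [heq hsymm (fun hr => hb.1 (red_labels hπ hr)) (fun hr => hb.2 (red_labels hπ hr))]
  by_cases hπ : Labels κ ρ π
  · rw [opE_pos hπ]
    simp only [opC, if_pos hi]
    rw [opE_pos (hsw.1 hπ)]
    by_cases hc : coeffSame D κ (π i) (π (i + 1)) = 0
    · rw [hc, zero_smul, zero_smul]
    · rw [opE_pos ((hsame hc).1 hπ)]
  · rw [opE_neg hπ]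
    simp only [opC, if_pos hi]
    rw [opE_neg (mt hsw.2 hπ)]
    by_cases hc : coeffSame D κ (π i) (π (i + 1)) = 0
    · rw [hc, zero_smul, smul_zero, add_zero]
    · rw [opE_neg (mt (hsame hc).2 hπ), smul_zero, smul_zero, add_zero]

lemma opX_opX (p q : ℕ) (φ : Equiv.Perm ℕ → V) :
    opX D κ q (opX D κ p φ) = opX D κ p (opX D κ q φ) := by
  funext π
  simp only [opX, smul_smul, mul_comm]

lemma opC_opX {p : ℕ} (h : p ≠ i) (h' : p ≠ i + 1) (φ : Equiv.Perm ℕ → V) :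
    opC D N κ i (opX D κ p φ) = opX D κ p (opC D N κ i φ) := by
  funext π
  have e : dotScalar D κ p (π * sw i) = dotScalar D κ p π := by
    unfold dotScalar
    rw [mul_sw_of_ne π i h h']
  simp only [opC, opX, e]
  split_ifs
  · module
  · rw [smul_zero]

lemma opC_opC {j : ℕ} (h : i + 1 < j) (φ : Equiv.Perm ℕ → V) :
    opC D N κ j (opC D N κ i φ) = opC D N κ i (opC D N κ j φ) := by
  funext π
  have e1 : (π * sw i) j = π j := mul_sw_of_ne π i (by omega) (by omega)
  have e2 : (π * sw i) (j + 1) = π (j + 1) := mul_sw_of_ne π i (by omega) (by omega)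
  have e3 : (π * sw j) i = π i := mul_sw_of_ne π j (by omega) (by omega)
  have e4 : (π * sw j) (i + 1) = π (i + 1) := mul_sw_of_ne π j (by omega) (by omega)
  have e5 : π * sw j * sw i = π * sw i * sw j := by
    have := commute_swap_permOf (p := i) (u := [j]) (by simp; omega)
    rw [permOf_cons, permOf, List.map_nil, List.prod_nil, mul_one] at this
    rw [mul_assoc, mul_assoc, this]
  simp only [opC, e1, e2, e3, e4, e5]
  by_cases hj : j + 1 < b + r
  · have hi : i + 1 < b + r := by omega
    simp only [if_pos hi, if_pos hj]
    module
  · simp only [if_neg hj, smul_zero, add_zero, ite_self]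

lemma opX_opN {p : ℕ} (φ : Equiv.Perm ℕ → V) :
    opX D κ p (opN D κ φ) = opN D κ (opX D κ p φ) := by
  funext π
  simp only [opX, opN]
  split_ifs
  · rw [map_smul]
  · rw [smul_zero]

lemma opC_opN (hi : 0 < i) (φ : Equiv.Perm ℕ → V) :
    opC D N κ i (opN D κ φ) = opN D κ (opC D N κ i φ) := by
  funext π
  have e : (π * sw i) 0 = π 0 := mul_sw_of_ne π i (by omega) (by omega)
  by_cases h : i + 1 < b + r
  · by_cases hb : IsRed κ (π 0)
    · rw [opN_red D hb]
      simp only [opC, if_pos h]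
      rw [opN_red D hb, opN_red D (by rwa [e]), smul_zero, smul_zero, add_zero]
    · rw [opN_black D (by omega) hb]
      simp only [opC, if_pos h]
      rw [opN_black D (by omega) hb, opN_black D (by omega) (by rwa [e]), e, LinearMap.map_add,
        LinearMap.map_smul, LinearMap.map_smul]
  · simp only [opC, opN, if_neg h, LinearMap.map_zero, ite_self]

lemma label_ne (π : Equiv.Perm ℕ) {p q : ℕ} (h : p ≠ q) : π p ≠ π q :=
  fun e => h (π.injective e)

lemma opC_sq {ρ : Comp b r} (h₀ : IsBlack ρ i) (h₁ : IsBlack ρ (i + 1))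
    (φ : Equiv.Perm ℕ → V) : opE κ ρ (opC D N κ i (opC D N κ i φ)) = 0 := by
  have : (0 : Equiv.Perm ℕ → V) = opE κ ρ 0 := by funext π; simp [opE]
  rw [this]
  refine opE_congr fun π hπ => ?_
  have b0 := black_labels hπ h₀
  have b1 := black_labels hπ h₁
  rw [opC_black D b1.1 b0.2 b1.2, opC_black D b1.1 b0.2 b1.2,
    opC_black D b1.1 (by rw [mul_sw_left]; exact b1.2) (by rw [mul_sw_right]; exact b0.2),
    mul_sw_sw, mul_sw_left, mul_sw_right, D.d_swap (label_ne π (by omega : i ≠ i + 1)),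
    Pi.zero_apply]
  module

/-- Both sides expand to sums over the six orders of the three strands, and their coefficients agree
by the partial fraction identity `d_mul_d`. -/
lemma opC_braid {ρ : Comp b r} (h₀ : IsBlack ρ i) (h₁ : IsBlack ρ (i + 1))
    (h₂ : IsBlack ρ (i + 1 + 1)) (φ : Equiv.Perm ℕ → V) :
    opE κ ρ (opC D N κ i (opC D N κ (i + 1) (opC D N κ i φ))) =
      opE κ ρ (opC D N κ (i + 1) (opC D N κ i (opC D N κ (i + 1) φ))) := by
  refine opE_congr fun π hπ => ?_
  obtain ⟨-, b0⟩ := black_labels hπ h₀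
  obtain ⟨l1, b1⟩ := black_labels hπ h₁
  obtain ⟨l2, b2⟩ := black_labels hπ h₂
  have key := D.d_mul_d (label_ne π (by omega : i ≠ i + 1))
    (label_ne π (by omega : i + 1 ≠ i + 1 + 1)) (label_ne π (by omega : i ≠ i + 1 + 1))
  have k1 := D.d_swap (label_ne π (by omega : i ≠ i + 1))
  have k2 := D.d_swap (label_ne π (by omega : i + 1 ≠ i + 1 + 1))
  have blk : ∀ {j : ℕ} {ψ : Equiv.Perm ℕ → V} {σ : Equiv.Perm ℕ}, j + 1 < b + r →
      ¬ IsRed κ (σ j) → ¬ IsRed κ (σ (j + 1)) →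
      opC D N κ j ψ σ = D.d (σ j) (σ (j + 1)) • (ψ σ + ψ (σ * sw j)) :=
    fun h h' h'' => opC_black D h h' h''
  have s0 := mul_sw_left
  have s1 := mul_sw_right
  have s2 := mul_sw_succ_succ
  have s3 := mul_sw_succ_apply
  rw [blk l1 b0 b1, blk l2 b1 b2,
    blk l2 (by rw [s1]; exact b0) (by rw [s2]; exact b2), blk l1 b0 b1,
    blk (σ := π * sw (i + 1)) l1 (by rw [s3]; exact b0) (by rw [s0]; exact b2),
    blk (σ := π * sw i) l1 (by rw [s0]; exact b1) (by rw [s1]; exact b0),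
    blk (σ := π * sw i * sw (i + 1)) l1 (by rw [s3, s0]; exact b1)
      (by rw [s0, s2]; exact b2),
    blk l2 b1 b2, blk l1 b0 b1,
    blk (σ := π * sw (i + 1)) l1 (by rw [s3]; exact b0) (by rw [s0]; exact b2),
    blk l2 b1 b2, blk (σ := π * sw i) l2 (by rw [s1]; exact b0) (by rw [s2]; exact b2),
    blk (σ := π * sw (i + 1)) l2 (by rw [s0]; exact b2) (by rw [s1]; exact b1),
    blk (σ := π * sw (i + 1) * sw i) l2 (by rw [s1, s3]; exact b0)
      (by rw [s2, s1]; exact b1)]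
  simp only [s0, s1, s2, s3, mul_sw_sw, mul_sw_braid, k1, k2]
  linear_combination (norm := module)
    ((D.d (π i) (π (i + 1)) - D.d (π (i + 1)) (π (i + 1 + 1))) * key) • φ π +
    (D.d (π i) (π (i + 1)) * key) • φ (π * sw i) -
    (D.d (π (i + 1)) (π (i + 1 + 1)) * key) • φ (π * sw (i + 1))

lemma opX_opC_left {ρ : Comp b r} (h₀ : IsBlack ρ i) (h₁ : IsBlack ρ (i + 1))
    (φ : Equiv.Perm ℕ → V) :
    opE κ ρ (opX D κ i (opC D N κ i φ)) =
      opE κ ρ (opC D N κ i (opX D κ (i + 1) φ) + φ) := by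
  refine opE_congr fun π hπ => ?_
  obtain ⟨l0, b0⟩ := black_labels hπ h₀
  obtain ⟨l1, b1⟩ := black_labels hπ h₁
  have key := D.d_mul (label_ne π (by omega : i ≠ i + 1))
  rw [Pi.add_apply, opX_black D l0 b0, opC_black D l1 b0 b1, opC_black D l1 b0 b1,
    opX_black D l1 b1, opX_black D l1 (by rw [mul_sw_right]; exact b0), mul_sw_right]
  linear_combination (norm := module) key • φ π

lemma opX_opC_right {ρ : Comp b r} (h₀ : IsBlack ρ i) (h₁ : IsBlack ρ (i + 1))
    (φ : Equiv.Perm ℕ → V) :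
    opE κ ρ (opC D N κ i (opX D κ i φ)) =
      opE κ ρ (opX D κ (i + 1) (opC D N κ i φ) + φ) := by
  refine opE_congr fun π hπ => ?_
  obtain ⟨l0, b0⟩ := black_labels hπ h₀
  obtain ⟨l1, b1⟩ := black_labels hπ h₁
  have key := D.d_mul (label_ne π (by omega : i ≠ i + 1))
  rw [Pi.add_apply, opX_black D l1 b1, opC_black D l1 b0 b1, opC_black D l1 b0 b1,
    opX_black D l0 b0, opX_black D l0 (by rw [mul_sw_left]; exact b1), mul_sw_left]
  linear_combination (norm := module) key • φ π

lemma opX_opC_red_left {ρ : Comp b r} (h₀ : IsRed ρ i) (h₁ : IsBlack ρ (i + 1))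
    (φ : Equiv.Perm ℕ → V) :
    opE κ ρ (opC D N κ i (opX D κ i φ)) = opE κ ρ (opX D κ (i + 1) (opC D N κ i φ)) := by
  refine opE_congr fun π hπ => ?_
  have b0 := red_labels hπ h₀
  obtain ⟨l1, b1⟩ := black_labels hπ h₁
  rw [opX_black D l1 b1, opC_red_left D l1 b0 b1, opC_red_left D l1 b0 b1,
    opX_black D (by omega) (by rw [mul_sw_left]; exact b1), mul_sw_left]
  module

lemma opX_opC_red_right {ρ : Comp b r} (h₀ : IsBlack ρ i) (h₁ : IsRed ρ (i + 1))
    (φ : Equiv.Perm ℕ → V) :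
    opE κ ρ (opX D κ i (opC D N κ i φ)) = opE κ ρ (opC D N κ i (opX D κ (i + 1) φ)) := by
  refine opE_congr fun π hπ => ?_
  obtain ⟨l0, b0⟩ := black_labels hπ h₀
  have b1 := red_labels hπ h₁
  have l1 := isRed_lt h₁
  rw [opX_black D l0 b0, opC_red_right D l1 b0 b1, opC_red_right D l1 b0 b1,
    opX_black D l1 (by rw [mul_sw_right]; exact b0), mul_sw_right]

lemma opX_pow_apply {p : ℕ} (hp : p < b + r) (h : ¬ IsRed κ (π p)) (m : ℕ) :
    ((opX D κ p)^[m] φ) π = D.x (π p) ^ m • φ π := by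
  induction m generalizing φ with
  | zero => simp
  | succ m ih =>
    rw [Function.iterate_succ_apply, ih, opX_black D hp h, smul_smul, pow_succ]

lemma opC_sq_red_left {ρ : Comp b r} {j : Fin r} (h₀ : redPos ρ j = i) (h₁ : IsBlack ρ (i + 1))
    (φ : Equiv.Perm ℕ → V) :
    opE κ ρ (opC D N κ i (opC D N κ i φ)) = opE κ ρ ((opX D κ (i + 1))^[N j] φ) := by
  refine opE_congr fun π hπ => ?_
  have b0 := red_labels hπ ⟨j, h₀⟩
  obtain ⟨l1, b1⟩ := black_labels hπ h₁
  have e : redExp N κ (π i) = N j := by rw [← h₀, hπ.2, redExp_redPos]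
  rw [opX_pow_apply D l1 b1, opC_red_left D l1 b0 b1,
    opC_red_right D l1 (by rw [mul_sw_left]; exact b1) (by rw [mul_sw_right]; exact b0),
    mul_sw_sw, e]

lemma opC_sq_red_right {ρ : Comp b r} {j : Fin r} (h₀ : IsBlack ρ i)
    (h₁ : redPos ρ j = i + 1) (φ : Equiv.Perm ℕ → V) :
    opE κ ρ (opC D N κ i (opC D N κ i φ)) = opE κ ρ ((opX D κ i)^[N j] φ) := by
  refine opE_congr fun π hπ => ?_
  have b1 := red_labels hπ ⟨j, h₁⟩
  obtain ⟨l0, b0⟩ := black_labels hπ h₀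
  have l1 := isRed_lt ⟨j, h₁⟩
  have e : redExp N κ (π (i + 1)) = N j := by rw [← h₁, hπ.2, redExp_redPos]
  rw [opX_pow_apply D l0 b0, opC_red_right D l1 b0 b1,
    opC_red_left D l1 (by rw [mul_sw_left]; exact b1) (by rw [mul_sw_right]; exact b0),
    mul_sw_sw, mul_sw_right, mul_sw_left, e]

lemma opC_braid_red_left {ρ : Comp b r} (h₀ : IsRed ρ i) (h₁ : IsBlack ρ (i + 1))
    (h₂ : IsBlack ρ (i + 1 + 1)) (φ : Equiv.Perm ℕ → V) :
    opE κ ρ (opC D N κ i (opC D N κ (i + 1) (opC D N κ i φ))) =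
      opE κ ρ (opC D N κ (i + 1) (opC D N κ i (opC D N κ (i + 1) φ))) := by
  refine opE_congr fun π hπ => ?_
  have b0 := red_labels hπ h₀
  obtain ⟨l1, b1⟩ := black_labels hπ h₁
  obtain ⟨l2, b2⟩ := black_labels hπ h₂
  have s0 := mul_sw_left
  have s1 := mul_sw_right
  have s2 := mul_sw_succ_succ
  have s3 := mul_sw_succ_apply
  rw [opC_red_left D l1 b0 b1,
    opC_red_left D l2 (by rw [s1]; exact b0) (by rw [s2]; exact b2),
    opC_black D (π := π * sw i * sw (i + 1)) l1 (by rw [s3, s0]; exact b1)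
      (by rw [s0, s2]; exact b2),
    opC_black D l2 b1 b2, opC_red_left D l1 b0 b1,
    opC_red_left D (π := π * sw (i + 1)) l1 (by rw [s3]; exact b0) (by rw [s0]; exact b2),
    opC_red_left D (π := π * sw i) l2 (by rw [s1]; exact b0) (by rw [s2]; exact b2),
    opC_red_left D (π := π * sw (i + 1) * sw i) l2 (by rw [s1, s3]; exact b0)
      (by rw [s2, s1]; exact b1)]
  simp only [s0, s1, s2, s3, mul_sw_braid]
  module

lemma opC_braid_red_right {ρ : Comp b r} (h₀ : IsBlack ρ i) (h₁ : IsBlack ρ (i + 1))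
    (h₂ : IsRed ρ (i + 1 + 1)) (φ : Equiv.Perm ℕ → V) :
    opE κ ρ (opC D N κ i (opC D N κ (i + 1) (opC D N κ i φ))) =
      opE κ ρ (opC D N κ (i + 1) (opC D N κ i (opC D N κ (i + 1) φ))) := by
  refine opE_congr fun π hπ => ?_
  obtain ⟨-, b0⟩ := black_labels hπ h₀
  obtain ⟨l1, b1⟩ := black_labels hπ h₁
  have b2 := red_labels hπ h₂
  have l2 := isRed_lt h₂
  have s0 := mul_sw_left
  have s1 := mul_sw_right
  have s2 := mul_sw_succ_succ
  have s3 := mul_sw_succ_apply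
  rw [opC_black D l1 b0 b1, opC_red_right D l2 b1 b2,
    opC_red_right D (π := π * sw i) l2 (by rw [s1]; exact b0) (by rw [s2]; exact b2),
    opC_red_right D (π := π * sw (i + 1)) l1 (by rw [s3]; exact b0) (by rw [s0]; exact b2),
    opC_red_right D (π := π * sw i * sw (i + 1)) l1 (by rw [s3, s0]; exact b1)
      (by rw [s0, s2]; exact b2),
    opC_red_right D l2 b1 b2,
    opC_red_right D (π := π * sw (i + 1)) l1 (by rw [s3]; exact b0) (by rw [s0]; exact b2),
    opC_black D (π := π * sw (i + 1) * sw i) l2 (by rw [s1, s3]; exact b0)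
      (by rw [s2, s1]; exact b1)]
  simp only [s1, s2, s3, mul_sw_braid]

/-- The correction term is the quotient of a difference of `N j`-th powers by the difference of
their bases, which is a geometric sum. -/
lemma opC_braid_red_mid {ρ : Comp b r} {j : Fin r} (h₀ : IsBlack ρ i)
    (h₁ : redPos ρ j = i + 1) (h₂ : IsBlack ρ (i + 1 + 1)) (φ : Equiv.Perm ℕ → V) :
    opE κ ρ (opC D N κ i (opC D N κ (i + 1) (opC D N κ i φ))) =
      opE κ ρ (opC D N κ (i + 1) (opC D N κ i (opC D N κ (i + 1) φ)) +
        ∑ m ∈ Finset.range (N j),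
          (opX D κ (i + 1 + 1))^[N j - 1 - m] ((opX D κ i)^[m] φ)) := by
  refine opE_congr fun π hπ => ?_
  obtain ⟨l0, b0⟩ := black_labels hπ h₀
  have b1 := red_labels hπ ⟨j, h₁⟩
  have l1 := isRed_lt ⟨j, h₁⟩
  obtain ⟨l2, b2⟩ := black_labels hπ h₂
  have e : redExp N κ (π (i + 1)) = N j := by rw [← h₁, hπ.2, redExp_redPos]
  have s0 := mul_sw_left
  have s1 := mul_sw_right
  have s2 := mul_sw_succ_succ
  have s3 := mul_sw_succ_apply
  have hsum : (∑ m ∈ Finset.range (N j),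
      (opX D κ (i + 1 + 1))^[N j - 1 - m] ((opX D κ i)^[m] φ)) π =
      (∑ m ∈ Finset.range (N j),
        D.x (π i) ^ m * D.x (π (i + 1 + 1)) ^ (N j - 1 - m)) • φ π := by
    rw [Finset.sum_apply, Finset.sum_smul]
    refine Finset.sum_congr rfl fun m _ => ?_
    rw [opX_pow_apply D l2 b2, opX_pow_apply D l0 b0, smul_smul, mul_comm]
  have hgeom := (Commute.all (D.x (π i)) (D.x (π (i + 1 + 1)))).geom_sum₂_mul (N j)
  have hd := D.d_mul (label_ne π (by omega : i ≠ i + 1 + 1))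
  rw [Pi.add_apply, hsum, opC_red_right D l1 b0 b1,
    opC_black D (π := π * sw i) l2 (by rw [s1]; exact b0) (by rw [s2]; exact b2),
    opC_red_left D (π := π * sw i) l1 (by rw [s0]; exact b1) (by rw [s1]; exact b0),
    opC_red_left D (π := π * sw i * sw (i + 1)) l1 (by rw [s3, s0]; exact b1)
      (by rw [s0, s2]; exact b2),
    opC_red_left D l2 b1 b2,
    opC_black D (π := π * sw (i + 1)) l1 (by rw [s3]; exact b0) (by rw [s0]; exact b2),
    opC_red_right D (π := π * sw (i + 1)) l2 (by rw [s0]; exact b2) (by rw [s1]; exact b1),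
    opC_red_right D (π := π * sw (i + 1) * sw i) l2 (by rw [s1, s3]; exact b0)
      (by rw [s2, s1]; exact b1)]
  simp only [s0, s1, s2, s3, mul_sw_braid, mul_sw_sw, e]
  set S := ∑ m ∈ Finset.range (N j), D.x (π i) ^ m * D.x (π (i + 1 + 1)) ^ (N j - 1 - m)
  linear_combination (norm := module)
    (-(D.d (π i) (π (i + 1 + 1))) * hgeom + S * hd) • φ π

lemma opN_sq {ρ : Comp b r} (h₀ : IsBlack ρ 0) (φ : Equiv.Perm ℕ → V) :
    opE κ ρ (opN D κ (opN D κ φ)) = 0 := by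
  have : (0 : Equiv.Perm ℕ → V) = opE κ ρ 0 := by funext π; simp [opE]
  rw [this]
  refine opE_congr fun π hπ => ?_
  obtain ⟨l0, b0⟩ := black_labels hπ h₀
  rw [opN_black D l0 b0, opN_black D l0 b0, D.eta_sq]
  rfl

/-- In the expansions of both sides, the operators that nail the two strands occur in opposite
orders. -/
lemma opN_opC_four {ρ : Comp b r} (h₀ : IsBlack ρ 0) (h₁ : IsBlack ρ 1)
    (φ : Equiv.Perm ℕ → V) :
    opE κ ρ (opN D κ (opC D N κ 0 (opN D κ (opC D N κ 0 φ)))) =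
      opE κ ρ (-opC D N κ 0 (opN D κ (opC D N κ 0 (opN D κ φ)))) := by
  refine opE_congr fun π hπ => ?_
  obtain ⟨l0, b0⟩ := black_labels hπ h₀
  obtain ⟨l1, b1⟩ := black_labels hπ h₁
  have s0 : (π * sw 0) 0 = π 1 := mul_sw_left π 0
  have s1 : (π * sw 0) 1 = π 0 := mul_sw_right π 0
  have blk : ∀ {ψ : Equiv.Perm ℕ → V} {σ : Equiv.Perm ℕ},
      ¬ IsRed κ (σ 0) → ¬ IsRed κ (σ 1) →
      opC D N κ 0 ψ σ = D.d (σ 0) (σ 1) • (ψ σ + ψ (σ * sw 0)) :=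
    fun h h' => opC_black D (i := 0) l1 h h'
  have k1 := D.d_swap (label_ne π (by omega : 0 ≠ 1))
  have c0 : ¬ IsRed κ ((π * sw 0) 0) := by rw [s0]; exact b1
  have c1 : ¬ IsRed κ ((π * sw 0) 1) := by rw [s1]; exact b0
  rw [Pi.neg_apply, opN_black D l0 b0, blk b0 b1, opN_black D l0 b0, opN_black D l0 c0,
    blk b0 b1, blk c0 c1, blk b0 b1, opN_black D l0 b0, opN_black D l0 c0, blk b0 b1, blk c0 c1,
    opN_black D l0 b0, opN_black D l0 c0, mul_sw_sw, opN_black D l0 b0]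
  simp only [s0, s1, k1, map_add, map_smul, D.eta_sq, D.eta_anti (π 1) (π 0)]
  module

end Operators

/-! ### The representation of the algebra -/

section Representation

variable {k K V : Type*} [CommRing k] [CommRing K] [Algebra k K] [AddCommGroup V] [Module K V]
  [Module k V] [IsScalarTower k K V] (D : RepData K V) {b r : ℕ} (N : Fin r → ℕ) (κ : Comp b r)

variable (K V) in
/-- The functions that vanish at the arrangements that have the colours of no `1_ρ`. -/
def labelled : Submodule K (Equiv.Perm ℕ → V) where
  carrier := {φ | ∀ π, (∀ ρ : Comp b r, ¬ Labels κ ρ π) → φ π = 0}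
  add_mem' h h' π hπ := by rw [Pi.add_apply, h π hπ, h' π hπ, add_zero]
  zero_mem' π hπ := rfl
  smul_mem' c φ h π hπ := by rw [Pi.smul_apply, h π hπ, smul_zero]

/-- Right multiplication by the idempotent `1_ρ`, as an endomorphism of `labelled`. -/
noncomputable def endE (ρ : Comp b r) : Module.End K (labelled K V κ) where
  toFun φ := ⟨opE κ ρ φ, fun _ hπ => opE_neg (hπ ρ)⟩
  map_add' φ ψ := by
    ext π
    by_cases h : Labels κ ρ π
    · simp [opE_pos h]
    · simp [opE_neg h]
  map_smul' c φ := by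
    ext π
    by_cases h : Labels κ ρ π
    · simp [opE_pos h]
    · simp [opE_neg h]

/-- Right multiplication by a dot, as an endomorphism of `labelled`. -/
noncomputable def endX (p : ℕ) : Module.End K (labelled K V κ) where
  toFun φ := ⟨opX D κ p φ, fun π hπ => by rw [opX, φ.2 π hπ, smul_zero]⟩
  map_add' φ ψ := by
    ext π
    simp [opX]
  map_smul' c φ := by
    ext π
    simp only [opX, SetLike.val_smul, Pi.smul_apply, RingHom.id_apply]
    rw [smul_comm]

lemma opC_mem_labelled (i : ℕ) {φ : Equiv.Perm ℕ → V} (hφ : φ ∈ labelled K V κ) :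
    opC D N κ i φ ∈ labelled K V κ := by
  intro π hπ
  simp only [opC]
  split_ifs with hi
  · rw [hφ π hπ, smul_zero, zero_add]
    by_cases hs : ∀ ρ : Comp b r, ¬ Labels κ ρ (π * sw i)
    · rw [hφ _ hs, smul_zero]
    push Not at hs
    obtain ⟨ρ', h'⟩ := hs
    by_cases hred : IsRed ρ' i ∧ IsRed ρ' (i + 1)
    · have h0 := red_labels h' hred.1
      have h1 := red_labels h' hred.2
      rw [mul_sw_left] at h0
      rw [mul_sw_right] at h1
      rw [coeffSwap, if_pos h1, if_pos h0, zero_smul]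
    · obtain ⟨ρ, hρ⟩ := exists_comp_swap ρ' hi hred
      have := h'.mul_sw hi hρ
      rw [mul_sw_sw] at this
      exact (hπ ρ this).elim
  · rfl

/-- Right multiplication by a crossing, as an endomorphism of `labelled`. -/
noncomputable def endC (i : ℕ) : Module.End K (labelled K V κ) where
  toFun φ := ⟨opC D N κ i φ, opC_mem_labelled D N κ i φ.2⟩
  map_add' φ ψ := by
    ext π
    simp only [opC, Submodule.coe_add, Pi.add_apply]
    split_ifs
    · module
    · rw [add_zero]
  map_smul' c φ := by
    ext π
    simp only [opC, SetLike.val_smul, Pi.smul_apply, RingHom.id_apply]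
    split_ifs
    · module
    · rw [smul_zero]

/-- Right multiplication by the nail, as an endomorphism of `labelled`. -/
noncomputable def endN : Module.End K (labelled K V κ) where
  toFun φ := ⟨opN D κ φ, fun π hπ => by
    simp only [opN, φ.2 π hπ, LinearMap.map_zero, ite_self]⟩
  map_add' φ ψ := by
    ext π
    simp only [opN, Submodule.coe_add, Pi.add_apply, LinearMap.map_add]
    split_ifs
    · rfl
    · rw [add_zero]
  map_smul' c φ := by
    ext π
    simp only [opN, SetLike.val_smul, Pi.smul_apply, RingHom.id_apply, LinearMap.map_smul]
    split_ifs
    · rfl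
    · rw [smul_zero]

/-- Right multiplication by an elementary piece. -/
noncomputable def endPiece : Letter → Module.End K (labelled K V κ)
  | Letter.dot p => endX D κ p
  | Letter.cross i => endC D N κ i
  | Letter.nail => endN D κ

/-- Right multiplication by a generator. -/
noncomputable def endGen : Gen b r → Module.End K (labelled K V κ)
  | Gen.idem ρ => endE κ ρ
  | Gen.piece a => endPiece D N κ a

variable (k) in
/-- The right representation of the free algebra on `labelled`. -/
noncomputable def freeRep : FreeAlgebra k (Gen b r) →ₐ[k] (Module.End K (labelled K V κ))ᵐᵒᵖ :=
  FreeAlgebra.lift k fun a => MulOpposite.op (endGen D N κ a)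

variable (k) in
/-- The right action of an element of the free algebra. -/
noncomputable def act (A : FreeAlgebra k (Gen b r)) (φ : labelled K V κ) : labelled K V κ :=
  (freeRep k D N κ A).unop φ

lemma act_mul (A B : FreeAlgebra k (Gen b r)) (φ : labelled K V κ) :
    act k D N κ (A * B) φ = act k D N κ B (act k D N κ A φ) := by
  simp only [act, map_mul, MulOpposite.unop_mul, Module.End.mul_apply]

lemma act_add (A B : FreeAlgebra k (Gen b r)) (φ : labelled K V κ) :
    act k D N κ (A + B) φ = act k D N κ A φ + act k D N κ B φ := by
  simp only [act, map_add, MulOpposite.unop_add, LinearMap.add_apply]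

lemma act_neg (A : FreeAlgebra k (Gen b r)) (φ : labelled K V κ) :
    act k D N κ (-A) φ = -act k D N κ A φ := by
  simp only [act, map_neg, MulOpposite.unop_neg, LinearMap.neg_apply]

lemma act_zero (φ : labelled K V κ) : act k D N κ 0 φ = 0 := by
  simp only [act, map_zero, MulOpposite.unop_zero, LinearMap.zero_apply]

lemma act_one (φ : labelled K V κ) : act k D N κ 1 φ = φ := by
  simp only [act, map_one, MulOpposite.unop_one, Module.End.one_apply]

lemma act_sum {ι : Type*} (s : Finset ι) (f : ι → FreeAlgebra k (Gen b r))
    (φ : labelled K V κ) : act k D N κ (∑ i ∈ s, f i) φ = ∑ i ∈ s, act k D N κ (f i) φ := by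
  classical
  induction s using Finset.induction_on with
  | empty => simp only [Finset.sum_empty, act_zero]
  | insert a s ha ih => rw [Finset.sum_insert ha, Finset.sum_insert ha, act_add, ih]

lemma act_ι (a : Gen b r) (φ : labelled K V κ) :
    act k D N κ (FreeAlgebra.ι k a) φ = endGen D N κ a φ := by
  simp only [act, freeRep, FreeAlgebra.lift_ι_apply, MulOpposite.unop_op]

lemma act_fE (ρ : Comp b r) (φ : labelled K V κ) :
    (act k D N κ (fE k ρ) φ : Equiv.Perm ℕ → V) = opE κ ρ φ := by
  rw [fE, act_ι]; rfl

lemma act_fX (p : ℕ) (φ : labelled K V κ) :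
    (act k D N κ (fX k p) φ : Equiv.Perm ℕ → V) = opX D κ p φ := by
  rw [fX, act_ι]; rfl

lemma act_fC (i : ℕ) (φ : labelled K V κ) :
    (act k D N κ (fC k i) φ : Equiv.Perm ℕ → V) = opC D N κ i φ := by
  rw [fC, act_ι]; rfl

lemma act_fN (φ : labelled K V κ) :
    (act k D N κ (fN k) φ : Equiv.Perm ℕ → V) = opN D κ φ := by
  rw [fN, act_ι]; rfl

lemma act_fX_pow (p m : ℕ) (φ : labelled K V κ) :
    (act k D N κ (fX k p ^ m) φ : Equiv.Perm ℕ → V) = (opX D κ p)^[m] φ := by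
  induction m generalizing φ with
  | zero => rw [pow_zero, act_one]; rfl
  | succ m ih => rw [pow_succ', act_mul, ih, act_fX, Function.iterate_succ_apply]

lemma opE_opE_self (ρ : Comp b r) (φ : Equiv.Perm ℕ → V) :
    opE κ ρ (opE κ ρ φ) = opE κ ρ φ :=
  opE_congr fun _ hπ => opE_pos hπ

lemma opE_opE_ne {ρ ρ' : Comp b r} (h : ρ ≠ ρ') (φ : Equiv.Perm ℕ → V) :
    opE κ ρ' (opE κ ρ φ) = 0 := by
  funext π
  by_cases h' : Labels κ ρ' π
  · rw [opE_pos h', opE_neg fun h'' => h (h''.unique h')]; rfl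
  · rw [opE_neg h']; rfl

lemma sum_opE (φ : labelled K V κ) : ∑ ρ : Comp b r, opE κ ρ (φ : Equiv.Perm ℕ → V) = φ := by
  funext π
  rw [Finset.sum_apply]
  by_cases h : ∀ ρ : Comp b r, ¬ Labels κ ρ π
  · rw [φ.2 π h]
    exact Finset.sum_eq_zero fun ρ _ => opE_neg (h ρ)
  · push Not at h
    obtain ⟨ρ, hρ⟩ := h
    rw [Finset.sum_eq_single ρ, opE_pos hρ]
    · intro ρ' _ hne
      exact opE_neg fun h' => hne (h'.unique hρ)
    · simp

lemma opE_add (ρ : Comp b r) (f g : Equiv.Perm ℕ → V) :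
    opE κ ρ (f + g) = opE κ ρ f + opE κ ρ g := by
  funext π
  by_cases h : Labels κ ρ π
  · simp only [Pi.add_apply, opE_pos h]
  · simp only [Pi.add_apply, opE_neg h, add_zero]

lemma opE_neg_fun (ρ : Comp b r) (f : Equiv.Perm ℕ → V) :
    opE κ ρ (-f) = -opE κ ρ f := by
  funext π
  by_cases h : Labels κ ρ π
  · simp only [Pi.neg_apply, opE_pos h]
  · simp only [Pi.neg_apply, opE_neg h, neg_zero]

lemma opE_sum {ι : Type*} (ρ : Comp b r) (s : Finset ι) (f : ι → Equiv.Perm ℕ → V) :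
    opE κ ρ (∑ i ∈ s, f i) = ∑ i ∈ s, opE κ ρ (f i) := by
  funext π
  by_cases h : Labels κ ρ π
  · simp only [Finset.sum_apply, opE_pos h]
  · simp only [Finset.sum_apply, opE_neg h, Finset.sum_const_zero]

/-- The operators satisfy the defining relations. -/
lemma act_rel {A B : FreeAlgebra k (Gen b r)} (h : Rel k N A B) (φ : labelled K V κ) :
    act k D N κ A φ = act k D N κ B φ := by
  apply Subtype.ext
  cases h <;>
    simp only [act_mul, act_add, act_neg, act_zero, act_one, act_sum, act_fE, act_fX, act_fC,
      act_fN, act_fX_pow, Submodule.coe_add, Submodule.coe_neg, Submodule.coe_zero,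
      Submodule.coe_sum]
  case idem_mul_self ρ => exact opE_opE_self κ ρ _
  case idem_mul_ne κ' ρ h => exact opE_opE_ne κ h _
  case idem_sum => exact sum_opE κ φ
  case dot_idem p ρ => exact opE_opX D p ρ φ
  case dot_zero p ρ h => exact opE_opX_zero D h φ
  case cross_idem i κ' ρ hi h => exact opE_opC D hi h φ
  case cross_zero i ρ h => exact opE_opC_zero D h φ
  case nail_idem ρ => exact opE_opN D ρ φ
  case nail_zero ρ h => exact opE_opN_zero D h φ
  case dot_dot p q => exact opX_opX D p q φ
  case dot_cross p i h h' => exact opC_opX D h h' φ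
  case cross_cross i j h => exact opC_opC D h φ
  case nail_dot p h => exact opX_opN D φ
  case nail_cross i h => exact opC_opN D h φ
  case cross_sq i ρ h₀ h₁ => exact opC_sq D h₀ h₁ φ
  case braid i ρ h₀ h₁ h₂ => exact opC_braid D h₀ h₁ h₂ φ
  case dot_slide_left i ρ h₀ h₁ =>
    rw [← opE_add]
    exact opX_opC_left D h₀ h₁ φ
  case dot_slide_right i ρ h₀ h₁ =>
    rw [← opE_add]
    exact opX_opC_right D h₀ h₁ φ
  case dot_red_left i ρ h₀ h₁ => exact opX_opC_red_left D h₀ h₁ φ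
  case dot_red_right i ρ h₀ h₁ => exact opX_opC_red_right D h₀ h₁ φ
  case red_sq_left i ρ j h₀ h₁ => exact opC_sq_red_left D h₀ h₁ φ
  case red_sq_right i ρ j h₀ h₁ => exact opC_sq_red_right D h₀ h₁ φ
  case braid_red_left i ρ h₀ h₁ h₂ => exact opC_braid_red_left D h₀ h₁ h₂ φ
  case braid_red_right i ρ h₀ h₁ h₂ => exact opC_braid_red_right D h₀ h₁ h₂ φ
  case braid_red_mid i ρ j h₀ h₁ h₂ =>
    rw [← opE_sum, ← opE_add]
    exact opC_braid_red_mid D h₀ h₁ h₂ φ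
  case nail_dot_zero ρ h₀ => exact congrArg _ (opX_opN D (φ : Equiv.Perm ℕ → V))
  case nail_nail ρ h₀ h₁ =>
    rw [← opE_neg_fun]
    exact opN_opC_four D h₀ h₁ φ
  case nail_sq ρ h₀ => exact opN_sq D h₀ φ

variable (k) in
/-- The right representation of `T_b^{λ,N}` on `labelled`. -/
noncomputable def rep : T k b N →ₐ[k] (Module.End K (labelled K V κ))ᵐᵒᵖ :=
  RingQuot.liftAlgHom k ⟨freeRep k D N κ, fun {A B} h => by
    apply MulOpposite.unop_injective
    exact LinearMap.ext fun φ => act_rel D N κ h φ⟩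

lemma rep_idem (ρ : Comp b r) (φ : labelled K V κ) :
    ((rep k D N κ (idem k N ρ)).unop φ : Equiv.Perm ℕ → V) = opE κ ρ φ := by
  rw [rep, idem, RingQuot.liftAlgHom_mkAlgHom_apply]
  exact act_fE D N κ ρ φ

lemma rep_piece (a : Letter) (φ : labelled K V κ) :
    (rep k D N κ (piece k N a)).unop φ = endPiece D N κ a φ := by
  rw [rep, piece, RingQuot.liftAlgHom_mkAlgHom_apply]
  exact act_ι D N κ _ φ

end Representation

/-! ### The range of the corner map -/

section Spanning

variable {k : Type*} [CommRing k] {b r : ℕ} {N : Fin r → ℕ} {ρ κ : Comp b r}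

/-- The span of the diagrams is a left ideal that contains `1`. -/
lemma span_diagram :
    Submodule.span k {t : T k b N | ∃ (ρ : Comp b r) (u : List Letter), diagram k N ρ u = t} =
      ⊤ := by
  set S := Submodule.span k
    {t : T k b N | ∃ (ρ : Comp b r) (u : List Letter), diagram k N ρ u = t} with hS
  have hmem : ∀ ρ u, diagram k N ρ u ∈ S := fun ρ u => Submodule.subset_span ⟨ρ, u, rfl⟩
  -- the span is a left ideal
  have hgen : ∀ (a : Gen b r) (s : T k b N), s ∈ S →
      RingQuot.mkAlgHom k (Rel k N) (FreeAlgebra.ι k a) * s ∈ S := by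
    intro a s hs
    induction hs using Submodule.span_induction with
    | mem s hs =>
      obtain ⟨ρ, u, rfl⟩ := hs
      cases a with
      | piece a =>
        have := hmem ρ (a :: u)
        rw [diagram_cons] at this
        exact this
      | idem κ =>
        change idem k N κ * _ ∈ S
        rcases path_or_diagram_eq_zero (k := k) (N := N) ρ u with ⟨κ', h⟩ | h
        · by_cases hκ : κ = κ'
          · subst hκ
            rw [h.idem_mul]
            exact hmem ρ u
          · rw [← h.idem_mul, ← mul_assoc, idem_mul_ne hκ, zero_mul]
            exact S.zero_mem
        · rw [h, mul_zero]
          exact S.zero_mem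
    | zero => rw [mul_zero]; exact S.zero_mem
    | add s s' _ _ h h' => rw [mul_add]; exact S.add_mem h h'
    | smul c s _ h => rw [mul_smul_comm]; exact S.smul_mem c h
  have hideal : ∀ (A : FreeAlgebra k (Gen b r)) (s : T k b N), s ∈ S →
      RingQuot.mkAlgHom k (Rel k N) A * s ∈ S := by
    intro A
    induction A using FreeAlgebra.induction with
    | grade0 c =>
      intro s hs
      rw [AlgHom.commutes, ← Algebra.smul_def]
      exact S.smul_mem c hs
    | grade1 a => exact hgen a
    | mul A B hA hB =>
      intro s hs
      rw [map_mul, mul_assoc]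
      exact hA _ (hB _ hs)
    | add A B hA hB =>
      intro s hs
      rw [map_add, add_mul]
      exact S.add_mem (hA _ hs) (hB _ hs)
  have hone : (1 : T k b N) ∈ S := by
    rw [← sum_idem]
    refine S.sum_mem fun ρ _ => ?_
    rw [← diagram_nil]
    exact hmem ρ []
  rw [eq_top_iff]
  intro t _
  obtain ⟨A, rfl⟩ := RingQuot.mkAlgHom_surjective k (Rel k N) t
  rw [← mul_one (RingQuot.mkAlgHom k (Rel k N) A)]
  exact hideal A 1 hone

lemma corner_apply (t : T k b N) : corner k N κ ρ t = idem k N κ * t * idem k N ρ := rfl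

lemma diagram_mul_idem (u : List Letter) :
    diagram k N ρ u * idem k N ρ = diagram k N ρ u := by
  rw [diagram, mul_assoc, idem_mul_self]

lemma Path.corner_diagram {u : List Letter} (h : Path ρ κ u) :
    corner k N κ ρ (diagram k N ρ u) = diagram k N ρ u := by
  rw [corner_apply, h.idem_mul, diagram_mul_idem]

lemma corner_diagram_eq_zero {ρ' : Comp b r} {u : List Letter} (h : ¬ (ρ' = ρ ∧ Path ρ κ u)) :
    corner k N κ ρ (diagram k N ρ' u) = 0 := by
  rw [corner_apply]
  by_cases hρ : ρ' = ρ
  · subst hρ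
    rcases path_or_diagram_eq_zero (k := k) (N := N) ρ' u with ⟨κ', h'⟩ | h'
    · have hκ : κ ≠ κ' := fun e => h ⟨rfl, e ▸ h'⟩
      rw [← h'.idem_mul, ← mul_assoc, idem_mul_ne hκ, zero_mul, zero_mul]
    · rw [h', mul_zero, zero_mul]
  · rw [mul_assoc, diagram, mul_assoc, idem_mul_ne hρ, mul_zero, mul_zero]

/-- A diagram obtained from a nailing is legal. -/
lemma IsNailing.path_basisWord {w : Equiv.Perm (Fin (b + r))} {l : Fin b → Fin 2}
    {v : List Block} (h : IsNailing κ w l v) (hw : w ∈ redOrdered κ ρ) (a : Fin b → ℕ) :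
    Path ρ κ (basisWord κ v a) :=
  path_dots_append (h.path hw) fun _ hc => isBlack_of_mem_dotLetters hc

variable {v : redOrdered κ ρ → (Fin b → Fin 2) → List Block}

lemma span_degree_eq (hv : ∀ (w : redOrdered κ ρ) (l : Fin b → Fin 2), IsNailing κ w.1 l (v w l))
    (g : ℤ × ℤ × ℤ) :
    Submodule.span k
      ((fun x : BasisIndex κ ρ => diagram k N ρ (basisWord κ (v x.1 x.2.1) x.2.2)) ''
        {x | diagramDeg N ρ (basisWord κ (v x.1 x.2.1) x.2.2) = g}) =
      (homogeneousPart k b N g).map (corner k N κ ρ) := by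
  apply le_antisymm
  · rw [Submodule.span_le]
    rintro _ ⟨x, hx, rfl⟩
    exact ⟨_, Submodule.subset_span ⟨ρ, _, hx, rfl⟩,
      ((hv x.1 x.2.1).path_basisWord x.1.2 x.2.2).corner_diagram⟩
  · rw [homogeneousPart, Submodule.map_span, Submodule.span_le]
    rintro _ ⟨_, ⟨ρ', u, rfl, rfl⟩, rfl⟩
    by_cases h : ρ' = ρ ∧ Path ρ κ u
    · obtain ⟨rfl, h⟩ := h
      rw [h.corner_diagram]
      exact h.mem_span hv _ u rfl
    · rw [corner_diagram_eq_zero h]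
      exact Submodule.zero_mem _

lemma span_eq_range (hv : ∀ (w : redOrdered κ ρ) (l : Fin b → Fin 2), IsNailing κ w.1 l (v w l)) :
    Submodule.span k (Set.range
      (fun x : BasisIndex κ ρ => diagram k N ρ (basisWord κ (v x.1 x.2.1) x.2.2))) =
      LinearMap.range (corner k N κ ρ) := by
  apply le_antisymm
  · rw [Submodule.span_le]
    rintro _ ⟨x, rfl⟩
    exact ⟨_, ((hv x.1 x.2.1).path_basisWord x.1.2 x.2.2).corner_diagram⟩
  · rw [LinearMap.range_eq_map, ← span_diagram, Submodule.map_span, Submodule.span_le]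
    rintro _ ⟨_, ⟨ρ', u, rfl⟩, rfl⟩
    by_cases h : ρ' = ρ ∧ Path ρ κ u
    · obtain ⟨rfl, h⟩ := h
      rw [h.corner_diagram]
      exact Submodule.span_mono (Set.image_subset_range _ _) (h.mem_span hv _ u rfl)
    · rw [corner_diagram_eq_zero h]
      exact Submodule.zero_mem _

end Spanning

/-! ### Operators for the generic representation -/

section Creation

variable (K : Type*) [CommRing K] {b : ℕ}

/-- The sign `(-1)^m`, where `m` is the number of elements of `S` that are smaller than `i`. -/
def orderSign (i : Fin b) (S : Finset (Fin b)) : K := (-1) ^ (S.filter (· < i)).card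

variable {K}

lemma orderSign_erase {i j : Fin b} {S : Finset (Fin b)} (hi : i ∈ S) :
    orderSign K j (S.erase i) = (if i < j then -1 else 1) * orderSign K j S := by
  unfold orderSign
  rw [Finset.filter_erase]
  split_ifs with h
  · have hm : i ∈ S.filter (· < j) := Finset.mem_filter.2 ⟨hi, h⟩
    rw [← Finset.card_erase_add_one hm, pow_succ]
    ring
  · rw [Finset.erase_eq_of_notMem (s := S.filter (· < j))
      (fun hm => h (Finset.mem_filter.1 hm).2), one_mul]

variable (K) in
/-- The creation operator of the `i`-th fermion on functions of the set of occupied places, that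
is, multiplication by a generator of an exterior algebra on `b` generators. -/
def creation (i : Fin b) : (Finset (Fin b) → K) →ₗ[K] (Finset (Fin b) → K) where
  toFun Φ S := if i ∈ S then orderSign K i S * Φ (S.erase i) else 0
  map_add' Φ Ψ := by
    ext S
    simp only [Pi.add_apply]
    split_ifs
    · ring
    · rw [add_zero]
  map_smul' c Φ := by
    ext S
    simp only [Pi.smul_apply, smul_eq_mul, RingHom.id_apply]
    split_ifs
    · ring
    · rw [mul_zero]

lemma creation_apply (i : Fin b) (Φ : Finset (Fin b) → K) (S : Finset (Fin b)) :
    creation K i Φ S = if i ∈ S then orderSign K i S * Φ (S.erase i) else 0 := rfl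

lemma creation_sq (i : Fin b) (Φ : Finset (Fin b) → K) : creation K i (creation K i Φ) = 0 := by
  ext S
  rw [creation_apply, creation_apply, if_neg (Finset.notMem_erase i S), mul_zero, ite_self]
  rfl

lemma creation_anti (i j : Fin b) (Φ : Finset (Fin b) → K) :
    creation K i (creation K j Φ) = -creation K j (creation K i Φ) := by
  by_cases hij : i = j
  · subst hij
    rw [creation_sq, neg_zero]
  ext S
  simp only [Pi.neg_apply, creation_apply, Finset.mem_erase, hij, Ne.symm hij, ne_eq,
    not_false_iff, true_and]
  by_cases hi : i ∈ S <;> by_cases hj : j ∈ S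
  · simp only [hi, hj, if_true, orderSign_erase hi, orderSign_erase hj,
      Finset.erase_right_comm (a := i) (b := j)]
    rcases lt_or_gt_of_ne hij with h | h
    · rw [if_pos h, if_neg (not_lt.2 h.le)]
      ring
    · rw [if_pos h, if_neg (not_lt.2 h.le)]
      ring
  all_goals simp [hi, hj]

lemma creation_single {i : Fin b} {S : Finset (Fin b)} (hi : i ∉ S) :
    creation K i (Pi.single S 1) = orderSign K i (insert i S) • Pi.single (insert i S) 1 := by
  ext S'
  rw [creation_apply, Pi.smul_apply, smul_eq_mul]
  by_cases h : S' = insert i S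
  · subst h
    rw [if_pos (Finset.mem_insert_self i S), Finset.erase_insert hi, Pi.single_eq_same,
      Pi.single_eq_same]
  · rw [Pi.single_eq_of_ne h, mul_zero]
    split_ifs with hm
    · rw [Pi.single_eq_of_ne, mul_zero]
      rintro rfl
      exact h (Finset.insert_erase hm).symm
    · rfl

lemma isUnit_orderSign (i : Fin b) (S : Finset (Fin b)) : IsUnit (orderSign K i S) :=
  isUnit_one.neg.pow _

end Creation

section Scalars

variable (k K : Type*) [CommRing k] [CommRing K] [Algebra (MvPolynomial ℕ k) K]

/-- The variable `X_a`, in an algebra over the polynomial ring over `k` in the variables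
`X_0, X_1, …`. -/
noncomputable def scalarX (a : ℕ) : K := algebraMap (MvPolynomial ℕ k) K (MvPolynomial.X a)

lemma isUnit_scalarX [IsFractionRing (MvPolynomial ℕ k) K] (a : ℕ) : IsUnit (scalarX k K a) :=
  IsLocalization.map_units (M := nonZeroDivisors (MvPolynomial ℕ k)) _
    ⟨MvPolynomial.X a, MvPolynomial.isRegular_X.mem_nonZeroDivisors⟩

variable {k} in
/-- A difference of two variables is a variable for other coordinates, hence regular. -/
lemma isRegular_X_sub_X {a c : ℕ} (h : a ≠ c) :
    IsRegular (MvPolynomial.X a - MvPolynomial.X c : MvPolynomial ℕ k) := by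
  let f : MvPolynomial ℕ k →ₐ[k] MvPolynomial ℕ k := MvPolynomial.aeval fun m =>
    if m = a then MvPolynomial.X a + MvPolynomial.X c else MvPolynomial.X m
  let g : MvPolynomial ℕ k →ₐ[k] MvPolynomial ℕ k := MvPolynomial.aeval fun m =>
    if m = a then MvPolynomial.X a - MvPolynomial.X c else MvPolynomial.X m
  have hgf : g.comp f = AlgHom.id k _ := by
    apply MvPolynomial.algHom_ext
    intro m
    simp only [f, g, AlgHom.comp_apply, MvPolynomial.aeval_X, AlgHom.id_apply]
    by_cases hm : m = a
    · rw [if_pos hm, map_add, MvPolynomial.aeval_X, MvPolynomial.aeval_X, if_pos rfl,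
        if_neg h.symm, hm]
      ring
    · rw [if_neg hm, MvPolynomial.aeval_X, if_neg hm]
  have hf : Function.Injective f := by
    intro p q hpq
    have := congrArg g hpq
    rwa [← AlgHom.comp_apply, ← AlgHom.comp_apply, hgf] at this
  have hfx : f (MvPolynomial.X a - MvPolynomial.X c) = MvPolynomial.X a := by
    rw [map_sub]
    simp only [f, MvPolynomial.aeval_X, if_true]
    rw [if_neg h.symm]
    ring
  have hreg : IsLeftRegular (MvPolynomial.X a - MvPolynomial.X c : MvPolynomial ℕ k) := by
    intro p q hpq
    apply hf
    apply (MvPolynomial.isRegular_X (n := a)).left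
    have := congrArg f hpq
    simpa only [map_mul, hfx] using this
  exact isLeftRegular_iff_isRegular.1 hreg

lemma isUnit_scalarX_sub [IsFractionRing (MvPolynomial ℕ k) K] {a c : ℕ} (h : a ≠ c) :
    IsUnit (scalarX k K a - scalarX k K c) := by
  rw [scalarX, scalarX, ← map_sub]
  exact IsLocalization.map_units (M := nonZeroDivisors (MvPolynomial ℕ k)) _
    ⟨_, (isRegular_X_sub_X h).mem_nonZeroDivisors⟩

/-- The monomials in some of the variables are linearly independent over `k`. -/
lemma linearIndependent_monomials [IsFractionRing (MvPolynomial ℕ k) K] [Algebra k K]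
    [IsScalarTower k (MvPolynomial ℕ k) K] {b : ℕ} {f : Fin b → ℕ} (hf : Function.Injective f) :
    LinearIndependent k fun a : Fin b → ℕ => ∏ i, scalarX k K (f i) ^ a i := by
  let e : (Fin b → ℕ) → (ℕ →₀ ℕ) := fun a => ∑ i, Finsupp.single (f i) (a i)
  have he : Function.Injective e := by
    intro a a' h
    funext i
    have := DFunLike.congr_fun h (f i)
    simpa [e, Finsupp.finsetSum_apply, Finsupp.single_apply, hf.eq_iff] using this
  have h1 := (MvPolynomial.basisMonomials ℕ k).linearIndependent.comp e he
  have h2 := h1.map_injOn ((IsScalarTower.toAlgHom k (MvPolynomial ℕ k) K).toLinearMap)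
    (IsFractionRing.injective (MvPolynomial ℕ k) K).injOn
  convert h2 using 2 with a
  simp only [Function.comp_apply, MvPolynomial.coe_basisMonomials, AlgHom.toLinearMap_apply,
    IsScalarTower.coe_toAlgHom', e, scalarX]
  rw [MvPolynomial.monomial_sum_one, map_prod]
  refine Finset.prod_congr rfl fun i _ => ?_
  rw [← map_pow, MvPolynomial.X_pow_eq_monomial]

end Scalars

section GenericData

variable (k K : Type*) [CommRing k] [CommRing K] [Algebra (MvPolynomial ℕ k) K]
  [IsFractionRing (MvPolynomial ℕ k) K] {b r : ℕ} (κ : Comp b r)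

open Classical in
/-- The creation operator of a black strand, given by its position in `1_κ`. -/
noncomputable def labelCreation (a : ℕ) :
    (Finset (Fin b) → K) →ₗ[K] (Finset (Fin b) → K) :=
  if h : ∃ i, blackPos κ i = a then creation K h.choose else 0

lemma labelCreation_blackPos (i : Fin b) :
    labelCreation K κ (blackPos κ i) = creation K i := by
  have h : ∃ j, blackPos κ j = blackPos κ i := ⟨i, rfl⟩
  rw [labelCreation, dif_pos h, (blackPos_strictMono κ).injective h.choose_spec]

/-- The data of the generic representation: a black strand acts by its own variable, and nailing
it creates a fermion. -/
noncomputable def genericData : RepData K (Finset (Fin b) → K) where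
  x := scalarX k K
  d a c := Ring.inverse (scalarX k K a - scalarX k K c)
  d_mul h := Ring.inverse_mul_cancel _ (isUnit_scalarX_sub k K h)
  eta := labelCreation K κ
  eta_sq a Φ := by
    unfold labelCreation
    split_ifs
    · exact creation_sq _ _
    · rfl
  eta_anti a c Φ := by
    unfold labelCreation
    split_ifs
    · exact creation_anti _ _ _
    all_goals simp only [LinearMap.zero_apply, LinearMap.map_zero, neg_zero]

end GenericData

/-! ### Linear independence -/

section Extension

variable {b r : ℕ} {κ ρ : Comp b r}

/-- The permutation of `ℕ` that extends `w` by the identity. -/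
def extendPerm {n : ℕ} (w : Equiv.Perm (Fin n)) : Equiv.Perm ℕ :=
  w.extendDomain Fin.equivSubtype

lemma extendPerm_fin {n : ℕ} (w : Equiv.Perm (Fin n)) (p : Fin n) :
    extendPerm w p = w p :=
  w.extendDomain_apply_image Fin.equivSubtype p

lemma extendPerm_of_le {n : ℕ} (w : Equiv.Perm (Fin n)) {p : ℕ} (hp : n ≤ p) :
    extendPerm w p = p :=
  w.extendDomain_apply_not_subtype Fin.equivSubtype (not_lt.2 hp)

lemma extendPerm_injective {n : ℕ} :
    Function.Injective (extendPerm : Equiv.Perm (Fin n) → Equiv.Perm ℕ) := by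
  intro w w' h
  ext p
  rw [← extendPerm_fin, ← extendPerm_fin, h]

lemma labels_one (κ : Comp b r) : Labels κ κ 1 := ⟨fun _ _ => rfl, fun _ => rfl⟩

lemma labels_extendPerm {w : Equiv.Perm (Fin (b + r))} (hw : w ∈ redOrdered κ ρ) :
    Labels κ ρ (extendPerm w) := by
  refine ⟨fun p hp => extendPerm_of_le w hp, fun j => ?_⟩
  rw [extendPerm_fin w ⟨redPos ρ j, redPos_lt ρ j⟩, redOrdered_redPos hw]

lemma crossings_of_nailedStrands_eq_nil {v : List Block} (h : nailedStrands v = []) :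
    crossings (v.flatMap Block.letters) = blockCrossings v := by
  induction v with
  | nil => rfl
  | cons a v ih =>
    cases a with
    | cross i => exact congrArg (i :: ·) (ih h)
    | theta p => exact absurd h (List.cons_ne_nil _ _)

/-- Every arrangement of the coloured strands is reached from `1_κ` by a legal diagram. -/
lemma exists_path_extendPerm {w : Equiv.Perm (Fin (b + r))} (hw : w ∈ redOrdered κ ρ) :
    ∃ u, Path ρ κ u ∧ permOf (crossings u) = extendPerm w := by
  obtain ⟨v, hv⟩ := exists_isNailing κ w 0
  refine ⟨_, hv.path hw, ?_⟩
  have hnil : nailedStrands v = [] := by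
    refine List.eq_nil_iff_forall_not_mem.2 fun s hs => ?_
    obtain ⟨i, hi, -⟩ := (hv.nailed s).1 hs
    exact zero_ne_one hi
  rw [crossings_of_nailedStrands_eq_nil hnil]
  ext p
  by_cases hp : p < b + r
  · rw [hv.leftAdjusted.1.1.2 ⟨p, hp⟩, extendPerm_fin w ⟨p, hp⟩]
  · rw [permOf_of_le hv.leftAdjusted.1.1.1 (not_lt.1 hp), extendPerm_of_le w (not_lt.1 hp)]

end Extension

section Row

variable (k K : Type*) [CommRing k] [CommRing K] [Algebra (MvPolynomial ℕ k) K]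
  [IsFractionRing (MvPolynomial ℕ k) K] {b r : ℕ} (N : Fin r → ℕ) (κ : Comp b r)

variable {k K N κ} in
lemma isUnit_coeffSwap {a c : ℕ} (hac : a ≠ c) (h : ¬ (IsRed κ a ∧ IsRed κ c)) :
    IsUnit (coeffSwap (genericData k K κ) N κ a c) := by
  unfold coeffSwap
  split_ifs with h1 h2 h2
  · exact (h ⟨h1, h2⟩).elim
  · exact (isUnit_scalarX k K c).pow _
  · exact isUnit_one
  · exact IsUnit.of_mul_eq_one _ ((genericData k K κ).d_mul hac)

variable [Algebra k K]

open Classical in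
/-- The function that takes the value `Φ` at `π` and vanishes elsewhere. -/
noncomputable def deltaAt {V : Type*} [AddCommGroup V] (π : Equiv.Perm ℕ) (Φ : V) :
    Equiv.Perm ℕ → V :=
  fun σ => if σ = π then Φ else 0

lemma deltaAt_self {V : Type*} [AddCommGroup V] (π : Equiv.Perm ℕ) (Φ : V) :
    deltaAt π Φ π = Φ := if_pos rfl

lemma deltaAt_of_ne {V : Type*} [AddCommGroup V] {π σ : Equiv.Perm ℕ} (h : σ ≠ π) (Φ : V) :
    deltaAt π Φ σ = 0 := if_neg h

/-- The vector on which the representation is evaluated: the arrangement `1_κ` without nails. -/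
noncomputable def vacuum : labelled K (Finset (Fin b) → K) κ :=
  ⟨deltaAt 1 (Pi.single ∅ 1), fun π hπ => deltaAt_of_ne
    (fun h : π = 1 => hπ κ (h ▸ labels_one κ)) _⟩

/-- The map `t ↦ vacuum · t`. -/
noncomputable def row : T k b N →ₗ[k] labelled K (Finset (Fin b) → K) κ where
  toFun t := (rep k (genericData k K κ) N κ t).unop (vacuum K κ)
  map_add' s t := by rw [map_add, MulOpposite.unop_add, LinearMap.add_apply]
  map_smul' c t := by
    rw [map_smul, MulOpposite.unop_smul, LinearMap.smul_apply, RingHom.id_apply]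

lemma row_mul (s t : T k b N) :
    row k K N κ (s * t) = (rep k (genericData k K κ) N κ t).unop (row k K N κ s) := by
  simp only [row, LinearMap.coe_mk, AddHom.coe_mk]
  rw [map_mul, MulOpposite.unop_mul, Module.End.mul_apply]

lemma row_one : row k K N κ 1 = vacuum K κ := by
  simp only [row, LinearMap.coe_mk, AddHom.coe_mk]
  rw [map_one, MulOpposite.unop_one, Module.End.one_apply]

/-- The `K`-span of the image of `row`. -/
noncomputable def rowSpan : Submodule K (labelled K (Finset (Fin b) → K) κ) :=
  Submodule.span K (Set.range (row k K N κ))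

variable {k K N κ}

lemma rep_mem_rowSpan {φ : labelled K (Finset (Fin b) → K) κ} (h : φ ∈ rowSpan k K N κ)
    (t : T k b N) : (rep k (genericData k K κ) N κ t).unop φ ∈ rowSpan k K N κ := by
  induction h using Submodule.span_induction with
  | mem φ hφ =>
    obtain ⟨s, rfl⟩ := hφ
    rw [← row_mul]
    exact Submodule.subset_span ⟨_, rfl⟩
  | zero => rw [map_zero]; exact Submodule.zero_mem _
  | add φ ψ _ _ h h' => rw [map_add]; exact Submodule.add_mem _ h h'
  | smul c φ _ h => rw [map_smul]; exact Submodule.smul_mem _ c h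

variable (k N κ) in
/-- The function supported at `π` with value `Φ` is a `K`-combination of vectors `vacuum · t`. -/
def Reach (π : Equiv.Perm ℕ) (Φ : Finset (Fin b) → K) : Prop :=
  ∃ φ ∈ rowSpan k K N κ, (φ : Equiv.Perm ℕ → Finset (Fin b) → K) = deltaAt π Φ

/-- A crossing combines an arrangement with the one where the two strands are exchanged; the
coefficient of the latter is invertible. -/
lemma Reach.mul_sw {π : Equiv.Perm ℕ} {Φ : Finset (Fin b) → K} (h : Reach k N κ π Φ) {i : ℕ}
    (hi : i + 1 < b + r) (hred : ¬ (IsRed κ (π i) ∧ IsRed κ (π (i + 1)))) :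
    Reach k N κ (π * sw i) Φ := by
  obtain ⟨φ, hφ, e⟩ := h
  have hne : π (i + 1) ≠ π i := label_ne π (by omega)
  obtain ⟨c, hc⟩ := isUnit_coeffSwap (k := k) (K := K) (N := N) hne fun h => hred ⟨h.2, h.1⟩
  refine ⟨(c⁻¹ : Kˣ).1 • ((rep k (genericData k K κ) N κ (piece k N (Letter.cross i))).unop φ -
    coeffSame (genericData k K κ) κ (π i) (π (i + 1)) • φ),
    Submodule.smul_mem _ _ (Submodule.sub_mem _ (rep_mem_rowSpan hφ _)
      (Submodule.smul_mem _ _ hφ)), ?_⟩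
  rw [rep_piece]
  funext σ
  have hσ : (((c⁻¹ : Kˣ).1 • (endPiece (genericData k K κ) N κ (Letter.cross i) φ -
      coeffSame (genericData k K κ) κ (π i) (π (i + 1)) • φ) : labelled K _ κ) :
      Equiv.Perm ℕ → Finset (Fin b) → K) σ = (c⁻¹ : Kˣ).1 • (opC (genericData k K κ) N κ i
      (φ : Equiv.Perm ℕ → Finset (Fin b) → K) σ -
      coeffSame (genericData k K κ) κ (π i) (π (i + 1)) •
        (φ : Equiv.Perm ℕ → Finset (Fin b) → K) σ) := rfl
  rw [hσ, e, opC, if_pos hi]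
  have hsw : π * sw i ≠ π := fun h => by
    have := mul_sw_left π i
    rw [h] at this
    exact hne this.symm
  by_cases h1 : σ = π
  · subst h1
    rw [deltaAt_self, deltaAt_of_ne hsw, deltaAt_of_ne hsw.symm, smul_zero, add_zero, sub_self,
      smul_zero]
  by_cases h2 : σ = π * sw i
  · subst h2
    rw [mul_sw_sw, deltaAt_self, deltaAt_self, deltaAt_of_ne hsw, mul_sw_left, mul_sw_right,
      ← hc, smul_zero, smul_zero, zero_add, sub_zero, smul_smul, Units.inv_mul, one_smul]
  · have h3 : σ * sw i ≠ π := fun h => h2 (by rw [← h, mul_sw_sw])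
    rw [deltaAt_of_ne h1, deltaAt_of_ne h2, deltaAt_of_ne h3, smul_zero, smul_zero, smul_zero,
      add_zero, sub_zero, smul_zero]

lemma reach_mul_sw_iff {π : Equiv.Perm ℕ} {Φ : Finset (Fin b) → K} {i : ℕ}
    (hi : i + 1 < b + r) (hred : ¬ (IsRed κ (π i) ∧ IsRed κ (π (i + 1)))) :
    Reach k N κ (π * sw i) Φ ↔ Reach k N κ π Φ := by
  refine ⟨fun h => ?_, fun h => h.mul_sw hi hred⟩
  have := h.mul_sw hi (by rw [mul_sw_left, mul_sw_right]; exact fun h => hred ⟨h.2, h.1⟩)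
  rwa [mul_sw_sw] at this

lemma reach_path_iff {ρ κ' : Comp b r} {u : List Letter} (hu : Path ρ κ' u)
    {π : Equiv.Perm ℕ} (hπ : Labels κ κ' π) (Φ : Finset (Fin b) → K) :
    Reach k N κ (π * permOf (crossings u)) Φ ↔ Reach k N κ π Φ := by
  induction u generalizing κ' π with
  | nil => exact Iff.rfl
  | cons a u ih =>
    obtain ⟨κ'', hu', ha⟩ := hu
    cases a with
    | dot p =>
      obtain ⟨-, rfl⟩ := ha
      exact ih hu' hπ
    | nail =>
      obtain ⟨-, rfl⟩ := ha
      exact ih hu' hπ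
    | cross i =>
      obtain ⟨hi, hred, h⟩ := ha
      have h' : ∀ j, redPos κ'' j = Equiv.swap i (i + 1) (redPos κ' j) := fun j => by
        rw [h j, Equiv.swap_apply_self]
      have hred' : ¬ (IsRed κ (π i) ∧ IsRed κ (π (i + 1))) := by
        rw [hπ.isRed, hπ.isRed, isRed_swap h, isRed_swap h]
        simpa [and_comm] using hred
      change Reach k N κ (π * permOf (i :: crossings u)) Φ ↔ _
      rw [permOf_cons, ← mul_assoc, ih hu' (hπ.mul_sw hi h'), reach_mul_sw_iff hi hred']

lemma Reach.nail {π : Equiv.Perm ℕ} {Φ : Finset (Fin b) → K} (h : Reach k N κ π Φ)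
    (h0 : 0 < b + r) (hb : ¬ IsRed κ (π 0)) : Reach k N κ π (labelCreation K κ (π 0) Φ) := by
  obtain ⟨φ, hφ, e⟩ := h
  refine ⟨_, rep_mem_rowSpan hφ (piece k N Letter.nail), ?_⟩
  rw [rep_piece]
  change opN (genericData k K κ) κ (φ : Equiv.Perm ℕ → Finset (Fin b) → K) = _
  rw [e]
  funext σ
  by_cases hσ : σ = π
  · subst hσ
    rw [opN_black _ h0 hb, deltaAt_self, deltaAt_self]
    rfl
  · simp only [opN, deltaAt_of_ne hσ, LinearMap.map_zero, ite_self]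

/-- A black strand can be moved to the front. -/
lemma exists_front (p : ℕ) {π : Equiv.Perm ℕ} {κ' : Comp b r} (hπ : Labels κ κ' π)
    (hp : IsBlack κ' p) : ∃ π' : Equiv.Perm ℕ, π' 0 = π p ∧
      ∀ Φ : Finset (Fin b) → K, Reach k N κ π' Φ ↔ Reach k N κ π Φ := by
  induction p generalizing π κ' with
  | zero => exact ⟨π, rfl, fun _ => Iff.rfl⟩
  | succ p ih =>
    have hred : ¬ (IsRed κ' p ∧ IsRed κ' (p + 1)) := fun h => hp.2 h.2
    obtain ⟨ρ', hρ'⟩ := exists_comp_swap κ' hp.1 hred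
    have hb := (black_labels hπ hp).2
    have h' := hπ.mul_sw hp.1 hρ'
    obtain ⟨π', h0, h⟩ := ih h' ⟨by have := hp.1; omega, by
      rw [← h'.isRed, mul_sw_left]
      exact hb⟩
    refine ⟨π', by rw [h0, mul_sw_left], fun Φ => ?_⟩
    rw [h, reach_mul_sw_iff hp.1 fun h => hb h.2]

lemma reach_one (S : Finset (Fin b)) : Reach k N κ 1 (Pi.single S (1 : K)) := by
  induction S using Finset.induction_on with
  | empty => exact ⟨_, Submodule.subset_span ⟨1, rfl⟩, by rw [row_one]; rfl⟩
  | insert i S hi ih =>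
    have hb := isBlack_blackPos κ i
    obtain ⟨π, h0, h⟩ := exists_front (k := k) (K := K) (N := N) _ (labels_one κ) hb
    have h0' : π 0 = blackPos κ i := h0
    have := ((h _).2 ih).nail (by have := hb.1; omega) (by rw [h0']; exact hb.2)
    rw [h0', labelCreation_blackPos, creation_single hi, h] at this
    obtain ⟨φ, hφ, e⟩ := this
    obtain ⟨c, hc⟩ := isUnit_orderSign (K := K) i (insert i S)
    refine ⟨(c⁻¹ : Kˣ).1 • φ, Submodule.smul_mem _ _ hφ, ?_⟩
    rw [SetLike.val_smul, e, ← hc]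
    funext σ
    rw [Pi.smul_apply]
    by_cases hσ : σ = 1
    · rw [hσ, deltaAt_self, deltaAt_self, smul_smul, Units.inv_mul, one_smul]
    · rw [deltaAt_of_ne hσ, deltaAt_of_ne hσ, smul_zero]

lemma reach_extendPerm {ρ : Comp b r} {w : Equiv.Perm (Fin (b + r))} (hw : w ∈ redOrdered κ ρ)
    (S : Finset (Fin b)) : Reach k N κ (extendPerm w) (Pi.single S (1 : K)) := by
  obtain ⟨u, hu, e⟩ := exists_path_extendPerm hw
  have := (reach_path_iff (k := k) (K := K) (N := N) hu (labels_one κ) (Pi.single S 1)).2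
    (reach_one S)
  rwa [one_mul, e] at this

end Row

section Independence

variable {k K : Type*} [CommRing k] [CommRing K] [Algebra (MvPolynomial ℕ k) K]
  [IsFractionRing (MvPolynomial ℕ k) K] [Algebra k K] {b r : ℕ} {N : Fin r → ℕ} {κ ρ : Comp b r}

variable (K κ ρ) in
/-- The values of a function at the arrangements with the colours of `1_ρ`. -/
def evalAt : labelled K (Finset (Fin b) → K) κ →ₗ[K] (redOrdered κ ρ × Finset (Fin b) → K) where
  toFun φ x := (φ : Equiv.Perm ℕ → Finset (Fin b) → K) (extendPerm x.1.1) x.2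
  map_add' _ _ := rfl
  map_smul' _ _ := rfl

lemma row_idem_mul (t : T k b N) : row k K N κ (idem k N κ * t) = row k K N κ t := by
  rw [row_mul, ← one_mul t, row_mul, one_mul]
  congr 1
  apply Subtype.ext
  rw [row_one, ← one_mul (idem k N κ), row_mul, row_one, rep_idem]
  funext π
  by_cases h : Labels κ κ π
  · rw [opE_pos h]
  · rw [opE_neg h]
    exact (deltaAt_of_ne (fun e : π = 1 => h (e ▸ labels_one κ)) _).symm

lemma evalAt_row_corner (t : T k b N) :
    evalAt K κ ρ (row k K N κ (corner k N κ ρ t)) = evalAt K κ ρ (row k K N κ t) := by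
  rw [corner_apply, row_mul, row_idem_mul]
  funext x
  change ((rep k (genericData k K κ) N κ (idem k N ρ)).unop (row k K N κ t) :
    Equiv.Perm ℕ → Finset (Fin b) → K) _ _ = _
  rw [rep_idem, opE_pos (labels_extendPerm x.1.2)]
  rfl

/-- Dots at the top act on the vacuum by scalars. -/
lemma row_dot_mul (i : Fin b) (m : ℕ) (t : T k b N) :
    row k K N κ (piece k N (Letter.dot (blackPos κ i)) ^ m * t) =
      scalarX k K (blackPos κ i) ^ m • row k K N κ t := by
  induction m with
  | zero => rw [pow_zero, pow_zero, one_mul, one_smul]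
  | succ m ih =>
    have hvac : row k K N κ (piece k N (Letter.dot (blackPos κ i))) =
        scalarX k K (blackPos κ i) • row k K N κ 1 := by
      rw [← one_mul (piece k N _), row_mul, row_one, rep_piece]
      apply Subtype.ext
      change opX (genericData k K κ) κ (blackPos κ i) (deltaAt 1 (Pi.single ∅ 1)) =
        scalarX k K (blackPos κ i) • deltaAt 1 (Pi.single ∅ 1)
      funext π
      by_cases hπ : π = 1
      · subst hπ
        have hb := isBlack_blackPos κ i
        rw [opX_black _ hb.1 hb.2]
        rfl
      · rw [opX, Pi.smul_apply, deltaAt_of_ne hπ, smul_zero, smul_zero]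
    rw [pow_succ', mul_assoc, row_mul, hvac, LinearMap.map_smul, ← row_mul, one_mul, ih, smul_smul,
      pow_succ']

lemma row_basisWord (v : List Block) (a : Fin b → ℕ) :
    row k K N κ (diagram k N ρ (basisWord κ v a)) =
      (∏ i, scalarX k K (blackPos κ i) ^ a i) •
        row k K N κ (diagram k N ρ (v.flatMap Block.letters)) := by
  have key : ∀ L : List (Fin b),
      row k K N κ (diagram k N ρ ((L.map fun i =>
        List.replicate (a i) (Letter.dot (blackPos κ i))).flatten ++
          v.flatMap Block.letters)) =
      (L.map fun i => scalarX k K (blackPos κ i) ^ a i).prod •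
        row k K N κ (diagram k N ρ (v.flatMap Block.letters)) := by
    intro L
    induction L with
    | nil => simp
    | cons i L ih =>
      rw [List.map_cons, List.flatten_cons, List.append_assoc, diagram_replicate_dot, row_dot_mul,
        ih, smul_smul, List.map_cons, List.prod_cons]
  have := key (List.finRange b)
  rw [← List.ofFn_eq_map, ← List.ofFn_eq_map, List.prod_ofFn] at this
  exact this

variable {v : redOrdered κ ρ → (Fin b → Fin 2) → List Block}

/-- The vectors given by the basis elements without dots generate all functions on the
arrangements with the colours of `1_ρ`. -/
lemma span_evalAt_row
    (hv : ∀ (w : redOrdered κ ρ) (l : Fin b → Fin 2), IsNailing κ w.1 l (v w l)) :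
    Submodule.span K (Set.range fun x : redOrdered κ ρ × (Fin b → Fin 2) =>
      evalAt K κ ρ (row k K N κ (diagram k N ρ ((v x.1 x.2).flatMap Block.letters)))) = ⊤ := by
  classical
  set P := Submodule.span K (Set.range fun x : redOrdered κ ρ × (Fin b → Fin 2) =>
    evalAt K κ ρ (row k K N κ (diagram k N ρ ((v x.1 x.2).flatMap Block.letters)))) with hP
  have h1 : ∀ t ∈ Submodule.span k (Set.range
      (fun x : BasisIndex κ ρ => diagram k N ρ (basisWord κ (v x.1 x.2.1) x.2.2))),
      evalAt K κ ρ (row k K N κ t) ∈ P := by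
    intro t ht
    induction ht using Submodule.span_induction with
    | mem t ht =>
      obtain ⟨x, rfl⟩ := ht
      simp only [row_basisWord, LinearMap.map_smul]
      exact P.smul_mem _ (Submodule.subset_span ⟨(x.1, x.2.1), rfl⟩)
    | zero => rw [map_zero, map_zero]; exact P.zero_mem
    | add s t _ _ h h' => rw [map_add, map_add]; exact P.add_mem h h'
    | smul c t _ h =>
      rw [LinearMap.map_smul, ← algebraMap_smul K c, LinearMap.map_smul]
      exact P.smul_mem _ h
  have h2 : ∀ t, evalAt K κ ρ (row k K N κ t) ∈ P := fun t => by
    rw [← evalAt_row_corner]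
    apply h1
    rw [span_eq_range hv]
    exact ⟨t, rfl⟩
  have h3 : ∀ φ ∈ rowSpan k K N κ, evalAt K κ ρ φ ∈ P := by
    intro φ hφ
    have : rowSpan k K N κ ≤ P.comap (evalAt K κ ρ) := by
      refine Submodule.span_le.2 ?_
      rintro _ ⟨t, rfl⟩
      exact h2 t
    exact this hφ
  rw [eq_top_iff]
  intro f _
  rw [pi_eq_sum_univ f]
  refine P.sum_mem fun x _ => P.smul_mem _ ?_
  obtain ⟨φ, hφ, e⟩ := reach_extendPerm (k := k) (K := K) (N := N) x.1.2 x.2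
  convert h3 φ hφ using 1
  funext y
  change _ = (φ : Equiv.Perm ℕ → Finset (Fin b) → K) (extendPerm y.1.1) y.2
  rw [e]
  by_cases h : y.1 = x.1
  · rw [h, deltaAt_self, Pi.single_apply]
    congr 1
    rw [eq_iff_iff]
    exact ⟨fun e => e ▸ rfl, fun e => Prod.ext h.symm e.symm⟩
  · rw [deltaAt_of_ne fun e => h (Subtype.ext (extendPerm_injective e)), if_neg]
    · rfl
    · rintro rfl
      exact h rfl

lemma linearIndependent_basis
    (hv : ∀ (w : redOrdered κ ρ) (l : Fin b → Fin 2), IsNailing κ w.1 l (v w l)) :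
    LinearIndependent k
      (fun x : BasisIndex κ ρ => diagram k N ρ (basisWord κ (v x.1 x.2.1) x.2.2)) := by
  classical
  nontriviality k
  let K := FractionRing (MvPolynomial ℕ k)
  have : Nontrivial K :=
    (IsFractionRing.injective (MvPolynomial ℕ k) K).nontrivial
  have : Fintype (redOrdered κ ρ) := Fintype.ofFinite _
  -- as many generators as the rank of the free module that they generate
  have hK : LinearIndependent K fun x : redOrdered κ ρ × (Fin b → Fin 2) =>
      evalAt K κ ρ (row k K N κ (diagram k N ρ ((v x.1 x.2).flatMap Block.letters))) := by
    refine linearIndependent_of_top_le_span_of_card_eq_finrank (span_evalAt_row hv).ge ?_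
    rw [Module.finrank_fintype_fun_eq_card]
    simp only [Fintype.card_prod, Fintype.card_finset, Fintype.card_pi, Fintype.card_fin,
      Finset.prod_const, Finset.card_univ]
  have hmon : LinearIndependent k fun a : Fin b → ℕ => ∏ i, scalarX k K (blackPos κ i) ^ a i :=
    linearIndependent_monomials k K (blackPos_strictMono κ).injective
  have h := linearIndependent_smul hmon hK
  let e : BasisIndex κ ρ → (Fin b → ℕ) × (redOrdered κ ρ × (Fin b → Fin 2)) :=
    fun x => (x.2.2, (x.1, x.2.1))
  have he : Function.Injective e := fun x y hxy => by
    simp only [e, Prod.mk.injEq] at hxy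
    exact Prod.ext hxy.2.1 (Prod.ext hxy.2.2 hxy.1)
  have h' := h.comp e he
  refine LinearIndependent.of_comp ((evalAt K κ ρ).restrictScalars k ∘ₗ row k K N κ) ?_
  convert h' using 1
  funext x
  change evalAt K κ ρ (row k K N κ _) = _
  rw [row_basisWord, LinearMap.map_smul]
  rfl

end Independence

end KLRW

open KLRW in
theorem mainTheorem4 {k : Type*} [CommRing k] (b r : ℕ) (N : Fin r → ℕ) (κ ρ : Comp b r) :
    -- the construction of the elements `b_{w,l,a}` can be carried out
    (∀ w ∈ redOrdered κ ρ, ∀ l : Fin b → Fin 2, ∃ v : List Block, IsNailing κ w l v) ∧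
    -- whatever the choices made in it,
    ∀ v : redOrdered κ ρ → (Fin b → Fin 2) → List Block,
      (∀ (w : redOrdered κ ρ) (l : Fin b → Fin 2), IsNailing κ w.1 l (v w l)) →
      -- the elements `b_{w,l,a}` form a `k`-basis of `1_κ T 1_ρ`
      LinearIndependent k
        (fun x : BasisIndex κ ρ => diagram k N ρ (basisWord κ (v x.1 x.2.1) x.2.2)) ∧
      Submodule.span k (Set.range
        (fun x : BasisIndex κ ρ => diagram k N ρ (basisWord κ (v x.1 x.2.1) x.2.2))) =
          LinearMap.range (corner k N κ ρ) ∧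
      -- and this basis is graded: those of degree `g` span `1_κ T_g 1_ρ`, for every `g`
      ∀ g : ℤ × ℤ × ℤ,
        Submodule.span k
          ((fun x : BasisIndex κ ρ => diagram k N ρ (basisWord κ (v x.1 x.2.1) x.2.2)) ''
            {x | diagramDeg N ρ (basisWord κ (v x.1 x.2.1) x.2.2) = g}) =
          (homogeneousPart k b N g).map (corner k N κ ρ) := by
  refine ⟨fun w _ l => exists_isNailing κ w l, fun v hv => ?_⟩
  exact ⟨linearIndependent_basis hv, span_eq_range hv, span_degree_eq hv⟩
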